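/- **Model.** Pico base stations (BSs) form a homogeneous Poisson point process $\Phi_2$ of density $\lambda_2>0$ in $\mathbb R^2$, and the typical user is at the origin. The BSs carry independent marks: each $x\in\Phi_2$ stores the $f$-th file with probability $p_{2,f}\in(0,1]$, has a fading power $|h_x|^2\sim\mathrm{Gamma}$ with shape $N_2^p$ and mean $1$ ($N_2^p\ge 1$ an integer), and has an angle $\omega_x$ uniform on $[-\tfrac d\lambda,\tfrac d\lambda]$ ($d,\lambda>0$). The marks are mutually independent and independent of $\Phi_2$. The array gain is $G_2(\omega)=\frac{\sin^2(\pi N_2\omega)}{N_2^2\sin^2(\pi\omega)}$ with $N_2\ge1$ an integer (and $G_2(\omega)=1$, by continuity, for $\omega\in\mathbb Z$). The path loss is $L_2(v)=C_2v^{-\alpha_2}$ for $v\le R_L$ and $L_2(v)=0$ for $v>R_L$, with $C_2,R_L>0$, and the transmit power is $P_2>0$. Let $x_0$ be the BS nearest to the origin among those storing the $f$-th file, and let $$I=\sum_{x\in\Phi_2\setminus\{x_0\}}P_2L_2(\|x\|)\,N_2|h_x|^2G_2(\omega_x)$$ be the pico-tier interference. For $s,\tau\ge0$ and $0<r\le R_L$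 write $$\mathcal L_2(s,\tau)=\mathbb E\Big[\exp\Big(-\tfrac{s\tau}{P_2C_2N_2}\,I\Big)\,\Big|\,\|x_0\|=r\Big]$$ for its Laplace transform, taken with respect to a regular conditional distribution of $I$ given $\|x_0\|$. **Lemma 1.** For almost every $r\in(0,R_L]$ and all $s,\tau\ge 0$, $$\mathcal L_2(s,\tau)=\lim_{u_1\to\infty}\exp\Big(-\pi\lambda_2(R_L^2-p_{2,f}r^2)-\frac{\pi^2\lambda_2}{2u_1}\sum_{k_1=1}^{u_1}W_f\big(\tfrac{x_{k_1}d}{\lambda},s,\tau\big)\sqrt{1-x_{k_1}^2}\Big),\qquad x_{k_1}=\cos\Big(\frac{2k_1-1}{2u_1}\pi\Big),$$ where $W_f$ is given as follows, with $X=\frac{sG_2(\omega)\tau}{N_2^p}$. 1. If $\alpha_2>2$, then $$W_f(\omega,s,\tau)=p_{2,f}\,S_2^0\big(X r^{-\alpha_2}\big)r^2+(1-p_{2,f})\,\Delta_2(X)-S_2^0\big(XR_L^{-\alpha_2}\big)R_L^2 ,$$ where $S_2^0(z)={}_2F_1\big(-\tfrac2{\alpha_2},N_2^p;1-\tfrac2{\alpha_2};-z\big)$,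 with ${}_2F_1$ the (analytically continued) Gauss hypergeometric function, and $\Delta_2(z)=\Gamma\big(1-\tfrac2{\alpha_2}\big)\Gamma\big(N_2^p+\tfrac2{\alpha_2}\big)\Gamma(N_2^p)^{-1}z^{2/\alpha_2}$. 2. If $\alpha_2=2$, then $$W_f(\omega,s,\tau)=X\Big(F_y\big(X/R_L^2\big)-p_{2,f}F_y\big(X/r^2\big)\Big)$$ (to be read as its limit $p_{2,f}r^2-R_L^2$ where $X=0$), where $$F_y(y)=N_2^p\ln\Big(1+\frac1y\Big)-\frac1{y(1+y)^{N_2^p-1}}-\sum_{m=1}^{N_2^p-1}\frac{N_2^p}{(1+y)^{N_2^p-m}(N_2^p-m)} .$$ -/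

import Mathlib

open MeasureTheory ProbabilityTheory Filter Topology

noncomputable section

namespace HetNet

/-- The plane in which the base stations (BSs) are placed; the typical user is at the origin. -/
abbrev Plane : Type := EuclideanSpace ℝ (Fin 2)

/-- Deterministic parameters of the pico tier, for a catalogue of `Nc` files. -/
structure Params (Nc : ℕ) where
  /-- density of the pico BSs -/
  lam : ℝ
  /-- radius of the line-of-sight ball -/
  RL : ℝ
  /-- path loss exponent -/
  α : ℝ
  /-- path loss intercept -/
  C : ℝ
  /-- transmit power -/
  P : ℝ
  /-- number of antenna elements of a pico BS -/
  Nant : ℕ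
  /-- Nakagami fading parameter -/
  Nnak : ℕ
  /-- antenna spacing -/
  d : ℝ
  /-- wavelength -/
  wl : ℝ
  /-- `p f` is the probability that a pico BS stores the file `f` -/
  p : Fin Nc → ℝ
  lam_pos : 0 < lam
  RL_pos : 0 < RL
  C_pos : 0 < C
  P_pos : 0 < P
  Nant_pos : 0 < Nant
  Nnak_pos : 0 < Nnak
  d_pos : 0 < d
  wl_pos : 0 < wl
  p_nonneg : ∀ f, 0 ≤ p f
  p_le_one : ∀ f, p f ≤ 1

/-- The random objects of the pico tier: an enumeration of the points of the process of BS
locations and, for the `n`-th BS, the set of files it stores, the fading power `|h|²` on its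
link to the typical user, and the spatial angle entering its array gain. -/
structure PicoTier (Ω : Type*) (Nc : ℕ) where
  loc : ℕ → Ω → Plane
  cache : ℕ → Ω → Set (Fin Nc)
  fading : ℕ → Ω → ℝ
  angle : ℕ → Ω → ℝ

/-- `X 0, X 1, …` enumerates the points of a homogeneous Poisson point process of density `lam`
on the plane: the number of points in a bounded Borel set `A` is Poisson with mean
`lam * volume A`, and the numbers of points in disjoint bounded Borel sets are independent. -/
structure IsHPPP {Ω : Type*} [MeasurableSpace Ω] (μ : Measure Ω) (lam : ℝ)
    (X : ℕ → Ω → Plane) : Prop where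
  measurable : ∀ n, Measurable (X n)
  poisson : ∀ A : Set Plane, MeasurableSet A → Bornology.IsBounded A → ∀ k : ℕ,
    μ {ω | {n | X n ω ∈ A}.encard = k} =
      poissonMeasure (lam * (volume A).toReal).toNNReal {k}
  indep : ∀ (m : ℕ) (A : Fin m → Set Plane), (∀ i, MeasurableSet (A i)) →
    (∀ i, Bornology.IsBounded (A i)) → Pairwise (fun i j => Disjoint (A i) (A j)) →
    iIndepFun (fun i ω => {n | X n ω ∈ A i}.encard) μ

/-- The independent sources of randomness: the whole point process, and the marks of each BS. -/
inductive Source : Type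
  | locations : Source
  | cache (n : ℕ) : Source
  | fading (n : ℕ) : Source
  | angle (n : ℕ) : Source

/-- The σ-algebra generated by a source of randomness. -/
@[reducible] def PicoTier.sigma {Ω : Type*} {Nc : ℕ} (T : PicoTier Ω Nc) : Source → MeasurableSpace Ω
  | .locations => ⨆ n, MeasurableSpace.comap (T.loc n) inferInstance
  | .cache n => MeasurableSpace.comap (T.cache n) inferInstance
  | .fading n => MeasurableSpace.comap (T.fading n) inferInstance
  | .angle n => MeasurableSpace.comap (T.angle n) inferInstance

/-- The probabilistic model: BSs form a homogeneous Poisson point process, and are independently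
marked with their cache content, a normalized Gamma fading power and a uniform angle. -/
structure IsPicoTier {Ω : Type*} [MeasurableSpace Ω] (μ : Measure Ω) {Nc : ℕ} (Q : Params Nc)
    (T : PicoTier Ω Nc) : Prop where
  hppp : IsHPPP μ Q.lam T.loc
  cache_measurable : ∀ n, Measurable (T.cache n)
  fading_measurable : ∀ n, Measurable (T.fading n)
  angle_measurable : ∀ n, Measurable (T.angle n)
  cache_law : ∀ n f, μ {ω | f ∈ T.cache n ω} = ENNReal.ofReal (Q.p f)
  fading_law : ∀ n, μ.map (T.fading n) = gammaMeasure (Q.Nnak : ℝ) (Q.Nnak : ℝ)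
  angle_law : ∀ n, pdf.IsUniform (T.angle n) (Set.Icc (-(Q.d / Q.wl)) (Q.d / Q.wl)) μ volume
  indep : iIndep T.sigma μ

/-- Array gain of a uniform linear array with `N` elements,
`sin² (π N w) / (N² sin² (π w))`, with the limit value `1` where the denominator vanishes. -/
def arrayGain (N : ℕ) (w : ℝ) : ℝ :=
  if Real.sin (Real.pi * w) = 0 then 1
  else Real.sin (Real.pi * N * w) ^ 2 / ((N : ℝ) ^ 2 * Real.sin (Real.pi * w) ^ 2)

/-- Path loss law `U(R_L - v) C v^(-α)` of the line-of-sight ball model. -/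
def pathLoss {Nc : ℕ} (Q : Params Nc) (v : ℝ) : ℝ :=
  if 0 ≤ Q.RL - v then Q.C * v ^ (-Q.α) else 0

/-- The `n`-th BS is the serving one: it is nearest to the user among those storing `f`. -/
def PicoTier.IsServing {Ω : Type*} {Nc : ℕ} (T : PicoTier Ω Nc) (f : Fin Nc) (n : ℕ)
    (ω : Ω) : Prop :=
  f ∈ T.cache n ω ∧ ∀ m, f ∈ T.cache m ω → ‖T.loc n ω‖ ≤ ‖T.loc m ω‖

/-- Distance from the typical user to the nearest BS storing the file `f`. -/
def PicoTier.servingDist {Ω : Type*} {Nc : ℕ} (T : PicoTier Ω Nc) (f : Fin Nc) (ω : Ω) : ℝ :=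
  sInf {v | ∃ n, f ∈ T.cache n ω ∧ v = ‖T.loc n ω‖}

open Classical in
/-- Interference at the typical user: the power received from all pico BSs (whether or not they
store `f`) other than the serving one. -/
def PicoTier.interference {Ω : Type*} {Nc : ℕ} (T : PicoTier Ω Nc) (Q : Params Nc)
    (f : Fin Nc) (ω : Ω) : ℝ :=
  ∑' n, if T.IsServing f n ω then 0
    else Q.P * pathLoss Q ‖T.loc n ω‖ *
      (Q.Nant * T.fading n ω * arrayGain Q.Nant (T.angle n ω))

/-- Laplace transform `E[exp(-s τ I / (P C N)) | ‖x₀‖ = r]` of the interference `I` (normalized by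
transmit power, intercept and array size), given that the serving BS is at distance `r`. -/
def laplaceInterference {Ω : Type*} [MeasurableSpace Ω] (μ : Measure Ω) [IsProbabilityMeasure μ]
    {Nc : ℕ} (Q : Params Nc) (T : PicoTier Ω Nc) (f : Fin Nc) (r s τ : ℝ) : ℝ :=
  ∫ y, Real.exp (-(s * τ / (Q.P * Q.C * Q.Nant)) * y)
    ∂(condDistrib (T.interference Q f) (T.servingDist f) μ r)

open Classical in
/-- Gauss hypergeometric function on the half-line `(-∞, 1)`: the analytic continuation of the
hypergeometric series (it is unique, the half-line being connected). -/
def gaussHyp (a b c : ℝ) : ℝ → ℝ :=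
  if h : ∃ F : ℝ → ℝ, AnalyticOnNhd ℝ F (Set.Iio 1) ∧
      ∀ x ∈ Set.Ioo (-1 : ℝ) 1, F x = ordinaryHypergeometric a b c x
  then h.choose else 0

/-- `S^k(z) = ₂F₁(k - 2/α, k + N; k + 1 - 2/α; -z)`. -/
def hypS (α : ℝ) (N k : ℕ) (z : ℝ) : ℝ :=
  gaussHyp (k - 2 / α) (k + N) (k + 1 - 2 / α) (-z)

/-- `Δ(z) = Γ(1 - 2/α) Γ(N + 2/α) Γ(N)⁻¹ z^(2/α)`. -/
def gammaDelta (α : ℝ) (N : ℕ) (z : ℝ) : ℝ :=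
  Real.Gamma (1 - 2 / α) * Real.Gamma (N + 2 / α) * (Real.Gamma N)⁻¹ * z ^ (2 / α)

/-- The argument `s G(w) τ / N^p`. -/
def argX {Nc : ℕ} (Q : Params Nc) (w s τ : ℝ) : ℝ :=
  s * arrayGain Q.Nant w * τ / Q.Nnak

/-- `W_f(w, s, τ)` in the case `α > 2`. -/
def Wgt {Nc : ℕ} (Q : Params Nc) (f : Fin Nc) (r w s τ : ℝ) : ℝ :=
  Q.p f * hypS Q.α Q.Nnak 0 (argX Q w s τ / r ^ Q.α) * r ^ 2
    + (1 - Q.p f) * gammaDelta Q.α Q.Nnak (argX Q w s τ)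
    - hypS Q.α Q.Nnak 0 (argX Q w s τ / Q.RL ^ Q.α) * Q.RL ^ 2

/-- `F_y(y)` for the fading parameter `N`. -/
def Fy (N : ℕ) (y : ℝ) : ℝ :=
  N * Real.log (1 + 1 / y) - 1 / (y * (1 + y) ^ (N - 1))
    - ∑ m ∈ Finset.Icc 1 (N - 1), (N : ℝ) / ((1 + y) ^ (N - m) * ((N : ℝ) - m))

/-- `W_f(w, s, τ)` in the case `α = 2`. Where `s G(w) τ = 0`, so that the expression reads
`0 · ∞`, it has its limit value `p r² - R_L²`. -/
def Weq {Nc : ℕ} (Q : Params Nc) (f : Fin Nc) (r w s τ : ℝ) : ℝ :=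
  if argX Q w s τ = 0 then Q.p f * r ^ 2 - Q.RL ^ 2
  else argX Q w s τ *
    (Fy Q.Nnak (argX Q w s τ / Q.RL ^ 2) - Q.p f * Fy Q.Nnak (argX Q w s τ / r ^ 2))

/-- Gauss–Chebyshev node `cos ((2k - 1) π / (2u))`. -/
def chebNode (u k : ℕ) : ℝ := Real.cos ((2 * k - 1) / (2 * u) * Real.pi)

/-- The closed form with `u` quadrature nodes, for a given function `W` of the angle. -/
def closedForm {Nc : ℕ} (Q : Params Nc) (f : Fin Nc) (r : ℝ) (W : ℝ → ℝ) (u : ℕ) : ℝ :=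
  Real.exp (-(Real.pi * Q.lam * (Q.RL ^ 2 - Q.p f * r ^ 2))
    - Real.pi ^ 2 * Q.lam / (2 * u) *
      ∑ k ∈ Finset.Icc 1 u, W (chebNode u k * Q.d / Q.wl) * Real.sqrt (1 - chebNode u k ^ 2))

end HetNet

end

/-! Write D for the serving distance, I for the interference, κ for the argument of its Laplace
transform, p for the probability of storing f and q(x) for the mean of exp(-κ · received power) of a
BS at x. The core claim is E[exp(-κ I) | D = r] = exp(-λ₂ E(κ, r)), with E(κ, b) = ∫ (1 - p 1{‖x‖ ≤
b}) (1 - q(x)) dx (`interfExponent`).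

No Palm calculus is used. Let U_b (`PicoTier.background`) be the power received from all BSs except
those storing f within distance b. The functional 1{no BS storing f within a} exp(-κ U_b) is a
product over the BSs. Averaging the independent marks (`integral_finprod_marked`) and applying the
Poisson generating functional (`IsHPPP.integral_finprod`) gives exp(-λ₂ p π a²) exp(-λ₂ E(κ, b)) for
a ≤ b. Subtracting the case a = b yields E[exp(-κ U_b); a < D ≤ b] = P(a < D ≤ b) exp(-λ₂ E(κ, b)).

On {a < D ≤ b} the powers I and U_b agree unless the annulus (a, b] holds two BSs, an event of
probability O((b - a)²). Replacing E(κ, b) by E(κ, D) also costs O((b - a)²). Hence b ↦ E[exp(-κ I)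
- exp(-λ₂ E(κ, D)); 0 < D ≤ b] has quadratically small increments, so it is constant, equal to 0
(`IsPicoTier.setIntegral_exp_interference`). This identifies the conditional expectation almost
everywhere for each κ, and for all κ at once through rational κ and continuity.

It remains to compute E. The Gamma law, the uniform angle and polar coordinates reduce it to J(x, v)
= ∫₀ᵛ 2t (1 + x t^(-α))^(-N) dt (`radialInt`), and W_f = p J(X, r) - J(X, R_L). Explicit primitives
give J: a hypergeometric one for α > 2, whose boundary value at t = 0 is Δ, and F_y for α = 2, whose
boundary value is 0. The angular average of W_f is the limit of its Gauss–Chebyshev sums, which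
become midpoint sums under x = cos θ. -/

noncomputable section

namespace HetNet

/-! ### Continuity of the array gain, and Gauss–Chebyshev sums as midpoint sums. -/

section Quadrature

/-- The array gain is a polynomial in `cos (π w)`. -/
lemma arrayGain_eq_chebyshev {N : ℕ} (hN : 0 < N) (w : ℝ) :
    arrayGain N w =
      ((Polynomial.Chebyshev.U ℝ (N - 1 : ℤ)).eval (Real.cos (Real.pi * w)) / N) ^ 2 := by
  have hN' : (N : ℝ) ≠ 0 := by positivity
  have key := Polynomial.Chebyshev.U_real_cos (Real.pi * w) (N - 1 : ℤ)
  unfold arrayGain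
  split_ifs with h
  -- At the removable singularities cos (π w) = ±1, where U_{N-1} equals ±N; the square is the
  -- assigned value 1. Elsewhere U_{N-1}(cos θ) sin θ = sin (N θ).
  · rcases Real.sin_eq_zero_iff_cos_eq.1 h with h | h
    · rw [h, Polynomial.Chebyshev.U_eval_one]
      push_cast
      rw [sub_add_cancel, div_self hN', one_pow]
    · rw [h, Polynomial.Chebyshev.U_eval_neg_one]
      push_cast
      rw [sub_add_cancel, mul_div_assoc, div_self hN', mul_one]
      rcases Int.even_or_odd (N - 1 : ℤ) with h | h
      · simp [Int.negOnePow_even _ h]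
      · simp [Int.negOnePow_odd _ h]
  · push_cast at key
    rw [sub_add_cancel] at key
    rw [show Real.pi * N * w = N * (Real.pi * w) by ring, ← key]
    field_simp

lemma continuous_arrayGain {N : ℕ} (hN : 0 < N) : Continuous (arrayGain N) := by
  rw [funext (arrayGain_eq_chebyshev hN)]
  fun_prop

lemma arrayGain_nonneg (N : ℕ) (w : ℝ) : 0 ≤ arrayGain N w := by
  unfold arrayGain
  split_ifs <;> positivity

/-- Midpoint Riemann sums of a continuous function converge to its integral. -/
lemma tendsto_midpoint_sum {h : ℝ → ℝ} (hc : Continuous h) {L : ℝ} (hL : 0 < L) :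
    Tendsto (fun u : ℕ => L / u * ∑ k ∈ Finset.Icc 1 u, h ((2 * k - 1) / (2 * u) * L)) atTop
      (𝓝 (∫ x in (0 : ℝ)..L, h x)) := by
  have huc : UniformContinuousOn h (Set.Icc 0 L) :=
    isCompact_Icc.uniformContinuousOn_of_continuous hc.continuousOn
  rw [Metric.uniformContinuousOn_iff_le] at huc
  rw [Metric.tendsto_atTop]
  intro ε hε
  -- An oscillation of ε / (2L) on each cell, over total length L, leaves an error of at most ε / 2.
  obtain ⟨δ, hδ, H⟩ := huc (ε / (2 * L)) (by positivity)
  obtain ⟨n, hn⟩ := exists_nat_gt (L / δ)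
  refine ⟨n + 1, fun u hu => ?_⟩
  have hu0 : (0 : ℝ) < u := by exact_mod_cast (by omega : 0 < u)
  have hmesh : L / u ≤ δ := by
    rw [div_le_iff₀ hu0]
    rw [div_lt_iff₀ hδ] at hn
    have : (n : ℝ) ≤ u := by exact_mod_cast (by omega : n ≤ u)
    nlinarith
  have hsplit : ∫ x in (0 : ℝ)..L, h x =
      ∑ k ∈ Finset.range u, ∫ x in ((k : ℕ) : ℝ) * (L / u)..((k + 1 : ℕ) : ℝ) * (L / u), h x := by
    rw [intervalIntegral.sum_integral_adjacent_intervals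
      (a := fun k : ℕ => (k : ℝ) * (L / u)) fun k _ => hc.intervalIntegrable _ _]
    simp only [Nat.cast_zero, zero_mul]
    rw [mul_div_cancel₀ _ hu0.ne']
  have hsum : ∑ k ∈ Finset.Icc 1 u, h ((2 * k - 1) / (2 * u) * L) =
      ∑ k ∈ Finset.range u, h ((2 * (k + 1 : ℕ) - 1) / (2 * u) * L) := by
    rw [Finset.range_eq_Ico, Finset.sum_Ico_add' (fun k : ℕ => h ((2 * k - 1) / (2 * u) * L)) 0 u 1]
    rfl
  rw [hsplit, hsum, Finset.mul_sum, dist_eq_norm, ← Finset.sum_sub_distrib]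
  have hterm : ∀ k ∈ Finset.range u,
      ‖L / u * h ((2 * (k + 1 : ℕ) - 1) / (2 * u) * L) -
        ∫ x in ((k : ℕ) : ℝ) * (L / u)..((k + 1 : ℕ) : ℝ) * (L / u), h x‖ ≤
        ε / (2 * L) * (L / u) := by
    intro k hk
    have hk' : (k : ℝ) + 1 ≤ u := by exact_mod_cast Finset.mem_range.1 hk
    have hLu : 0 < L / u := by positivity
    -- After the shift k ↦ k + 1, the node is the midpoint of the cell from k L / u to (k + 1) L /
    -- u.
    have hmid : (2 * ((k + 1 : ℕ) : ℝ) - 1) / (2 * u) * L = (k + 1 / 2) * (L / u) := by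
      push_cast
      field_simp
      ring
    have hle : ((k : ℕ) : ℝ) * (L / u) ≤ ((k + 1 : ℕ) : ℝ) * (L / u) := by
      push_cast
      nlinarith
    have htop : ((k : ℝ) + 1) * (L / u) ≤ L := by
      calc ((k : ℝ) + 1) * (L / u) ≤ u * (L / u) := by gcongr
        _ = L := mul_div_cancel₀ _ hu0.ne'
    have hconst : L / u * h ((2 * (k + 1 : ℕ) - 1) / (2 * u) * L) =
        ∫ _ in ((k : ℕ) : ℝ) * (L / u)..((k + 1 : ℕ) : ℝ) * (L / u),
          h ((2 * (k + 1 : ℕ) - 1) / (2 * u) * L) := by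
      rw [intervalIntegral.integral_const, smul_eq_mul]
      push_cast
      ring
    rw [hconst, ← intervalIntegral.integral_sub (by simp) (hc.intervalIntegrable _ _)]
    refine (intervalIntegral.norm_integral_le_of_norm_le_const (C := ε / (2 * L)) ?_).trans ?_
    · intro x hx
      rw [Set.uIoc_of_le hle] at hx
      obtain ⟨hx1, hx2⟩ := hx
      push_cast at hx2
      rw [hmid, ← dist_eq_norm]
      have hk0 : (0 : ℝ) ≤ k := by positivity
      refine H _ ⟨by positivity, ?_⟩ _ ⟨?_, hx2.trans htop⟩ ?_
      · nlinarith
      · exact (by positivity : (0 : ℝ) ≤ k * (L / u)).trans hx1.le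
      · rw [Real.dist_eq, abs_le]
        constructor <;> nlinarith
    · rw [abs_of_nonneg (by linarith)]
      push_cast
      apply le_of_eq
      ring
  calc ‖∑ k ∈ Finset.range u, (L / u * h ((2 * (k + 1 : ℕ) - 1) / (2 * u) * L) -
        ∫ x in ((k : ℕ) : ℝ) * (L / u)..((k + 1 : ℕ) : ℝ) * (L / u), h x)‖
      ≤ ∑ _k ∈ Finset.range u, ε / (2 * L) * (L / u) := norm_sum_le_of_le _ hterm
    _ = ε / 2 := by
      rw [Finset.sum_const, Finset.card_range, nsmul_eq_mul]
      field_simp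
    _ < ε := by linarith

/-- Convergence of Gauss–Chebyshev quadrature for the unweighted integral. -/
lemma tendsto_chebNode_sum {g : ℝ → ℝ} (hg : Continuous g) :
    Tendsto (fun u : ℕ => Real.pi / u *
      ∑ k ∈ Finset.Icc 1 u, g (chebNode u k) * Real.sqrt (1 - chebNode u k ^ 2)) atTop
      (𝓝 (∫ x in (-1 : ℝ)..1, g x)) := by
  -- Under x = cos θ the weight √(1 - x²) is the Jacobian sin θ, and the Chebyshev nodes become the
  -- midpoints of u equal cells of [0, π].
  have hint : ∫ x in (-1 : ℝ)..1, g x =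
      ∫ θ in (0 : ℝ)..Real.pi, g (Real.cos θ) * Real.sqrt (1 - Real.cos θ ^ 2) := by
    have h1 := intervalIntegral.integral_comp_mul_deriv (a := 0) (b := Real.pi) (g := g)
      (fun x _ => Real.hasDerivAt_cos x) (by fun_prop) hg
    rw [Real.cos_zero, Real.cos_pi] at h1
    rw [intervalIntegral.integral_symm, ← h1, ← intervalIntegral.integral_neg]
    refine intervalIntegral.integral_congr fun θ hθ => ?_
    rw [Set.uIcc_of_le Real.pi_pos.le] at hθ
    have hs : Real.sqrt (1 - Real.cos θ ^ 2) = Real.sin θ := by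
      rw [← Real.sin_sq, Real.sqrt_sq (Real.sin_nonneg_of_nonneg_of_le_pi hθ.1 hθ.2)]
    simp [hs]
  rw [hint]
  exact tendsto_midpoint_sum (h := fun θ => g (Real.cos θ) * Real.sqrt (1 - Real.cos θ ^ 2))
    (by fun_prop) Real.pi_pos

/-- `∫₀ᵛ 2 t (1 + x t^(-α))^(-N) dt`. -/
def radialInt (α : ℝ) (N : ℕ) (x v : ℝ) : ℝ :=
  ∫ t in (0 : ℝ)..v, 2 * t * ((1 + x * t ^ (-α)) ^ N)⁻¹

lemma radial_factor_mem {α : ℝ} (N : ℕ) {x t : ℝ} (hx : 0 ≤ x) (ht : 0 ≤ t) :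
    0 ≤ ((1 + x * t ^ (-α)) ^ N)⁻¹ ∧ ((1 + x * t ^ (-α)) ^ N)⁻¹ ≤ 1 := by
  have h : 0 ≤ x * t ^ (-α) := mul_nonneg hx (Real.rpow_nonneg ht _)
  exact ⟨by positivity, inv_le_one_of_one_le₀ (one_le_pow₀ (by linarith))⟩

lemma radialInt_zero_left (α : ℝ) (N : ℕ) (v : ℝ) : radialInt α N 0 v = v ^ 2 := by
  simp only [radialInt, zero_mul, add_zero, one_pow, inv_one, mul_one]
  rw [intervalIntegral.integral_const_mul, integral_id]
  ring

/-- Dominated convergence: for x ≥ 0 the integrand is at most 2v. This makes W_f continuous in the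
angle, including at the zeros of the gain, where the closed forms degenerate. -/
lemma continuous_radialInt_comp {α : ℝ} (N : ℕ) {x : ℝ → ℝ} (hx : Continuous x)
    (hx0 : ∀ w, 0 ≤ x w) {v : ℝ} (hv : 0 ≤ v) : Continuous fun w => radialInt α N (x w) v := by
  unfold radialInt
  refine intervalIntegral.continuous_of_dominated_interval (bound := fun _ => 2 * v) ?_ ?_ ?_ ?_
  · intro w
    exact Measurable.aestronglyMeasurable (by fun_prop)
  · intro w
    refine Eventually.of_forall fun t ht => ?_
    rw [Set.uIoc_of_le hv] at ht
    have := radial_factor_mem (α := α) N (hx0 w) ht.1.le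
    rw [Real.norm_eq_abs, abs_of_nonneg (mul_nonneg (by linarith [ht.1]) this.1)]
    nlinarith [ht.1, ht.2, this.1, this.2]
  · simp
  · refine Eventually.of_forall fun t ht => ?_
    rw [Set.uIoc_of_le hv] at ht
    refine continuous_const.mul (Continuous.inv₀ (by fun_prop) fun w => ?_)
    have : 0 ≤ x w * t ^ (-α) := mul_nonneg (hx0 w) (Real.rpow_nonneg ht.1.le _)
    positivity

end Quadrature

/-! ### An integral formula for the analytic continuation of ₂F₁(-δ, m; 1 - δ; x) to x < 1. -/

section Hypergeometric

/-- `∫₀¹ t^(-δ) (1 - t x)^(-(m+1)) dt`. -/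
def eulerInt (δ : ℝ) (m : ℕ) (x : ℝ) : ℝ :=
  ∫ t in (0 : ℝ)..1, t ^ (-δ) * ((1 - t * x) ^ (m + 1))⁻¹

/-- An integral representation of `₂F₁(-δ, m; 1 - δ; x)`, valid for `x < 1`. -/
def hypEuler (δ : ℝ) (m : ℕ) (x : ℝ) : ℝ :=
  ((1 - x) ^ m)⁻¹ - m * x * eulerInt δ m x

/-- The power series reaches only |x| < 1, while the continuation is needed on all of (-∞, 1).
Holomorphy on the half-plane Re z < 1, by differentiation under the integral, supplies analyticity
there. -/
lemma differentiableAt_complex_eulerInt {δ : ℝ} (hδ : δ < 1) (m : ℕ) {z₀ : ℂ} (hz₀ : z₀.re < 1) :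
    DifferentiableAt ℂ
      (fun z : ℂ => ∫ t in (0 : ℝ)..1, ((t ^ (-δ) : ℝ) : ℂ) * ((1 - t * z) ^ (m + 1))⁻¹) z₀ := by
  -- The number ρ lies halfway between Re z₀ and 1. For Re z < ρ and 0 < t ≤ 1, the real part of 1 -
  -- t z is at least 1 if Re z ≤ 0 and at least 1 - ρ otherwise; c is the smaller of the two bounds.
  set ρ : ℝ := (1 + z₀.re) / 2 with hρ
  set c : ℝ := min 1 (1 - ρ) with hc
  have hρ1 : ρ < 1 := by linarith
  have hc0 : 0 < c := lt_min one_pos (by linarith)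
  have hrp : IntervalIntegrable (fun t : ℝ => t ^ (-δ)) volume 0 1 :=
    intervalIntegral.intervalIntegrable_rpow' (by linarith)
  have hlow : ∀ t ∈ Set.uIoc (0 : ℝ) 1, ∀ z : ℂ, z.re < ρ → c ≤ ‖1 - t * z‖ := by
    intro t ht z hz
    rw [Set.uIoc_of_le zero_le_one] at ht
    have h1 : (1 - t * z).re ≤ ‖1 - t * z‖ := Complex.re_le_norm _
    have h2 : (1 - t * z : ℂ).re = 1 - t * z.re := by simp
    rw [h2] at h1
    refine le_trans ?_ h1
    rcases le_or_gt z.re 0 with h | h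
    · exact (min_le_left _ _).trans (by nlinarith [ht.1])
    · exact (min_le_right _ _).trans (by nlinarith [ht.1, ht.2])
  have hmeas : ∀ (z : ℂ) (j : ℕ), Measurable
      fun t : ℝ => ((t ^ (-δ) : ℝ) : ℂ) * ((1 - t * z) ^ j)⁻¹ := by
    intro z j
    fun_prop
  refine (intervalIntegral.hasDerivAt_integral_of_dominated_loc_of_deriv_le (𝕜 := ℂ)
    (F' := fun z t => ((t ^ (-δ) : ℝ) : ℂ) * ((m + 1 : ℕ) * t * ((1 - t * z) ^ (m + 2))⁻¹))
    (s := {z : ℂ | z.re < ρ}) (bound := fun t => t ^ (-δ) * ((m + 1 : ℕ) * (c ^ (m + 2))⁻¹))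
    ?_ ?_ ?_ ?_ ?_ ?_ ?_).2.differentiableAt
  · exact (isOpen_lt Complex.continuous_re continuous_const).mem_nhds
      (by simp only [Set.mem_ofPred_eq]; linarith)
  · exact Eventually.of_forall fun z => (hmeas z _).aestronglyMeasurable
  · rw [intervalIntegrable_iff] at hrp ⊢
    refine (hrp.mul_const ((c ^ (m + 1))⁻¹)).mono' (hmeas z₀ _).aestronglyMeasurable ?_
    refine (ae_restrict_mem measurableSet_uIoc).mono fun t ht => ?_
    have ht' := ht
    rw [Set.uIoc_of_le zero_le_one] at ht'
    have := hlow t ht z₀ (by linarith)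
    rw [norm_mul, Complex.norm_real, Real.norm_of_nonneg (Real.rpow_nonneg ht'.1.le _), norm_inv,
      norm_pow]
    gcongr
    exact Real.rpow_nonneg ht'.1.le _
  · exact Measurable.aestronglyMeasurable (by fun_prop)
  · refine Eventually.of_forall fun t ht z hz => ?_
    have ht' := ht
    rw [Set.uIoc_of_le zero_le_one] at ht'
    have := hlow t ht z hz
    rw [norm_mul, Complex.norm_real, Real.norm_of_nonneg (Real.rpow_nonneg ht'.1.le _), norm_mul,
      norm_mul, norm_inv, norm_pow, Complex.norm_natCast, Complex.norm_real,
      Real.norm_of_nonneg ht'.1.le]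
    have h1 : ((m + 1 : ℕ) : ℝ) * t ≤ (m + 1 : ℕ) := mul_le_of_le_one_right (by positivity) ht'.2
    have h2 : 0 ≤ t := ht'.1.le
    gcongr
  · exact hrp.mul_const _
  · refine Eventually.of_forall fun t ht z hz => ?_
    have hne : (1 - t * z : ℂ) ≠ 0 := by
      intro h
      have := hlow t ht z hz
      rw [h, norm_zero] at this
      linarith
    have h1 : HasDerivAt (fun z : ℂ => 1 - t * z) (-(t : ℂ)) z := by
      simpa using ((hasDerivAt_id z).const_mul (t : ℂ)).const_sub 1
    refine (((h1.pow (m + 1)).inv (pow_ne_zero _ hne)).const_mul _).congr_deriv ?_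
    congr 1
    field_simp
    simp
    ring

lemma analyticOnNhd_hypEuler {δ : ℝ} (hδ : δ < 1) (m : ℕ) :
    AnalyticOnNhd ℝ (hypEuler δ m) (Set.Iio 1) := by
  have hE : AnalyticOnNhd ℝ (eulerInt δ m) (Set.Iio 1) := by
    intro x hx
    have hopen : IsOpen {z : ℂ | z.re < 1} := isOpen_lt Complex.continuous_re continuous_const
    have hd : DifferentiableOn ℂ
        (fun z : ℂ => ∫ t in (0 : ℝ)..1, ((t ^ (-δ) : ℝ) : ℂ) * ((1 - t * z) ^ (m + 1))⁻¹)
        {z : ℂ | z.re < 1} :=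
      fun z hz => (differentiableAt_complex_eulerInt hδ m hz).differentiableWithinAt
    have := (hd.analyticOnNhd hopen (x : ℂ) (by simpa using hx)).re_ofReal
    convert this using 1
    ext y
    rw [eulerInt]
    have : (fun t : ℝ => ((t ^ (-δ) : ℝ) : ℂ) * ((1 - t * (y : ℂ)) ^ (m + 1))⁻¹) =
        fun t : ℝ => ((t ^ (-δ) * ((1 - t * y) ^ (m + 1))⁻¹ : ℝ) : ℂ) := by
      ext t
      push_cast
      rfl
    rw [this, intervalIntegral.integral_ofReal, Complex.ofReal_re]
  intro x hx
  have hx' : (1 - x) ^ m ≠ 0 := pow_ne_zero _ (by simp only [Set.mem_Iio] at hx; linarith)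
  exact (((analyticAt_const.sub analyticAt_id).pow m).inv hx').sub
    ((analyticAt_const.mul analyticAt_id).mul (hE x hx))

/-- Expand (1 - t x)^(-(m+1)) in the negative binomial series and integrate termwise, using ∫₀¹
t^(n-δ) dt = 1 / (n + 1 - δ). The same series at |x| dominates. -/
lemma hasSum_eulerInt {δ : ℝ} (hδ : δ < 1) (m : ℕ) {x : ℝ} (hx : |x| < 1) :
    HasSum (fun n : ℕ => ((n + m).choose m : ℝ) * x ^ n / (n + 1 - δ)) (eulerInt δ m x) := by
  have hexp : ∀ n : ℕ, ∀ t ∈ Set.Ioc (0 : ℝ) 1,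
      t ^ (-δ) * (((n + m).choose m : ℝ) * (t * x) ^ n) =
        ((n + m).choose m : ℝ) * x ^ n * t ^ (n - δ) := by
    intro n t ht
    rw [sub_eq_add_neg, Real.rpow_add ht.1, Real.rpow_natCast, mul_pow]
    ring
  have hval : ∀ n : ℕ, ∫ t in (0 : ℝ)..1, t ^ ((n : ℝ) - δ) = 1 / (n + 1 - δ) := by
    intro n
    have hn : (0 : ℝ) ≤ n := by positivity
    rw [integral_rpow (Or.inl (by linarith)), Real.one_rpow, Real.zero_rpow (by linarith)]
    ring_nf
  have hsum := hasSum_integral_of_summable_integral_norm (μ := volume.restrict (Set.Ioc (0:ℝ) 1))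
    (F := fun (n : ℕ) (t : ℝ) => t ^ (-δ) * (((n + m).choose m : ℝ) * (t * x) ^ n)) ?_ ?_
  · have h1 : ∀ n : ℕ, ∫ t in Set.Ioc (0 : ℝ) 1, t ^ (-δ) * (((n + m).choose m : ℝ) * (t * x) ^ n)
        = ((n + m).choose m : ℝ) * x ^ n / (n + 1 - δ) := by
      intro n
      rw [setIntegral_congr_fun measurableSet_Ioc (hexp n), integral_const_mul,
        ← intervalIntegral.integral_of_le zero_le_one, hval n]
      ring
    simp only [h1] at hsum
    suffices h : eulerInt δ m x = ∫ t in Set.Ioc (0 : ℝ) 1,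
        ∑' n : ℕ, t ^ (-δ) * (((n + m).choose m : ℝ) * (t * x) ^ n) by rwa [h]
    rw [eulerInt, intervalIntegral.integral_of_le zero_le_one]
    refine setIntegral_congr_fun measurableSet_Ioc fun t ht => ?_
    have htx : ‖t * x‖ < 1 := by
      rw [norm_mul, Real.norm_of_nonneg ht.1.le, Real.norm_eq_abs]
      exact (mul_le_of_le_one_left (abs_nonneg _) ht.2).trans_lt hx
    simp only [tsum_mul_left]
    rw [tsum_choose_mul_geometric_of_norm_lt_one m htx, one_div]
  · intro n
    have hn : (0 : ℝ) ≤ n := by positivity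
    refine IntegrableOn.congr_fun ?_ (fun t ht => (hexp n t ht).symm) measurableSet_Ioc
    have := intervalIntegral.intervalIntegrable_rpow' (a := 0) (b := 1)
      (r := (n : ℝ) - δ) (by linarith)
    rw [intervalIntegrable_iff_integrableOn_Ioc_of_le zero_le_one] at this
    exact this.const_mul _
  · have h1 : ∀ n : ℕ,
        ∫ t in Set.Ioc (0 : ℝ) 1, ‖t ^ (-δ) * (((n + m).choose m : ℝ) * (t * x) ^ n)‖
        = ((n + m).choose m : ℝ) * |x| ^ n / (n + 1 - δ) := by
      intro n
      have : ∀ t ∈ Set.Ioc (0 : ℝ) 1, ‖t ^ (-δ) * (((n + m).choose m : ℝ) * (t * x) ^ n)‖ =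
          ((n + m).choose m : ℝ) * |x| ^ n * t ^ (n - δ) := by
        intro t ht
        rw [hexp n t ht, norm_mul, norm_mul, norm_pow, Real.norm_natCast,
          Real.norm_of_nonneg (Real.rpow_nonneg ht.1.le _), Real.norm_eq_abs]
      rw [setIntegral_congr_fun measurableSet_Ioc this, integral_const_mul,
        ← intervalIntegral.integral_of_le zero_le_one, hval n]
      ring
    simp only [h1]
    have hs : Summable fun n : ℕ => ((n + m).choose m : ℝ) * |x| ^ n :=
      summable_choose_mul_geometric_of_norm_lt_one m (by simpa using hx)
    refine Summable.of_nonneg_of_le (fun n => ?_) (fun n => ?_) (hs.mul_right (1 / (1 - δ)))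
    · have hn : (0 : ℝ) ≤ n := by positivity
      exact div_nonneg (by positivity) (by linarith)
    · have hn : (0 : ℝ) ≤ n := by positivity
      rw [div_eq_mul_one_div]
      have : 0 < 1 - δ := by linarith
      gcongr
      linarith

/-- Both sides are the rising factorial of a of length n + 1. With a = -δ this evaluates the ratio
of the Pochhammer symbols of -δ and 1 - δ. -/
lemma ascPochhammer_eval_mul_add {K : Type*} [CommRing K] (a : K) (n : ℕ) :
    (ascPochhammer K n).eval a * (a + n) = a * (ascPochhammer K n).eval (a + 1) := by
  induction n with
  | zero => simp
  | succ n ih =>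
    rw [ascPochhammer_succ_eval, ascPochhammer_succ_eval, ih]
    push_cast
    ring

/-- Euler's integral would have the divergent kernel t^(-δ-1); `hypEuler` is its form after one
integration by parts. On coefficients, (-δ)_n / (1-δ)_n = -δ / (n - δ) = 1 - n / (n - δ): the 1 sums
to (1 - x)^(-m), and n / (n - δ) to m x `eulerInt`, with m = k + 1. -/
lemma hypEuler_eq_ordinaryHypergeometric {δ : ℝ} (hδ0 : 0 < δ) (hδ : δ < 1) (k : ℕ) {x : ℝ}
    (hx : |x| < 1) :
    hypEuler δ (k + 1) x = ordinaryHypergeometric (-δ) ((k + 1 : ℕ) : ℝ) (1 - δ) x := by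
  have hsub : ∀ n : ℕ, (n : ℝ) - δ ≠ 0 := by
    intro n h
    rcases Nat.eq_zero_or_pos n with rfl | hn
    · simp at h
      linarith
    · have : (1 : ℝ) ≤ n := by exact_mod_cast hn
      linarith
  have h1 : HasSum (fun n : ℕ => ((n + k).choose k : ℝ) * x ^ n) (1 / (1 - x) ^ (k + 1)) :=
    hasSum_choose_mul_geometric_of_norm_lt_one k (by simpa using hx)
  have h2 : HasSum (fun n : ℕ => ((n + k).choose k : ℝ) * x ^ n * (n / (n - δ)))
      ((k + 1 : ℕ) * x * eulerInt δ (k + 1) x) := by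
    -- The term n = 0 vanishes. After the shift, (n + 1) C(n+1+k, k) = (k + 1) C(n+1+k, k+1) matches
    -- the series of `eulerInt`.
    rw [← hasSum_nat_add_iff' 1]
    simp only [Finset.range_one, Finset.sum_singleton, Nat.cast_zero, zero_div, mul_zero, sub_zero]
    refine ((hasSum_eulerInt hδ (k + 1) hx).mul_left ((k + 1 : ℕ) * x)).congr_fun ?_
    intro n
    have hch : ((n + 1 + k).choose k : ℝ) * (n + 1 : ℕ) =
        (k + 1 : ℕ) * ((n + (k + 1)).choose (k + 1) : ℝ) := by
      have := Nat.choose_succ_right_eq (n + 1 + k) k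
      rw [show n + 1 + k - k = n + 1 by omega] at this
      rw [show n + (k + 1) = n + 1 + k by omega]
      have h3 : ((n + 1 + k).choose (k + 1) : ℝ) * (k + 1 : ℕ) =
          ((n + 1 + k).choose k : ℝ) * (n + 1 : ℕ) := by exact_mod_cast this
      rw [← h3]
      ring
    have hne := hsub (n + 1)
    have e : ((n + 1 : ℕ) : ℝ) - δ = n + 1 - δ := by push_cast; ring
    rw [← e]
    rw [pow_succ]
    calc ((n + 1 + k).choose k : ℝ) * (x ^ n * x) * ((n + 1 : ℕ) / ((n + 1 : ℕ) - δ))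
        = (((n + 1 + k).choose k : ℝ) * (n + 1 : ℕ)) * (x ^ n * x) / ((n + 1 : ℕ) - δ) := by ring
      _ = _ := by rw [hch]; ring
  have h3 := h1.sub h2
  rw [hypEuler, ordinaryHypergeometric_eq_tsum, ← one_div, ← h3.tsum_eq]
  refine tsum_congr fun n => ?_
  have hp := ascPochhammer_eval_mul_add (-δ) n
  rw [show -δ + 1 = 1 - δ by ring] at hp
  have hpos : (ascPochhammer ℝ n).eval (1 - δ) ≠ 0 :=
    (ascPochhammer_pos n (1 - δ) (by linarith)).ne'
  have hN : (ascPochhammer ℝ n).eval ((k + 1 : ℕ) : ℝ) =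
      (n.factorial : ℝ) * ((n + k).choose k : ℝ) := by
    rw [← ascPochhammer_eval_cast, ascPochhammer_nat_eq_ascFactorial,
      Nat.ascFactorial_eq_factorial_mul_choose, Nat.add_comm k n, Nat.choose_symm_add]
    push_cast
    rfl
  have hfac : (n.factorial : ℝ) ≠ 0 := by positivity
  have hne := hsub n
  have hev : (ascPochhammer ℝ n).eval (-δ) =
      -δ * (ascPochhammer ℝ n).eval (1 - δ) / (n - δ) := by
    rw [eq_div_iff hne, ← hp]
    ring
  rw [hN, hev, smul_eq_mul]
  field_simp
  ring

/-- `gaussHyp` is defined by choice among analytic continuations. `hypEuler` shows that one exists,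
and the identity theorem on the connected set (-∞, 1) makes the chosen one equal to it. -/
lemma gaussHyp_eq_hypEuler {δ : ℝ} (hδ0 : 0 < δ) (hδ : δ < 1) {N : ℕ} (hN : 0 < N) {x : ℝ}
    (hx : x < 1) : gaussHyp (-δ) N (1 - δ) x = hypEuler δ N x := by
  obtain ⟨k, rfl⟩ : ∃ k, N = k + 1 := ⟨N - 1, by omega⟩
  have hex : ∃ F : ℝ → ℝ, AnalyticOnNhd ℝ F (Set.Iio 1) ∧
      ∀ x ∈ Set.Ioo (-1 : ℝ) 1,
        F x = ordinaryHypergeometric (-δ) ((k + 1 : ℕ) : ℝ) (1 - δ) x :=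
    ⟨hypEuler δ (k + 1), analyticOnNhd_hypEuler hδ _, fun y hy =>
      hypEuler_eq_ordinaryHypergeometric hδ0 hδ k (abs_lt.2 hy)⟩
  rw [gaussHyp, dif_pos hex]
  refine hex.choose_spec.1.eqOn_of_preconnected_of_eventuallyEq (analyticOnNhd_hypEuler hδ _)
    isPreconnected_Iio (Set.mem_Iio.2 one_pos) ?_ hx
  filter_upwards [Ioo_mem_nhds (neg_one_lt_zero (R := ℝ)) one_pos] with y hy
  rw [hex.choose_spec.2 y hy, hypEuler_eq_ordinaryHypergeometric hδ0 hδ k (abs_lt.2 hy)]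

end Hypergeometric

/-! ### Closed forms of the radial integral for α > 2 and α = 2. -/

section RadialIntegral

/-- Write Γ(m+1) (1+s)^(-(m+1)) as ∫ y^m exp(-(1+s) y) dy and exchange the integrals: the s-integral
gives Γ(1-δ) y^(δ-1), and the remaining y-integral gives Γ(m+δ). Integrability in s comes from
Fubini as well. -/
lemma integrableOn_beta_Ioi_and_integral {δ : ℝ} (hδ0 : 0 < δ) (hδ : δ < 1) (m : ℕ) :
    IntegrableOn (fun s : ℝ => s ^ (-δ) * ((1 + s) ^ (m + 1))⁻¹) (Set.Ioi 0) ∧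
    ∫ s in Set.Ioi (0 : ℝ), s ^ (-δ) * ((1 + s) ^ (m + 1))⁻¹ =
      Real.Gamma (1 - δ) * Real.Gamma (m + δ) / Real.Gamma (m + 1) := by
  set ν : Measure ℝ := volume.restrict (Set.Ioi 0) with hν
  set F : ℝ → ℝ → ℝ := fun s y => s ^ (-δ) * (y ^ (m : ℝ) * Real.exp (-((1 + s) * y))) with hF
  have hm : (0 : ℝ) ≤ m := by positivity
  have hmem : ∀ᵐ y ∂ν, (0 : ℝ) < y := ae_restrict_mem measurableSet_Ioi
  have hFm : Measurable (Function.uncurry F) := by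
    simp only [hF, Function.uncurry_def]
    fun_prop
  have hFs : ∀ s > 0, ∫ y, F s y ∂ν = s ^ (-δ) * ((1 + s) ^ (m + 1))⁻¹ * Real.Gamma (m + 1) := by
    intro s hs
    simp only [hF]
    rw [integral_const_mul]
    have := Real.integral_rpow_mul_exp_neg_mul_Ioi (a := (m : ℝ) + 1) (r := 1 + s)
      (by linarith) (by linarith)
    simp only [add_sub_cancel_right] at this
    rw [this, one_div, Real.inv_rpow (by linarith), mul_assoc]
    congr 3
    rw [show (m : ℝ) + 1 = ((m + 1 : ℕ) : ℝ) by push_cast; rfl, Real.rpow_natCast]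
  have hFy_int : ∀ y > 0, Integrable (fun s => F s y) ν := by
    intro y hy
    have h := integrableOn_rpow_mul_exp_neg_mul_rpow (p := 1) (s := -δ) (b := y)
      (by linarith) one_pos hy
    refine (h.mul_const (y ^ (m : ℝ) * Real.exp (-y))).congr ?_
    refine Eventually.of_forall fun s => ?_
    simp only [hF, Real.rpow_one]
    rw [show -((1 + s) * y) = -y * s + -y by ring, Real.exp_add]
    ring
  have hFy : ∀ y > 0, ∫ s, F s y ∂ν = Real.Gamma (1 - δ) * (y ^ ((m : ℝ) + δ - 1) *
      Real.exp (-y)) := by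
    intro y hy
    have := Real.integral_rpow_mul_exp_neg_mul_Ioi (a := 1 - δ) (r := y) (by linarith) hy
    have e : ∀ s : ℝ, F s y = y ^ (m : ℝ) * Real.exp (-y) *
        (s ^ (1 - δ - 1) * Real.exp (-(y * s))) := by
      intro s
      simp only [hF]
      rw [show -((1 + s) * y) = -(y * s) + -y by ring, Real.exp_add,
        show 1 - δ - 1 = -δ by ring]
      ring
    simp only [e]
    rw [integral_const_mul, this, one_div, Real.inv_rpow hy.le, ← Real.rpow_neg hy.le,
      show (m : ℝ) + δ - 1 = m + -(1 - δ) by ring, Real.rpow_add hy]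
    ring
  have hnonneg : ∀ s > 0, ∀ y > 0, 0 ≤ F s y := by
    intro s hs y hy
    simp only [hF]
    positivity
  have hGint : Integrable (fun y : ℝ => y ^ ((m : ℝ) + δ - 1) * Real.exp (-y)) ν := by
    have := Real.GammaIntegral_convergent (s := (m : ℝ) + δ) (by linarith)
    exact this.congr (Eventually.of_forall fun y => mul_comm _ _)
  have hprod : Integrable (Function.uncurry F) (ν.prod ν) := by
    rw [integrable_prod_iff' hFm.aestronglyMeasurable]
    refine ⟨hmem.mono fun y hy => hFy_int y hy, ?_⟩
    refine (hGint.const_mul (Real.Gamma (1 - δ))).congr ?_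
    filter_upwards [hmem] with y hy
    rw [← hFy y hy]
    refine integral_congr_ae ?_
    filter_upwards [hmem] with s hs
    rw [Function.uncurry_apply_pair, Real.norm_of_nonneg (hnonneg s hs y hy)]
  have hG : Real.Gamma ((m : ℝ) + 1) ≠ 0 := (Real.Gamma_pos_of_pos (by linarith)).ne'
  constructor
  · have h := hprod.integral_prod_left.mul_const (Real.Gamma ((m : ℝ) + 1))⁻¹
    refine h.congr ?_
    filter_upwards [hmem] with s hs
    simp only [Function.uncurry_apply_pair]
    rw [hFs s hs, mul_assoc, mul_inv_cancel₀ hG, mul_one]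
  · have hswap := integral_integral_swap hprod
    have h1 : ∫ s, ∫ y, F s y ∂ν ∂ν =
        (∫ s in Set.Ioi (0 : ℝ), s ^ (-δ) * ((1 + s) ^ (m + 1))⁻¹) * Real.Gamma (m + 1) := by
      rw [← integral_mul_const]
      refine integral_congr_ae ?_
      filter_upwards [hmem] with s hs using hFs s hs
    have h2 : ∫ y, ∫ s, F s y ∂ν ∂ν = Real.Gamma (1 - δ) * Real.Gamma (m + δ) := by
      rw [Real.Gamma_eq_integral (s := (m : ℝ) + δ) (by linarith), ← integral_const_mul]
      refine integral_congr_ae ?_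
      filter_upwards [hmem] with y hy
      rw [hFy y hy, mul_comm (Real.exp _)]
    rw [eq_div_iff hG, ← h1, hswap, h2]

/-- The incomplete beta integral `∫₀ᶻ s^(-δ) (1+s)^(-(m+1)) ds`. -/
def incBeta (δ : ℝ) (m : ℕ) (z : ℝ) : ℝ :=
  ∫ s in (0 : ℝ)..z, s ^ (-δ) * ((1 + s) ^ (m + 1))⁻¹

lemma hasDerivAt_incBeta {δ : ℝ} (hδ0 : 0 < δ) (hδ : δ < 1) (m : ℕ) {z : ℝ} (hz : 0 < z) :
    HasDerivAt (incBeta δ m) (z ^ (-δ) * ((1 + z) ^ (m + 1))⁻¹) z := by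
  refine intervalIntegral.integral_hasDerivAt_right ?_ ?_ ?_
  · rw [intervalIntegrable_iff_integrableOn_Ioc_of_le hz.le]
    exact (integrableOn_beta_Ioi_and_integral hδ0 hδ m).1.mono_set Set.Ioc_subset_Ioi_self
  · exact (Measurable.stronglyMeasurable (by fun_prop)).stronglyMeasurableAtFilter
  · refine ContinuousAt.mul (Real.continuousAt_rpow_const _ _ (Or.inl hz.ne')) ?_
    exact ContinuousAt.inv₀ (by fun_prop) (by positivity)

/-- The substitution s = t z. -/
lemma rpow_mul_eulerInt_neg {δ : ℝ} (m : ℕ) {z : ℝ} (hz : 0 < z) :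
    z ^ (1 - δ) * eulerInt δ m (-z) = incBeta δ m z := by
  have h := intervalIntegral.integral_comp_mul_right (a := 0) (b := 1)
    (fun s : ℝ => s ^ (-δ) * ((1 + s) ^ (m + 1))⁻¹) hz.ne'
  rw [zero_mul, one_mul, smul_eq_mul] at h
  rw [incBeta, eq_comm, ← inv_mul_eq_iff_eq_mul₀ (by positivity : z ^ (1 - δ) ≠ 0)]
  have h2 : ∫ t in (0 : ℝ)..1, (t * z) ^ (-δ) * ((1 + t * z) ^ (m + 1))⁻¹ =
      z ^ (-δ) * eulerInt δ m (-z) := by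
    rw [eulerInt, ← intervalIntegral.integral_const_mul]
    refine intervalIntegral.integral_congr fun t ht => ?_
    rw [Set.uIcc_of_le zero_le_one] at ht
    simp only [mul_neg, sub_neg_eq_add]
    rw [Real.mul_rpow ht.1 hz.le]
    ring
  rw [h2] at h
  have h3 : ∫ s in (0 : ℝ)..z, s ^ (-δ) * ((1 + s) ^ (m + 1))⁻¹ =
      z * (z ^ (-δ) * eulerInt δ m (-z)) := by
    rw [h]
    field_simp
  rw [h3, show 1 - δ = 1 + -δ by ring, Real.rpow_add hz, Real.rpow_one]
  have : z ^ (-δ) ≠ 0 := by positivity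
  field_simp

/-- `z^(-δ) ₂F₁(-δ, m; 1 - δ; -z)`, which is a primitive of `-δ z^(-δ-1) (1+z)^(-m)`. -/
lemma rpow_mul_hypEuler_neg {δ : ℝ} (m : ℕ) {z : ℝ} (hz : 0 < z) :
    z ^ (-δ) * hypEuler δ m (-z) = z ^ (-δ) * ((1 + z) ^ m)⁻¹ + m * incBeta δ m z := by
  rw [← rpow_mul_eulerInt_neg m hz, hypEuler, show 1 - δ = -δ + 1 by ring, Real.rpow_add hz,
    Real.rpow_one]
  simp only [sub_neg_eq_add]
  ring

/-- In the decomposition of `rpow_mul_hypEuler_neg`, differentiating (1+z)^(-m) produces -m z^(-δ)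
(1+z)^(-m-1), which cancels the derivative of the incomplete beta term. -/
lemma hasDerivAt_rpow_mul_hypEuler_neg {δ : ℝ} (hδ0 : 0 < δ) (hδ : δ < 1) (m : ℕ) {z : ℝ}
    (hz : 0 < z) :
    HasDerivAt (fun z => z ^ (-δ) * hypEuler δ m (-z))
      (-δ * z ^ (-δ - 1) * ((1 + z) ^ m)⁻¹) z := by
  have h1 : HasDerivAt (fun z : ℝ => z ^ (-δ)) (-δ * z ^ (-δ - 1)) z :=
    Real.hasDerivAt_rpow_const (Or.inl hz.ne')
  have h2 : HasDerivAt (fun z : ℝ => ((1 + z) ^ m)⁻¹) (-(m * ((1 + z) ^ (m + 1))⁻¹)) z := by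
    have h := (((hasDerivAt_id' z).const_add 1).fun_pow m).fun_inv (by positivity)
    refine h.congr_deriv ?_
    rcases m with _ | k
    · simp
    · simp only [Nat.add_sub_cancel, mul_one]
      field_simp
      ring
  have h := (h1.mul h2).add ((hasDerivAt_incBeta hδ0 hδ m hz).const_mul (m : ℝ))
  have h' := h.congr_deriv (g' := -δ * z ^ (-δ - 1) * ((1 + z) ^ m)⁻¹) (by ring)
  refine h'.congr_of_eventuallyEq ?_
  filter_upwards [Ioi_mem_nhds hz] with y hy
  rw [rpow_mul_hypEuler_neg m hy]
  rfl

/-- The boundary term decays and the incomplete beta integral tends to the complete one; m / Γ(m+1)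
= 1 / Γ(m). This limit is the constant in Δ. -/
lemma tendsto_rpow_mul_hypEuler_neg {δ : ℝ} (hδ0 : 0 < δ) (hδ : δ < 1) {m : ℕ} (hm : 0 < m) :
    Tendsto (fun z => z ^ (-δ) * hypEuler δ m (-z)) atTop
      (𝓝 (Real.Gamma (1 - δ) * Real.Gamma (m + δ) * (Real.Gamma m)⁻¹)) := by
  obtain ⟨hint, hval⟩ := integrableOn_beta_Ioi_and_integral hδ0 hδ m
  have h1 := intervalIntegral_tendsto_integral_Ioi 0 hint tendsto_id
  rw [hval] at h1
  have h2 : Tendsto (fun z : ℝ => z ^ (-δ) * ((1 + z) ^ m)⁻¹) atTop (𝓝 (0 * 0)) := by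
    refine (tendsto_rpow_neg_atTop hδ0).mul (Tendsto.inv_tendsto_atTop ?_)
    exact (tendsto_pow_atTop hm.ne').comp (tendsto_atTop_add_const_left _ _ tendsto_id)
  have h3 := h2.add (h1.const_mul (m : ℝ))
  have hm' : (m : ℝ) ≠ 0 := by positivity
  have hval' : (0 : ℝ) * 0 + m * (Real.Gamma (1 - δ) * Real.Gamma (m + δ) / Real.Gamma (m + 1)) =
      Real.Gamma (1 - δ) * Real.Gamma (m + δ) * (Real.Gamma m)⁻¹ := by
    rw [Real.Gamma_add_one hm']
    have : Real.Gamma m ≠ 0 := (Real.Gamma_pos_of_pos (by positivity)).ne'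
    field_simp
    ring
  rw [hval'] at h3
  refine h3.congr' ?_
  filter_upwards [eventually_gt_atTop 0] with z hz
  rw [rpow_mul_hypEuler_neg m hz]
  rfl

lemma intervalIntegrable_radial {α : ℝ} (N : ℕ) {x v : ℝ} (hx : 0 ≤ x) (hv : 0 ≤ v) :
    IntervalIntegrable (fun t => 2 * t * ((1 + x * t ^ (-α)) ^ N)⁻¹) volume 0 v := by
  rw [intervalIntegrable_iff_integrableOn_Ioc_of_le hv]
  refine Measure.integrableOn_of_bounded (M := 2 * v) (by simp)
    (Measurable.aestronglyMeasurable (by fun_prop)) ?_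
  refine (ae_restrict_mem measurableSet_Ioc).mono fun t ht => ?_
  have := radial_factor_mem (α := α) N hx ht.1.le
  rw [Real.norm_eq_abs, abs_of_nonneg (mul_nonneg (by linarith [ht.1]) this.1)]
  nlinarith [ht.1, ht.2, this.1, this.2]

/-- Closed form of the radial integral for a path loss exponent `α > 2`. -/
lemma radialInt_eq_hypS {α : ℝ} (hα : 2 < α) {N : ℕ} (hN : 0 < N) {x v : ℝ} (hx : 0 ≤ x)
    (hv : 0 < v) :
    radialInt α N x v = hypS α N 0 (x / v ^ α) * v ^ 2 - gammaDelta α N x := by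
  have hα0 : 0 < α := by linarith
  set δ : ℝ := 2 / α with hδdef
  have hδ0 : 0 < δ := by positivity
  have hδ : δ < 1 := by rw [hδdef, div_lt_one hα0]; exact hα
  have hS : hypS α N 0 (x / v ^ α) = hypEuler δ N (-(x / v ^ α)) := by
    rw [← gaussHyp_eq_hypEuler hδ0 hδ hN, hypS]
    · simp [hδdef]
    · have : 0 ≤ x / v ^ α := by positivity
      linarith
  rw [hS, gammaDelta]
  -- The primitive below needs x > 0. At x = 0 both sides are v², since Δ(0) = 0 and the
  -- hypergeometric factor is 1.
  rcases hx.eq_or_lt with rfl | hx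
  · rw [radialInt_zero_left, Real.zero_rpow hδ0.ne']
    simp [hypEuler]
  have hαδ : α * δ = 2 := by rw [hδdef]; field_simp
  set T : ℝ → ℝ := fun z => z ^ (-δ) * hypEuler δ N (-z) with hT
  have hzpos : ∀ t > 0, 0 < x * t ^ (-α) := fun t ht => by positivity
  have hpow : ∀ t > 0, (x * t ^ (-α)) ^ (-δ) = x ^ (-δ) * t ^ 2 := by
    intro t ht
    rw [Real.mul_rpow hx.le (by positivity), ← Real.rpow_mul ht.le, neg_mul_neg, hαδ]
    norm_num
  -- Chain rule; α δ = 2 is what turns (x t^(-α))^(-δ) into x^(-δ) t².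
  have hder : ∀ t > 0, HasDerivAt (fun t => x ^ δ * T (x * t ^ (-α)))
      (2 * t * ((1 + x * t ^ (-α)) ^ N)⁻¹) t := by
    intro t ht
    have h1 : HasDerivAt (fun t : ℝ => x * t ^ (-α)) (x * (-α * t ^ (-α - 1))) t :=
      (Real.hasDerivAt_rpow_const (Or.inl ht.ne')).const_mul x
    have h2 := (hasDerivAt_rpow_mul_hypEuler_neg hδ0 hδ N (hzpos t ht)).comp t h1
    refine (h2.const_mul (x ^ δ)).congr_deriv ?_
    have h3 : (x * t ^ (-α)) ^ (-δ - 1) = x ^ (-δ) * t ^ 2 / (x * t ^ (-α)) := by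
      rw [Real.rpow_sub (hzpos t ht), hpow t ht, Real.rpow_one]
    have h4 : t ^ (-α - 1) = t ^ (-α) / t := by rw [Real.rpow_sub ht, Real.rpow_one]
    rw [h3, h4, Real.rpow_neg hx.le δ]
    have h5 : t ^ (-α) ≠ 0 := by positivity
    have h6 : x ^ δ ≠ 0 := by positivity
    have : ((1 + x * t ^ (-α)) ^ N) ≠ 0 := by
      have := hzpos t ht
      positivity
    field_simp
    rw [mul_comm δ α, hαδ]
  -- As t → 0⁺ the argument tends to infinity, so the lower boundary value is Δ(x).
  have hlim : Tendsto (fun t => x ^ δ * T (x * t ^ (-α))) (𝓝[>] 0)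
      (𝓝 (x ^ δ * (Real.Gamma (1 - δ) * Real.Gamma (N + δ) * (Real.Gamma N)⁻¹))) := by
    refine Tendsto.const_mul _ ((tendsto_rpow_mul_hypEuler_neg hδ0 hδ hN).comp ?_)
    exact (tendsto_rpow_neg_nhdsGT_zero (by linarith)).const_mul_atTop hx
  have hcont : Tendsto (fun t => x ^ δ * T (x * t ^ (-α))) (𝓝[<] v)
      (𝓝 (x ^ δ * T (x * v ^ (-α)))) :=
    ((hder v hv).continuousAt.tendsto).mono_left nhdsWithin_le_nhds
  have := intervalIntegral.integral_eq_sub_of_hasDerivAt_of_tendsto hv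
    (fun t ht => hder t ht.1) (intervalIntegrable_radial N hx.le hv.le) hlim hcont
  rw [radialInt, this]
  simp only [hT]
  rw [hpow v hv, Real.rpow_neg hv.le, ← div_eq_mul_inv, Real.rpow_neg hx.le]
  have h6 : x ^ δ * (x ^ δ)⁻¹ = 1 := mul_inv_cancel₀ (by positivity)
  linear_combination (v ^ 2 * hypEuler δ N (-(x / v ^ α))) * h6

/-- The derivative of the finite sum is a geometric sum in 1 / (1+y). Its first part cancels the
derivative -N / (y (1+y)) of the logarithmic term, leaving -N / (y (1+y)^N); adding the derivative
of the middle term leaves 1 / (y² (1+y)^N). -/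
lemma hasDerivAt_Fy {N : ℕ} (hN : 0 < N) {y : ℝ} (hy : 0 < y) :
    HasDerivAt (Fy N) ((y ^ 2 * (1 + y) ^ N)⁻¹) y := by
  obtain ⟨k, rfl⟩ : ∃ k, N = k + 1 := ⟨N - 1, by omega⟩
  have hy1 : (1 + y) ≠ 0 := by positivity
  have hd1 : HasDerivAt (fun y : ℝ => 1 + y) 1 y := by simpa using (hasDerivAt_id y).const_add 1
  have hlog : HasDerivAt (fun y : ℝ => ((k + 1 : ℕ) : ℝ) * Real.log (1 + 1 / y))
      (-((k + 1 : ℕ) : ℝ) / (y * (1 + y))) y := by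
    have h1 : HasDerivAt (fun y : ℝ => 1 + 1 / y) (-(y ^ 2)⁻¹) y := by
      simpa using (hasDerivAt_inv hy.ne').const_add 1
    refine ((h1.log (by positivity)).const_mul _).congr_deriv ?_
    field_simp
    ring
  have hmid : HasDerivAt (fun y : ℝ => 1 / (y * (1 + y) ^ k))
      (-((1 + y) ^ k + y * (k * (1 + y) ^ (k - 1))) / (y * (1 + y) ^ k) ^ 2) y := by
    have h := ((hasDerivAt_id' y).fun_mul (hd1.fun_pow k)).fun_inv (by positivity)
    simp only [one_div]
    refine h.congr_deriv ?_
    simp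
  have hsum : HasDerivAt (fun y : ℝ => ∑ m ∈ Finset.Icc 1 k,
      ((k + 1 : ℕ) : ℝ) / ((1 + y) ^ (k + 1 - m) * (((k + 1 : ℕ) : ℝ) - m)))
      (∑ m ∈ Finset.Icc 1 k, -(((k + 1 : ℕ) : ℝ) / (1 + y) ^ (k + 1 - m + 1))) y := by
    refine HasDerivAt.fun_sum fun m hm => ?_
    rw [Finset.mem_Icc] at hm
    obtain ⟨j, hj⟩ : ∃ j, k + 1 = m + (j + 1) := ⟨k - m, by omega⟩
    have hj1 : k + 1 - m = j + 1 := by omega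
    have hj2 : ((k + 1 : ℕ) : ℝ) - m = (j + 1 : ℕ) := by
      rw [hj]
      push_cast
      ring
    have hj3 : ((j + 1 : ℕ) : ℝ) ≠ 0 := by positivity
    rw [hj1, hj2]
    have h := (((hd1.fun_pow (j + 1)).mul_const ((j + 1 : ℕ) : ℝ)).fun_inv (by positivity)).const_mul
      (((k + 1 : ℕ) : ℝ))
    simp only [div_eq_mul_inv]
    refine h.congr_deriv ?_
    simp only [Nat.add_sub_cancel]
    field_simp
    ring
  have h := (hlog.sub hmid).sub hsum
  refine HasDerivAt.congr_deriv (f := Fy (k + 1)) h ?_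
  have hgeom : ∀ k : ℕ, ∑ m ∈ Finset.Icc 1 k, ((1 + y) ^ (k + 1 - m + 1))⁻¹ =
      (y * (1 + y))⁻¹ - (y * (1 + y) ^ (k + 1))⁻¹ := by
    intro k
    induction k with
    | zero => simp
    | succ k ih =>
      have hsh : ∑ m ∈ Finset.Icc 1 (k + 1), ((1 + y) ^ (k + 1 + 1 - m + 1))⁻¹ =
          ((1 + y) ^ (k + 2))⁻¹ + ∑ m ∈ Finset.Icc 1 k, ((1 + y) ^ (k + 1 - m + 1))⁻¹ := by
        rw [← Finset.add_sum_Ioc_eq_sum_Icc (by omega : 1 ≤ k + 1)]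
        congr 1
        rw [show Finset.Ioc 1 (k + 1) = Finset.image (· + 1) (Finset.Icc 1 k) by
          ext a
          simp only [Finset.mem_Ioc, Finset.mem_image, Finset.mem_Icc]
          exact ⟨fun h => ⟨a - 1, by omega, by omega⟩, fun ⟨b, hb, h⟩ => by omega⟩,
          Finset.sum_image (by intro a _ b _ h; simpa using h)]
        refine Finset.sum_congr rfl fun m hm => ?_
        congr 3
        rw [Finset.mem_Icc] at hm
        omega
      rw [hsh, ih]
      field_simp
      ring
  have hs2 : ∑ m ∈ Finset.Icc 1 k, -(((k + 1 : ℕ) : ℝ) / (1 + y) ^ (k + 1 - m + 1)) =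
      -(((k + 1 : ℕ) : ℝ) * ((y * (1 + y))⁻¹ - (y * (1 + y) ^ (k + 1))⁻¹)) := by
    rw [← hgeom k, Finset.mul_sum, ← Finset.sum_neg_distrib]
    rfl
  rw [hs2]
  -- The exponent k - 1 is a truncated subtraction, so k = 0 is separate.
  rcases k with _ | j
  · simp
    field_simp
    ring
  · simp only [Nat.add_sub_cancel]
    push_cast
    field_simp
    ring

/-- This is the boundary value at t = 0 of the primitive -x F_y(x / t²), and the reason why no
analogue of Δ appears for α = 2. -/
lemma tendsto_Fy_atTop (N : ℕ) : Tendsto (Fy N) atTop (𝓝 0) := by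
  have h1 : Tendsto (fun y : ℝ => (N : ℝ) * Real.log (1 + 1 / y)) atTop (𝓝 0) := by
    have : Tendsto (fun y : ℝ => 1 + 1 / y) atTop (𝓝 (1 + 0)) := by
      simp only [one_div]
      exact tendsto_const_nhds.add tendsto_inv_atTop_zero
    rw [add_zero] at this
    simpa using (this.log one_ne_zero).const_mul (N : ℝ)
  have hadd : Tendsto (fun y : ℝ => 1 + y) atTop atTop :=
    tendsto_atTop_add_const_left _ _ tendsto_id
  have h2 : Tendsto (fun y : ℝ => 1 / (y * (1 + y) ^ (N - 1))) atTop (𝓝 0) := by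
    simp only [one_div]
    refine Tendsto.inv_tendsto_atTop ?_
    refine tendsto_atTop_mono' _ ?_ tendsto_id
    filter_upwards [eventually_ge_atTop 0] with y hy
    exact le_mul_of_one_le_right hy (one_le_pow₀ (by linarith))
  have h3 : Tendsto (fun y : ℝ => ∑ m ∈ Finset.Icc 1 (N - 1),
      (N : ℝ) / ((1 + y) ^ (N - m) * ((N : ℝ) - m))) atTop (𝓝 (∑ m ∈ Finset.Icc 1 (N - 1), 0)) := by
    refine tendsto_finsetSum _ fun m hm => ?_
    rw [Finset.mem_Icc] at hm
    have hpos : (0 : ℝ) < N - m := by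
      have : (m : ℝ) < N := by exact_mod_cast (by omega : m < N)
      linarith
    exact Tendsto.div_atTop tendsto_const_nhds
      (((tendsto_pow_atTop (by omega)).comp hadd).atTop_mul_const hpos)
  have h := (h1.sub h2).sub h3
  simp only [sub_zero, Finset.sum_const_zero] at h
  exact h

/-- Closed form of the radial integral for the path loss exponent `2`. -/
lemma radialInt_eq_Fy {N : ℕ} (hN : 0 < N) {x v : ℝ} (hx : 0 < x) (hv : 0 < v) :
    radialInt 2 N x v = -(x * Fy N (x / v ^ 2)) := by
  have hder : ∀ t > 0, HasDerivAt (fun t => -(x * Fy N (x / t ^ 2)))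
      (2 * t * ((1 + x * t ^ (-2 : ℝ)) ^ N)⁻¹) t := by
    intro t ht
    have h1 : HasDerivAt (fun t : ℝ => x / t ^ 2) (-(2 * x / t ^ 3)) t := by
      have := (((hasDerivAt_id' t).fun_pow 2).fun_inv (by positivity)).const_mul x
      simp only [div_eq_mul_inv]
      refine this.congr_deriv ?_
      field_simp
      ring
    have h2 := (((hasDerivAt_Fy hN (by positivity : 0 < x / t ^ 2)).comp t h1).const_mul x).neg
    refine h2.congr_deriv ?_
    have e : x * t ^ (-2 : ℝ) = x / t ^ 2 := by
      rw [Real.rpow_neg ht.le, div_eq_mul_inv]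
      norm_num
    rw [e]
    have h3 : (1 + x / t ^ 2) ^ N ≠ 0 := by positivity
    generalize (1 + x / t ^ 2) ^ N = A at h3
    field_simp
  have hlim : Tendsto (fun t => -(x * Fy N (x / t ^ 2))) (𝓝[>] 0) (𝓝 (-(x * 0))) := by
    refine (((tendsto_Fy_atTop N).comp ?_).const_mul x).neg
    simp only [div_eq_mul_inv]
    refine Tendsto.const_mul_atTop hx (Tendsto.inv_tendsto_nhdsGT_zero ?_)
    refine tendsto_nhdsWithin_iff.2 ⟨?_, ?_⟩
    · have : Tendsto (fun t : ℝ => t ^ 2) (𝓝 0) (𝓝 (0 ^ 2)) := (continuous_pow 2).tendsto 0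
      simpa using this.mono_left nhdsWithin_le_nhds
    · filter_upwards [self_mem_nhdsWithin] with t ht
      exact Set.mem_Ioi.2 (pow_pos ht 2)
  have hcont : Tendsto (fun t => -(x * Fy N (x / t ^ 2))) (𝓝[<] v) (𝓝 (-(x * Fy N (x / v ^ 2)))) :=
    ((hder v hv).continuousAt.tendsto).mono_left nhdsWithin_le_nhds
  rw [radialInt, intervalIntegral.integral_eq_sub_of_hasDerivAt_of_tendsto hv
    (fun t ht => hder t ht.1) (intervalIntegrable_radial N hx.le hv.le) hlim hcont]
  ring

lemma argX_nonneg {Nc : ℕ} (Q : Params Nc) (w : ℝ) {s τ : ℝ} (hs : 0 ≤ s) (hτ : 0 ≤ τ) :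
    0 ≤ argX Q w s τ := by
  have := arrayGain_nonneg Q.Nant w
  unfold argX
  positivity

/-- The boundary terms -p Δ and +Δ of the two radial integrals combine to (1 - p) Δ. -/
lemma Wgt_eq_radialInt {Nc : ℕ} (Q : Params Nc) (hα : 2 < Q.α) (f : Fin Nc) {r : ℝ} (hr : 0 < r)
    (w : ℝ) {s τ : ℝ} (hs : 0 ≤ s) (hτ : 0 ≤ τ) :
    Wgt Q f r w s τ = Q.p f * radialInt Q.α Q.Nnak (argX Q w s τ) r -
      radialInt Q.α Q.Nnak (argX Q w s τ) Q.RL := by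
  have hX := argX_nonneg Q w hs hτ
  rw [radialInt_eq_hypS hα Q.Nnak_pos hX hr, radialInt_eq_hypS hα Q.Nnak_pos hX Q.RL_pos, Wgt]
  ring

/-- At X = 0 the radial integral up to v is v², which is why p r² - R_L² is the right value there.
-/
lemma Weq_eq_radialInt {Nc : ℕ} (Q : Params Nc) (hα : Q.α = 2) (f : Fin Nc) {r : ℝ} (hr : 0 < r)
    (w : ℝ) {s τ : ℝ} (hs : 0 ≤ s) (hτ : 0 ≤ τ) :
    Weq Q f r w s τ = Q.p f * radialInt Q.α Q.Nnak (argX Q w s τ) r -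
      radialInt Q.α Q.Nnak (argX Q w s τ) Q.RL := by
  have hX := argX_nonneg Q w hs hτ
  rw [hα, Weq]
  split_ifs with h
  · rw [h, radialInt_zero_left, radialInt_zero_left]
  · have hX' := lt_of_le_of_ne hX (Ne.symm h)
    rw [radialInt_eq_Fy Q.Nnak_pos hX' hr, radialInt_eq_Fy Q.Nnak_pos hX' Q.RL_pos]
    ring

/-- Limit of the closed forms, in terms of the radial integrals averaged over the angle. -/
lemma tendsto_closedForm {Nc : ℕ} (Q : Params Nc) (f : Fin Nc) {r : ℝ} (hr : 0 < r) {W : ℝ → ℝ}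
    {s τ : ℝ} (hs : 0 ≤ s) (hτ : 0 ≤ τ)
    (hW : ∀ w, W w = Q.p f * radialInt Q.α Q.Nnak (argX Q w s τ) r -
      radialInt Q.α Q.Nnak (argX Q w s τ) Q.RL) :
    Tendsto (closedForm Q f r W) atTop
      (𝓝 (Real.exp (-(Real.pi * Q.lam * (Q.RL ^ 2 - Q.p f * r ^ 2))
        - Real.pi * Q.lam / 2 * ∫ y in (-1 : ℝ)..1, W (y * Q.d / Q.wl)))) := by
  have hcont : Continuous fun w => argX Q w s τ := by
    unfold argX
    have := continuous_arrayGain Q.Nant_pos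
    fun_prop
  have hWc : Continuous W := by
    rw [funext hW]
    exact (continuous_const.mul (continuous_radialInt_comp _ hcont
      (fun w => argX_nonneg Q w hs hτ) hr.le)).sub
      (continuous_radialInt_comp _ hcont (fun w => argX_nonneg Q w hs hτ) Q.RL_pos.le)
  have h := tendsto_chebNode_sum (g := fun y => W (y * Q.d / Q.wl)) (by fun_prop)
  refine ((Real.continuous_exp.tendsto _).comp
    ((h.const_mul (Real.pi * Q.lam / 2)).const_sub _)).congr fun u => ?_
  simp only [Function.comp_apply, closedForm]
  congr 2
  ring

end RadialIntegral

/-! ### Counts and the probability generating functional of a Poisson process. -/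

section Poisson

section PoissonProcess

variable {Ω : Type*} [MeasurableSpace Ω] {μ : Measure Ω} {lam : ℝ} {X : ℕ → Ω → Plane}

lemma IsHPPP.measurable_count (h : IsHPPP μ lam X) {A : Set Plane} (hA : MeasurableSet A) :
    Measurable fun ω => {n | X n ω ∈ A}.encard := by
  refine measurable_encard.comp (measurable_set_iff.2 fun n => ?_)
  exact measurableSet_setOfPred.1 (h.measurable n hA)

variable [IsProbabilityMeasure μ]

/-- The model prescribes only the probabilities of finite counts. Both laws have total mass one, so
their masses at `⊤` agree too, which excludes infinitely many points in a bounded set. -/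
lemma IsHPPP.map_count (h : IsHPPP μ lam X) {A : Set Plane} (hA : MeasurableSet A)
    (hb : Bornology.IsBounded A) :
    μ.map (fun ω => {n | X n ω ∈ A}.encard) =
      (poissonMeasure (lam * (volume A).toReal).toNNReal).map ((↑) : ℕ → ℕ∞) := by
  set ν := poissonMeasure (lam * (volume A).toReal).toNNReal with hν
  have hm := h.measurable_count hA
  have hprob : IsProbabilityMeasure (μ.map fun ω => {n | X n ω ∈ A}.encard) :=
    Measure.isProbabilityMeasure_map hm.aemeasurable
  have hprob' : IsProbabilityMeasure (ν.map ((↑) : ℕ → ℕ∞)) :=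
    Measure.isProbabilityMeasure_map Measurable.of_discrete.aemeasurable
  have hpre : ∀ k : ℕ, ((↑) : ℕ → ℕ∞) ⁻¹' {(k : ℕ∞)} = {k} := by
    intro k
    ext j
    simp
  have hcoe : ∀ k : ℕ, (μ.map fun ω => {n | X n ω ∈ A}.encard) {(k : ℕ∞)} =
      (ν.map ((↑) : ℕ → ℕ∞)) {(k : ℕ∞)} := by
    intro k
    rw [Measure.map_apply hm (measurableSet_singleton _),
      Measure.map_apply Measurable.of_discrete (measurableSet_singleton _), hpre]
    exact h.poisson A hA hb k
  have hunion : ∀ ρ : Measure ℕ∞, ρ {⊤}ᶜ = ∑' k : ℕ, ρ {(k : ℕ∞)} := by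
    intro ρ
    rw [← measure_iUnion (fun i j hij => by simpa using hij) fun _ => measurableSet_singleton _]
    congr 1
    ext a
    induction a using ENat.recTopCoe <;> simp
  have htop : (μ.map fun ω => {n | X n ω ∈ A}.encard) {⊤} = (ν.map ((↑) : ℕ → ℕ∞)) {⊤} := by
    have e : (μ.map fun ω => {n | X n ω ∈ A}.encard) {⊤}ᶜ = (ν.map ((↑) : ℕ → ℕ∞)) {⊤}ᶜ := by
      rw [hunion, hunion]
      exact tsum_congr hcoe
    rw [← compl_compl ({⊤} : Set ℕ∞), prob_compl_eq_one_sub (measurableSet_singleton _).compl,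
      prob_compl_eq_one_sub (measurableSet_singleton _).compl, e]
  refine Measure.ext_of_singleton fun a => ?_
  induction a using ENat.recTopCoe with
  | top => exact htop
  | coe k => exact hcoe k

lemma IsHPPP.ae_finite (h : IsHPPP μ lam X) {A : Set Plane} (hA : MeasurableSet A)
    (hb : Bornology.IsBounded A) : ∀ᵐ ω ∂μ, {n | X n ω ∈ A}.Finite := by
  have h1 : ∀ᵐ a ∂(μ.map fun ω => {n | X n ω ∈ A}.encard), a ≠ ⊤ := by
    rw [h.map_count hA hb, ae_map_iff Measurable.of_discrete.aemeasurable
      (MeasurableSet.of_discrete)]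
    exact Eventually.of_forall fun k => ENat.natCast_ne_top k
  filter_upwards [ae_of_ae_map (h.measurable_count hA).aemeasurable h1] with ω hω
  exact Set.encard_ne_top_iff.1 hω

/-- Probability generating function of the number of points in a bounded set. -/
lemma IsHPPP.integral_pow_count (h : IsHPPP μ lam X) (hlam : 0 ≤ lam) {A : Set Plane}
    (hA : MeasurableSet A) (hb : Bornology.IsBounded A) (v : ℝ) :
    ∫ ω, v ^ ({n | X n ω ∈ A}.encard.toNat) ∂μ =
      Real.exp (-(lam * (volume A).toReal * (1 - v))) := by
  have hm := h.measurable_count hA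
  have h1 := integral_map (μ := μ) (f := fun a : ℕ∞ => v ^ a.toNat) hm.aemeasurable
    (Measurable.of_discrete.aestronglyMeasurable)
  rw [← h1, h.map_count hA hb, integral_map Measurable.of_discrete.aemeasurable
    (Measurable.of_discrete.aestronglyMeasurable), integral_poissonMeasure]
  have hr : ((lam * (volume A).toReal).toNNReal : ℝ) = lam * (volume A).toReal :=
    Real.coe_toNNReal _ (by positivity)
  rw [hr]
  set r := lam * (volume A).toReal
  have h2 := (NormedSpace.expSeries_div_hasSum_exp (r * v)).mul_left (Real.exp (-r))
  rw [← Real.exp_eq_exp_ℝ, ← Real.exp_add] at h2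
  rw [show -(r * (1 - v)) = -r + r * v by ring, ← h2.tsum_eq]
  refine tsum_congr fun n => ?_
  rw [ENat.toNat_natCast, smul_eq_mul, mul_pow]
  ring

/-- With mean r, the probability is 1 - exp(-r) (1 + r) ≤ 1 - (1 - r)(1 + r) = r². -/
lemma IsHPPP.measureReal_two_le_count (h : IsHPPP μ lam X) (hlam : 0 ≤ lam) {A : Set Plane}
    (hA : MeasurableSet A) (hb : Bornology.IsBounded A) :
    μ.real {ω | 2 ≤ {n | X n ω ∈ A}.encard} ≤ (lam * (volume A).toReal) ^ 2 := by
  have hm := h.measurable_count hA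
  have hr : ((lam * (volume A).toReal).toNNReal : ℝ) = lam * (volume A).toReal :=
    Real.coe_toNNReal _ (by positivity)
  have hr0 : 0 ≤ lam * (volume A).toReal := by positivity
  have hk : ∀ k : ℕ, μ.real {ω | {n | X n ω ∈ A}.encard = k} =
      Real.exp (-(lam * (volume A).toReal)) * (lam * (volume A).toReal) ^ k / k.factorial := by
    intro k
    rw [measureReal_def, h.poisson A hA hb k, ← measureReal_def, poissonMeasure_real_singleton, hr]
  have hms : ∀ k : ℕ, MeasurableSet {ω | {n | X n ω ∈ A}.encard = k} :=
    fun k => hm (measurableSet_singleton _)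
  have hset : {ω | 2 ≤ {n | X n ω ∈ A}.encard}ᶜ =
      {ω | {n | X n ω ∈ A}.encard = (0 : ℕ)} ∪ {ω | {n | X n ω ∈ A}.encard = (1 : ℕ)} := by
    ext ω
    simp only [Set.mem_compl_iff, Set.mem_ofPred_eq, Set.mem_union, not_le]
    generalize {n | X n ω ∈ A}.encard = a
    induction a using ENat.recTopCoe with
    | top => simp
    | coe k =>
      have e : (2 : ℕ∞) = ((2 : ℕ) : ℕ∞) := rfl
      rw [e, Nat.cast_lt, Nat.cast_inj, Nat.cast_inj]
      omega
  have hmeas : MeasurableSet {ω | 2 ≤ {n | X n ω ∈ A}.encard} :=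
    hm (MeasurableSet.of_discrete (s := Set.Ici 2))
  have hc := measureReal_compl (μ := μ) hmeas
  rw [hset, measureReal_union ?_ (hms 1), hk, hk] at hc
  · set r := lam * (volume A).toReal
    have he : 1 - r ≤ Real.exp (-r) := by
      have := Real.add_one_le_exp (-r)
      linarith
    simp only [pow_zero, Nat.factorial_zero, Nat.cast_one, pow_one, Nat.factorial_one, div_one,
      mul_one, probReal_univ] at hc
    nlinarith
  · rw [Set.disjoint_left]
    intro ω h0 h1
    simp only [Set.mem_ofPred_eq] at h0 h1
    rw [h0] at h1
    exact absurd h1 (by norm_num)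

/-- The probability generating functional of the process at a step function. -/
lemma IsHPPP.integral_prod_pow_count (h : IsHPPP μ lam X) (hlam : 0 ≤ lam) {m : ℕ}
    {A : Fin m → Set Plane} (hA : ∀ i, MeasurableSet (A i))
    (hb : ∀ i, Bornology.IsBounded (A i)) (hd : Pairwise fun i j => Disjoint (A i) (A j))
    (v : Fin m → ℝ) :
    ∫ ω, ∏ i, v i ^ ({n | X n ω ∈ A i}.encard.toNat) ∂μ =
      Real.exp (-(lam * ∑ i, (volume (A i)).toReal * (1 - v i))) := by
  have hi := (h.indep m A hA hb hd).comp (fun i (a : ℕ∞) => v i ^ a.toNat)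
    (fun i => Measurable.of_discrete)
  have hprod := hi.integral_fun_prod_eq_prod_integral fun i =>
    (Measurable.of_discrete.comp (h.measurable_count (hA i))).aestronglyMeasurable
  simp only [Function.comp_apply] at hprod
  rw [hprod, Finset.mul_sum, ← Finset.sum_neg_distrib, Real.exp_sum]
  refine Finset.prod_congr rfl fun i _ => ?_
  rw [← mul_assoc, ← h.integral_pow_count hlam (hA i) (hb i) (v i)]

/-- The probability generating functional of a homogeneous Poisson point process. -/
lemma IsHPPP.integral_finprod (h : IsHPPP μ lam X) (hlam : 0 ≤ lam) {φ : Plane → ℝ}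
    (hφ : Measurable φ) (h0 : ∀ x, 0 ≤ φ x) (h1 : ∀ x, φ x ≤ 1) {K : ℝ}
    (hK : ∀ x, K < ‖x‖ → φ x = 1) :
    ∫ ω, ∏ᶠ n, φ (X n ω) ∂μ = Real.exp (-(lam * ∫ x, (1 - φ x))) := by
  set B : Set Plane := Metric.closedBall 0 K with hB
  have hBm : MeasurableSet B := Metric.isClosed_closedBall.measurableSet
  have hBb : Bornology.IsBounded B := Metric.isBounded_closedBall
  have hout : ∀ x, x ∉ B → φ x = 1 := fun x hx => hK x (by simpa [hB] using hx)
  -- Level sets of φ rounded down to multiples of 1 / (j+1). The levels are 0, …, j + 1, hence `Fin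
  -- (j + 2)`; the level j + 1 is where φ = 1, so the step function `φs j` is exactly 1 off the
  -- ball.
  set A : (j : ℕ) → Fin (j + 2) → Set Plane :=
    fun j i => B ∩ {x | ⌊(j + 1 : ℕ) * φ x⌋₊ = (i : ℕ)} with hAdef
  set φs : ℕ → Plane → ℝ := fun j x => (⌊((j + 1 : ℕ) : ℝ) * φ x⌋₊ : ℝ) / (j + 1 : ℕ) with hφs
  have hfl : ∀ j : ℕ, Measurable fun x => ⌊((j + 1 : ℕ) : ℝ) * φ x⌋₊ :=
    fun j => Nat.measurable_floor.comp (hφ.const_mul _)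
  have hlt : ∀ (j : ℕ) x, ⌊((j + 1 : ℕ) : ℝ) * φ x⌋₊ < j + 2 := by
    intro j x
    have : ⌊((j + 1 : ℕ) : ℝ) * φ x⌋₊ ≤ j + 1 := by
      refine Nat.floor_le_of_le ?_
      exact mul_le_of_le_one_right (by positivity) (h1 x)
    omega
  have hAm : ∀ j i, MeasurableSet (A j i) :=
    fun j i => hBm.inter (hfl j (measurableSet_singleton _))
  have hAb : ∀ j i, Bornology.IsBounded (A j i) := fun j i => hBb.subset Set.inter_subset_left
  have hAd : ∀ j, Pairwise fun i i' => Disjoint (A j i) (A j i') := by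
    intro j i i' hii
    rw [Set.disjoint_left]
    rintro x ⟨_, hx⟩ ⟨_, hx'⟩
    exact hii (Fin.ext (hx.symm.trans hx'))
  have hφs0 : ∀ j x, 0 ≤ φs j x := fun j x => by positivity
  have hφsle : ∀ j x, φs j x ≤ 1 := by
    intro j x
    rw [hφs, div_le_one (by positivity)]
    exact_mod_cast Nat.lt_succ_iff.1 (hlt j x)
  have hφsout : ∀ j x, x ∉ B → φs j x = 1 := by
    intro j x hx
    simp only [hφs]
    rw [hout x hx, mul_one, Nat.floor_natCast, div_self (by positivity)]
  have hφslim : ∀ x, Tendsto (fun j => φs j x) atTop (𝓝 (φ x)) := by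
    intro x
    have h2 := (tendsto_nat_floor_mul_div_atTop (R := ℝ) (h0 x)).comp
      (tendsto_natCast_atTop_atTop.comp (tendsto_add_atTop_nat 1))
    refine h2.congr fun j => ?_
    simp only [Function.comp_apply, hφs]
    rw [mul_comm (φ x)]
  set F : ℕ → Ω → ℝ := fun j ω =>
    ∏ i : Fin (j + 2), (((i : ℕ) : ℝ) / (j + 1 : ℕ)) ^ ({n | X n ω ∈ A j i}.encard.toNat) with hF
  have hfin := h.ae_finite hBm hBb
  have hprodS : ∀ (ψ : Plane → ℝ) (hψ : ∀ x, x ∉ B → ψ x = 1) (ω : Ω)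
      (hω : {n | X n ω ∈ B}.Finite), ∏ᶠ n, ψ (X n ω) = ∏ n ∈ hω.toFinset, ψ (X n ω) := by
    intro ψ hψ ω hω
    refine finprod_eq_prod_of_mulSupport_subset _ fun n hn => ?_
    rw [hω.coe_toFinset]
    by_contra hcon
    exact hn (hψ _ hcon)
  -- Group the finitely many points in the ball by level: each level contributes its value to the
  -- power of its count.
  have hFeq : ∀ j, ∀ ω, {n | X n ω ∈ B}.Finite → F j ω = ∏ᶠ n, φs j (X n ω) := by
    intro j ω hω
    rw [hprodS (φs j) (hφsout j) ω hω]
    rw [← Finset.prod_fiberwise (s := hω.toFinset)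
      (g := fun n => (⟨⌊((j + 1 : ℕ) : ℝ) * φ (X n ω)⌋₊, hlt j _⟩ : Fin (j + 2)))]
    refine Finset.prod_congr rfl fun i _ => ?_
    have hc : {n | X n ω ∈ A j i}.encard.toNat = (hω.toFinset.filter fun n =>
        (⟨⌊((j + 1 : ℕ) : ℝ) * φ (X n ω)⌋₊, hlt j _⟩ : Fin (j + 2)) = i).card := by
      rw [← Set.ncard_def, ← Set.ncard_coe_finset]
      congr 1
      ext n
      simp [hAdef, Fin.ext_iff]
    rw [hc, ← Finset.prod_const]
    refine Finset.prod_congr rfl fun n hn => ?_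
    rw [Finset.mem_filter, Fin.ext_iff] at hn
    simp only [hφs]
    rw [← hn.2]
  have hint : ∀ j, ∫ ω, F j ω ∂μ = Real.exp (-(lam * ∫ x, (1 - φs j x))) := by
    intro j
    rw [h.integral_prod_pow_count hlam (hAm j) (hAb j) (hAd j)]
    congr 3
    have e : ∀ x, 1 - φs j x = ∑ i : Fin (j + 2),
        (A j i).indicator (fun _ => 1 - ((i : ℕ) : ℝ) / (j + 1 : ℕ)) x := by
      intro x
      by_cases hx : x ∈ B
      · rw [Finset.sum_eq_single (⟨_, hlt j x⟩ : Fin (j + 2))]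
        · rw [Set.indicator_of_mem (show x ∈ A j ⟨_, hlt j x⟩ from ⟨hx, rfl⟩)]
        · intro i _ hi
          refine Set.indicator_of_notMem (fun hmem => hi ?_) _
          exact Fin.ext hmem.2.symm
        · simp
      · rw [hφsout j x hx, sub_self, Finset.sum_eq_zero]
        intro i _
        exact Set.indicator_of_notMem (fun hmem => hx hmem.1) _
    simp only [e]
    rw [integral_finsetSum]
    · refine Finset.sum_congr rfl fun i _ => ?_
      rw [integral_indicator_const _ (hAm j i), smul_eq_mul, measureReal_def]
    · intro i _
      exact (integrable_indicator_iff (hAm j i)).2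
        (integrableOn_const (hs := (hAb j i).measure_lt_top.ne))
  have hL : Tendsto (fun j => ∫ ω, F j ω ∂μ) atTop (𝓝 (∫ ω, ∏ᶠ n, φ (X n ω) ∂μ)) := by
    refine tendsto_integral_of_dominated_convergence (fun _ => 1) ?_ (integrable_const _) ?_ ?_
    · intro j
      refine (Finset.measurable_prod _ fun i _ => ?_).aestronglyMeasurable
      exact (Measurable.of_discrete (f := fun a : ℕ∞ =>
        (((i : ℕ) : ℝ) / (j + 1 : ℕ)) ^ a.toNat)).comp (h.measurable_count (hAm j i))
    · intro j
      filter_upwards [hfin] with ω hω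
      rw [hFeq j ω hω, hprodS (φs j) (hφsout j) ω hω,
        Real.norm_of_nonneg (Finset.prod_nonneg fun n _ => hφs0 j _)]
      exact Finset.prod_le_one (fun n _ => hφs0 j _) fun n _ => hφsle j _
    · filter_upwards [hfin] with ω hω
      rw [hprodS φ hout ω hω]
      refine Tendsto.congr (fun j => ((hFeq j ω hω).trans
        (hprodS (φs j) (hφsout j) ω hω)).symm) ?_
      exact tendsto_finsetProd _ fun n _ => hφslim _
  have hR : Tendsto (fun j => Real.exp (-(lam * ∫ x, (1 - φs j x)))) atTop
      (𝓝 (Real.exp (-(lam * ∫ x, (1 - φ x))))) := by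
    refine (Real.continuous_exp.tendsto _).comp (Tendsto.neg (Tendsto.const_mul _ ?_))
    refine tendsto_integral_of_dominated_convergence (B.indicator fun _ => 1) ?_ ?_ ?_ ?_
    · intro j
      refine Measurable.aestronglyMeasurable (measurable_const.sub (Measurable.div_const ?_ _))
      exact Measurable.of_discrete.comp (hfl j)
    · exact (integrable_indicator_iff hBm).2
        (integrableOn_const (hs := hBb.measure_lt_top.ne))
    · intro j
      refine Eventually.of_forall fun x => ?_
      by_cases hx : x ∈ B
      · rw [Set.indicator_of_mem hx, Real.norm_of_nonneg (by linarith [hφsle j x])]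
        linarith [hφs0 j x]
      · rw [Set.indicator_of_notMem hx, hφsout j x hx]
        simp
    · exact Eventually.of_forall fun x => (hφslim x).const_sub _
  exact tendsto_nhds_unique hL (by simpa only [hint] using hR)

end PoissonProcess

end Poisson

/-! ### Averaging independent marks out of product functionals. -/

section Marks

section Marking

variable {Ω E K : Type*} [MeasurableSpace Ω] [MeasurableSpace E] [MeasurableSpace K]
  {μ : Measure Ω} [IsProbabilityMeasure μ]

lemma integrable_of_mem_unit {α : Type*} [MeasurableSpace α] {ν : Measure α} [IsFiniteMeasure ν]
    {g : α → ℝ} (hg : AEStronglyMeasurable g ν) (h0 : ∀ x, 0 ≤ g x) (h1 : ∀ x, g x ≤ 1) :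
    Integrable g ν :=
  (integrable_const (1 : ℝ)).mono' hg (Eventually.of_forall fun x => by
    rw [Real.norm_of_nonneg (h0 x)]
    exact h1 x)

/-- Independent marks can be averaged out of a product functional. -/
lemma integral_prod_marked {X : ℕ → Ω → E} {Z : ℕ → Ω → K} (hX : ∀ n, Measurable (X n))
    (hZ : ∀ n, Measurable (Z n))
    (hind : ∀ M : ℕ, IndepFun (fun ω => ((fun n => X n ω), fun i : Fin M => Z i ω)) (Z M) μ)
    {ν : Measure K} [IsProbabilityMeasure ν] (hν : ∀ n, μ.map (Z n) = ν) {Φ : E → K → ℝ}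
    (hΦ : Measurable (Function.uncurry Φ)) (h0 : ∀ x z, 0 ≤ Φ x z) (h1 : ∀ x z, Φ x z ≤ 1)
    (M : ℕ) {G : (ℕ → E) → ℝ} (hG : Measurable G) (hG0 : ∀ x, 0 ≤ G x) (hG1 : ∀ x, G x ≤ 1) :
    ∫ ω, G (fun n => X n ω) * ∏ n ∈ Finset.range M, Φ (X n ω) (Z n ω) ∂μ =
      ∫ ω, G (fun n => X n ω) * ∏ n ∈ Finset.range M, ∫ z, Φ (X n ω) z ∂ν ∂μ := by
  have hΦb : Measurable fun x => ∫ z, Φ x z ∂ν :=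
    hΦ.stronglyMeasurable.integral_prod_right.measurable
  have hb0 : ∀ x, 0 ≤ ∫ z, Φ x z ∂ν := fun x => integral_nonneg (h0 x)
  have hb1 : ∀ x, ∫ z, Φ x z ∂ν ≤ 1 := fun x => by
    have := integral_mono_of_nonneg (μ := ν) (Eventually.of_forall (h0 x))
      (integrable_const (1 : ℝ)) (Eventually.of_forall (h1 x))
    simpa using this
  -- The weight G must vary: once mark M is averaged, its mean factor depends only on the locations
  -- and is absorbed into G.
  induction M generalizing G with
  | zero => simp
  | succ M ih =>
    set V : Ω → (ℕ → E) × (Fin M → K) := fun ω => ((fun n => X n ω), fun i : Fin M => Z i ω)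
      with hV
    have hVm : Measurable V :=
      (measurable_pi_lambda _ hX).prodMk (measurable_pi_lambda _ fun i => hZ i)
    set A : (ℕ → E) × (Fin M → K) → ℝ := fun v => G v.1 * ∏ i : Fin M, Φ (v.1 i) (v.2 i) with hA
    have hAm : Measurable A := by
      refine (hG.comp measurable_fst).mul (Finset.measurable_prod _ fun i _ => ?_)
      have hpair : Measurable fun v : (ℕ → E) × (Fin M → K) => (v.1 (i : ℕ), v.2 i) := by fun_prop
      exact hΦ.comp hpair
    have hA0 : ∀ v, 0 ≤ A v := fun v =>
      mul_nonneg (hG0 _) (Finset.prod_nonneg fun i _ => h0 _ _)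
    have hA1 : ∀ v, A v ≤ 1 := fun v =>
      mul_le_one₀ (hG1 _) (Finset.prod_nonneg fun i _ => h0 _ _)
        (Finset.prod_le_one (fun i _ => h0 _ _) fun i _ => h1 _ _)
    set H : ((ℕ → E) × (Fin M → K)) × K → ℝ := fun y => A y.1 * Φ (y.1.1 M) y.2 with hH
    have hHm : Measurable H := by
      refine (hAm.comp measurable_fst).mul (hΦ.comp (Measurable.prodMk ?_ measurable_snd))
      exact (measurable_pi_apply M).comp (measurable_fst.comp measurable_fst)
    have hprob : IsProbabilityMeasure (μ.map V) := Measure.isProbabilityMeasure_map hVm.aemeasurable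
    have hmap := (indepFun_iff_map_prod_eq_prod_map_map hVm.aemeasurable
      (hZ M).aemeasurable).1 (hind M)
    rw [hν M] at hmap
    have hleft : ∫ ω, G (fun n => X n ω) * ∏ n ∈ Finset.range (M + 1), Φ (X n ω) (Z n ω) ∂μ =
        ∫ y, H y ∂(μ.map fun ω => (V ω, Z M ω)) := by
      rw [integral_map (hVm.prodMk (hZ M)).aemeasurable hHm.aestronglyMeasurable]
      refine integral_congr_ae (Eventually.of_forall fun ω => ?_)
      simp only [hH, hA, hV]
      rw [Finset.prod_range_succ, ← Finset.prod_range fun n => Φ (X n ω) (Z n ω), mul_assoc]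
    have hHint : Integrable H ((μ.map V).prod ν) :=
      integrable_of_mem_unit hHm.aestronglyMeasurable (fun y => mul_nonneg (hA0 _) (h0 _ _))
        fun y => mul_le_one₀ (hA1 _) (h0 _ _) (h1 _ _)
    rw [hleft, hmap, integral_prod _ hHint]
    simp only [hH, integral_const_mul]
    rw [integral_map hVm.aemeasurable]
    · have := ih (G := fun x => G x * ∫ z, Φ (x M) z ∂ν)
        (hG.mul (hΦb.comp (measurable_pi_apply M))) (fun x => mul_nonneg (hG0 x) (hb0 _))
        (fun x => mul_le_one₀ (hG1 x) (hb0 _) (hb1 _))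
      simp only [Finset.prod_range_succ]
      calc ∫ ω, A (V ω) * ∫ z, Φ ((V ω).1 M) z ∂ν ∂μ
          = ∫ ω, (G (fun n => X n ω) * ∫ z, Φ (X M ω) z ∂ν) *
              ∏ n ∈ Finset.range M, Φ (X n ω) (Z n ω) ∂μ := by
            refine integral_congr_ae (Eventually.of_forall fun ω => ?_)
            simp only [hA, hV]
            rw [← Finset.prod_range fun n => Φ (X n ω) (Z n ω)]
            ring
        _ = _ := by
            rw [this]
            refine integral_congr_ae (Eventually.of_forall fun ω => ?_)
            ring
    · exact (hAm.mul (hΦb.comp ((measurable_pi_apply M).comp measurable_fst))).aestronglyMeasurable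

lemma tendsto_prod_range_finprod {g : ℕ → ℝ} (hg : (Function.mulSupport g).Finite) :
    Tendsto (fun M => ∏ n ∈ Finset.range M, g n) atTop (𝓝 (∏ᶠ n, g n)) := by
  obtain ⟨m, hm⟩ := hg.bddAbove
  refine tendsto_const_nhds.congr' ?_
  filter_upwards [eventually_gt_atTop m] with M hM
  refine finprod_eq_prod_of_mulSupport_subset _ fun n hn => ?_
  simp only [Finset.coe_range, Set.mem_Iio]
  exact (hm hn).trans_lt hM

/-- Let the number of factors in `integral_prod_marked` tend to infinity. Almost surely only
finitely many points lie in B, so the partial products are eventually constant, and they are bounded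
by 1. -/
lemma integral_finprod_marked {X : ℕ → Ω → E} {Z : ℕ → Ω → K} (hX : ∀ n, Measurable (X n))
    (hZ : ∀ n, Measurable (Z n))
    (hind : ∀ M : ℕ, IndepFun (fun ω => ((fun n => X n ω), fun i : Fin M => Z i ω)) (Z M) μ)
    {ν : Measure K} [IsProbabilityMeasure ν] (hν : ∀ n, μ.map (Z n) = ν) {Φ : E → K → ℝ}
    (hΦ : Measurable (Function.uncurry Φ)) (h0 : ∀ x z, 0 ≤ Φ x z) (h1 : ∀ x z, Φ x z ≤ 1)
    {B : Set E} (hB : ∀ x ∉ B, ∀ z, Φ x z = 1) (hfin : ∀ᵐ ω ∂μ, {n | X n ω ∈ B}.Finite) :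
    ∫ ω, ∏ᶠ n, Φ (X n ω) (Z n ω) ∂μ = ∫ ω, ∏ᶠ n, ∫ z, Φ (X n ω) z ∂ν ∂μ := by
  have hΦb : Measurable fun x => ∫ z, Φ x z ∂ν :=
    hΦ.stronglyMeasurable.integral_prod_right.measurable
  have hb0 : ∀ x, 0 ≤ ∫ z, Φ x z ∂ν := fun x => integral_nonneg (h0 x)
  have hb1 : ∀ x, ∫ z, Φ x z ∂ν ≤ 1 := fun x => by
    have := integral_mono_of_nonneg (μ := ν) (Eventually.of_forall (h0 x))
      (integrable_const (1 : ℝ)) (Eventually.of_forall (h1 x))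
    simpa using this
  have hlim : ∀ g : ℕ → Ω → ℝ, (∀ n, Measurable (g n)) → (∀ n ω, 0 ≤ g n ω) →
      (∀ n ω, g n ω ≤ 1) → (∀ n ω, X n ω ∉ B → g n ω = 1) →
      Tendsto (fun M => ∫ ω, ∏ n ∈ Finset.range M, g n ω ∂μ) atTop
        (𝓝 (∫ ω, ∏ᶠ n, g n ω ∂μ)) := by
    intro g hg hg0 hg1 hgB
    refine tendsto_integral_of_dominated_convergence (fun _ => 1) ?_ (integrable_const _) ?_ ?_
    · exact fun M => (Finset.measurable_prod _ fun n _ => hg n).aestronglyMeasurable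
    · refine fun M => Eventually.of_forall fun ω => ?_
      rw [Real.norm_of_nonneg (Finset.prod_nonneg fun n _ => hg0 n ω)]
      exact Finset.prod_le_one (fun n _ => hg0 n ω) fun n _ => hg1 n ω
    · filter_upwards [hfin] with ω hω
      refine tendsto_prod_range_finprod (hω.subset fun n hn => ?_)
      by_contra hcon
      exact hn (hgB n ω hcon)
  have hL := hlim (fun n ω => Φ (X n ω) (Z n ω)) (fun n => hΦ.comp ((hX n).prodMk (hZ n)))
    (fun n ω => h0 _ _) (fun n ω => h1 _ _) (fun n ω h => hB _ h _)
  have hR := hlim (fun n ω => ∫ z, Φ (X n ω) z ∂ν) (fun n => hΦb.comp (hX n))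
    (fun n ω => hb0 _) (fun n ω => hb1 _) (fun n ω h => by simp [hB _ h])
  refine tendsto_nhds_unique hL (hR.congr fun M => ?_)
  have := integral_prod_marked hX hZ hind hν hΦ h0 h1 M (G := fun _ => 1) measurable_const
    (fun _ => zero_le_one) (fun _ => le_rfl)
  simpa using this.symm

end Marking

/-- The mark of the `n`-th BS relevant to the file `f`: whether it stores `f`, its fading power
and its angle. -/
def PicoTier.mark {Ω : Type*} {Nc : ℕ} (T : PicoTier Ω Nc) (f : Fin Nc) (n : ℕ) (ω : Ω) :
    Prop × ℝ × ℝ :=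
  (f ∈ T.cache n ω, T.fading n ω, T.angle n ω)

section SourceMeasurability

variable {Ω : Type*} {Nc : ℕ} {T : PicoTier Ω Nc} {m : MeasurableSpace Ω}

lemma PicoTier.measurable_channel_of_le (n : ℕ) (h2 : T.sigma (.fading n) ≤ m)
    (h3 : T.sigma (.angle n) ≤ m) : Measurable fun ω => (T.fading n ω, T.angle n ω) :=
  ((comap_measurable (T.fading n)).mono h2 le_rfl).prodMk
    ((comap_measurable (T.angle n)).mono h3 le_rfl)

lemma PicoTier.measurable_mark_of_le (f : Fin Nc) (n : ℕ)
    (h1 : T.sigma (.cache n) ≤ m) (h2 : T.sigma (.fading n) ≤ m) (h3 : T.sigma (.angle n) ≤ m) :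
    Measurable (T.mark f n) := by
  have hc : Measurable (T.cache n) := (comap_measurable _).mono h1 le_rfl
  exact ((measurable_set_mem f).comp hc).prodMk (PicoTier.measurable_channel_of_le n h2 h3)

lemma PicoTier.measurable_locations_of_le (h : T.sigma .locations ≤ m) :
    Measurable fun ω n => T.loc n ω := by
  refine measurable_pi_lambda _ fun n => (comap_measurable (T.loc n)).mono ?_ le_rfl
  exact (le_iSup (fun n => MeasurableSpace.comap (T.loc n) inferInstance) n).trans h

lemma PicoTier.measurable_locations_marks_of_le (f : Fin Nc) (M : ℕ) (h : T.sigma .locations ≤ m)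
    (h1 : ∀ n < M, T.sigma (.cache n) ≤ m) (h2 : ∀ n < M, T.sigma (.fading n) ≤ m)
    (h3 : ∀ n < M, T.sigma (.angle n) ≤ m) :
    Measurable fun ω => ((fun n => T.loc n ω), fun i : Fin M => T.mark f i ω) :=
  (PicoTier.measurable_locations_of_le h).prodMk (measurable_pi_lambda _ fun i =>
    PicoTier.measurable_mark_of_le f i (h1 i i.2) (h2 i i.2) (h3 i i.2))

end SourceMeasurability

section Tier

variable {Ω : Type*} [MeasurableSpace Ω] {μ : Measure Ω} {Nc : ℕ} {Q : Params Nc}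
  {T : PicoTier Ω Nc}

lemma IsPicoTier.sigma_le (hT : IsPicoTier μ Q T) (i : Source) : T.sigma i ≤ ‹_› := by
  cases i with
  | locations => exact iSup_le fun n => (hT.hppp.measurable n).comap_le
  | cache n => exact (hT.cache_measurable n).comap_le
  | fading n => exact (hT.fading_measurable n).comap_le
  | angle n => exact (hT.angle_measurable n).comap_le

lemma IsPicoTier.measurable_mark (hT : IsPicoTier μ Q T) (f : Fin Nc) (n : ℕ) :
    Measurable (T.mark f n) :=
  PicoTier.measurable_mark_of_le f n (hT.sigma_le _) (hT.sigma_le _) (hT.sigma_le _)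

/-- Disjoint blocks of independent sources generate independent σ-algebras: the locations and all
marks below M on one side, the three sources of BS M on the other. -/
lemma IsPicoTier.indepFun_mark (hT : IsPicoTier μ Q T) (f : Fin Nc) (M : ℕ) :
    IndepFun (fun ω => ((fun n => T.loc n ω), fun i : Fin M => T.mark f i ω)) (T.mark f M) μ := by
  set S : Set Source := {i | i = .locations ∨ ∃ n < M, i = .cache n ∨ i = .fading n ∨ i = .angle n}
    with hS
  set S' : Set Source := {.cache M, .fading M, .angle M} with hS'
  have hdisj : Disjoint S S' := by
    rw [Set.disjoint_left]
    rintro i (rfl | ⟨n, hn, rfl | rfl | rfl⟩)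
    · simp [hS']
    all_goals simp [hS', hn.ne]
  have h := indep_iSup_of_disjoint hT.sigma_le hT.indep hdisj
  have hle : ∀ (U : Set Source) (i : Source), i ∈ U → T.sigma i ≤ ⨆ j ∈ U, T.sigma j :=
    fun U i hi => le_iSup₂_of_le i hi le_rfl
  rw [IndepFun_iff_Indep]
  refine indep_of_indep_of_le_left (indep_of_indep_of_le_right h ?_) ?_
  · refine Measurable.comap_le (PicoTier.measurable_mark_of_le f M ?_ ?_ ?_) <;>
      exact hle S' _ (by simp [hS'])
  · exact Measurable.comap_le (PicoTier.measurable_locations_marks_of_le f M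
      (hle S _ (Or.inl rfl)) (fun n hn => hle S _ (Or.inr ⟨n, hn, Or.inl rfl⟩))
      (fun n hn => hle S _ (Or.inr ⟨n, hn, Or.inr (Or.inl rfl)⟩))
      (fun n hn => hle S _ (Or.inr ⟨n, hn, Or.inr (Or.inr rfl)⟩)))

/-- The joint law of the fading power and the angle of a BS. -/
def channelLaw (Q : Params Nc) : Measure (ℝ × ℝ) :=
  (gammaMeasure (Q.Nnak : ℝ) (Q.Nnak : ℝ)).prod
    (cond volume (Set.Icc (-(Q.d / Q.wl)) (Q.d / Q.wl)))

lemma IsPicoTier.map_channel (hT : IsPicoTier μ Q T) [IsProbabilityMeasure μ] (n : ℕ) :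
    μ.map (fun ω => (T.fading n ω, T.angle n ω)) = channelLaw Q := by
  have hind : IndepFun (T.fading n) (T.angle n) μ := by
    rw [IndepFun_iff_Indep]
    exact hT.indep.indep (i := .fading n) (j := .angle n) (by simp)
  rw [(indepFun_iff_map_prod_eq_prod_map_map (hT.fading_measurable n).aemeasurable
    (hT.angle_measurable n).aemeasurable).1 hind, hT.fading_law n, channelLaw]
  congr 1
  exact hT.angle_law n

lemma isProbabilityMeasure_channelLaw (Q : Params Nc) : IsProbabilityMeasure (channelLaw Q) := by
  have hN : (0 : ℝ) < Q.Nnak := by exact_mod_cast Q.Nnak_pos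
  have := isProbabilityMeasure_gammaMeasure hN hN
  have hd : 0 < Q.d / Q.wl := div_pos Q.d_pos Q.wl_pos
  have : IsProbabilityMeasure (cond (volume : Measure ℝ) (Set.Icc (-(Q.d / Q.wl)) (Q.d / Q.wl))) := by
    refine cond_isProbabilityMeasure_of_finite ?_ ?_
    · rw [Real.volume_Icc]
      simp
      linarith
    · rw [Real.volume_Icc]
      exact ENNReal.ofReal_ne_top
  unfold channelLaw
  infer_instance

/-- Averaging a functional of the mark that distinguishes the BSs storing `f`. -/
lemma IsPicoTier.integral_mark (hT : IsPicoTier μ Q T) [IsProbabilityMeasure μ] (f : Fin Nc)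
    (n : ℕ) {A B : ℝ × ℝ → ℝ} (hA : Measurable A) (hB : Measurable B)
    (hA0 : ∀ z, 0 ≤ A z) (hA1 : ∀ z, A z ≤ 1) (hB0 : ∀ z, 0 ≤ B z) (hB1 : ∀ z, B z ≤ 1)
    {F : Prop × ℝ × ℝ → ℝ} (hF : Measurable F) (hFA : ∀ z, F (True, z) = A z)
    (hFB : ∀ z, F (False, z) = B z) :
    ∫ z, F z ∂(μ.map (T.mark f n)) = Q.p f * ∫ z, A z ∂(channelLaw Q) +
      (1 - Q.p f) * ∫ z, B z ∂(channelLaw Q) := by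
  set Y : Ω → ℝ × ℝ := fun ω => (T.fading n ω, T.angle n ω) with hY
  have hYm : Measurable Y := (hT.fading_measurable n).prodMk (hT.angle_measurable n)
  have hCσ : MeasurableSet[T.sigma (.cache n)] {ω | f ∈ T.cache n ω} :=
    ⟨{s | f ∈ s}, measurableSet_setOfPred.2 (measurable_set_mem f), rfl⟩
  have hC : MeasurableSet {ω | f ∈ T.cache n ω} := hT.sigma_le _ _ hCσ
  have hind : Indep (T.sigma (.cache n)) (MeasurableSpace.comap Y inferInstance) μ := by
    have hdisj : Disjoint ({.cache n} : Set Source) {.fading n, .angle n} := by simp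
    have h := indep_iSup_of_disjoint hT.sigma_le hT.indep hdisj
    have hle : ∀ (U : Set Source) (i : Source), i ∈ U → T.sigma i ≤ ⨆ j ∈ U, T.sigma j :=
      fun U i hi => le_iSup₂_of_le i hi le_rfl
    refine indep_of_indep_of_le_left (indep_of_indep_of_le_right h ?_) (hle _ _ (by simp))
    exact Measurable.comap_le (PicoTier.measurable_channel_of_le n (hle _ _ (by simp))
      (hle _ _ (by simp)))
  have hlaw : ∀ {g : ℝ × ℝ → ℝ}, Measurable g → ∫ ω, g (Y ω) ∂μ = ∫ z, g z ∂(channelLaw Q) := by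
    intro g hg
    rw [← hT.map_channel n, integral_map hYm.aemeasurable hg.aestronglyMeasurable]
  have hp : μ.real {ω | f ∈ T.cache n ω} = Q.p f := by
    rw [measureReal_def, hT.cache_law n f, ENNReal.toReal_ofReal (Q.p_nonneg f)]
  have hFm : Measurable fun ω => F (T.mark f n ω) := hF.comp (hT.measurable_mark f n)
  have hF1 : ∀ ω, f ∈ T.cache n ω → F (T.mark f n ω) = A (Y ω) := by
    intro ω hω
    rw [← hFA, PicoTier.mark, eq_true hω]
  have hF2 : ∀ ω, f ∉ T.cache n ω → F (T.mark f n ω) = B (Y ω) := by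
    intro ω hω
    rw [← hFB, PicoTier.mark, eq_false hω]
  have hFint : Integrable (fun ω => F (T.mark f n ω)) μ := by
    refine integrable_of_mem_unit hFm.aestronglyMeasurable (fun ω => ?_) fun ω => ?_
    all_goals by_cases hω : f ∈ T.cache n ω
    · rw [hF1 ω hω]; exact hA0 _
    · rw [hF2 ω hω]; exact hB0 _
    · rw [hF1 ω hω]; exact hA1 _
    · rw [hF2 ω hω]; exact hB1 _
  -- Split on the event that the BS stores f; it belongs to the cache σ-algebra, which is
  -- independent of the channel, so each half factorises.
  rw [integral_map (hT.measurable_mark f n).aemeasurable hF.aestronglyMeasurable,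
    ← integral_add_compl hC hFint, setIntegral_congr_fun hC hF1,
    setIntegral_congr_fun hC.compl hF2,
    Indep.setIntegral_eq_smul (hT.sigma_le _) hind hYm.aemeasurable hCσ hA.aestronglyMeasurable,
    Indep.setIntegral_eq_smul (hT.sigma_le _) hind hYm.aemeasurable hCσ.compl
      hB.aestronglyMeasurable, hlaw hA, hlaw hB, probReal_compl_eq_one_sub hC, hp, smul_eq_mul,
    smul_eq_mul]

end Tier

end Marks

/-! ### The product functional behind the Laplace transform, and its mean. -/

section Attenuation

variable {Nc : ℕ}

lemma measurable_pathLoss (Q : Params Nc) : Measurable (pathLoss Q) := by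
  unfold pathLoss
  refine Measurable.ite ?_ (by fun_prop) measurable_const
  exact measurableSet_le measurable_const (by fun_prop)

lemma pathLoss_nonneg (Q : Params Nc) {v : ℝ} (hv : 0 ≤ v) : 0 ≤ pathLoss Q v := by
  unfold pathLoss
  have := Q.C_pos
  split_ifs <;> positivity

lemma pathLoss_of_lt (Q : Params Nc) {v : ℝ} (hv : Q.RL < v) : pathLoss Q v = 0 := by
  rw [pathLoss, if_neg (by linarith)]

/-- Power received from a BS at `x` with fading power `|z.1|` and angle `z.2`. -/
def rxPower (Q : Params Nc) (x : Plane) (z : ℝ × ℝ) : ℝ :=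
  Q.P * pathLoss Q ‖x‖ * (Q.Nant * |z.1| * arrayGain Q.Nant z.2)

/-- The absolute value of the fading makes this hold for every z and puts all Laplace factors in [0,
1] everywhere. It changes nothing almost surely, Gamma variables being nonnegative. -/
lemma rxPower_nonneg (Q : Params Nc) (x : Plane) (z : ℝ × ℝ) : 0 ≤ rxPower Q x z := by
  have h1 := Q.P_pos
  have h2 := pathLoss_nonneg Q (norm_nonneg x)
  have h3 := arrayGain_nonneg Q.Nant z.2
  unfold rxPower
  positivity

lemma rxPower_of_lt (Q : Params Nc) {x : Plane} (hx : Q.RL < ‖x‖) (z : ℝ × ℝ) :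
    rxPower Q x z = 0 := by
  rw [rxPower, pathLoss_of_lt Q hx]
  ring

lemma measurable_rxPower (Q : Params Nc) : Measurable (Function.uncurry (rxPower Q)) := by
  have h1 := measurable_pathLoss Q
  have h2 := (continuous_arrayGain Q.Nant_pos).measurable
  unfold rxPower
  fun_prop

/-- Laplace factor of a single interferer. -/
def attn (Q : Params Nc) (κ : ℝ) (x : Plane) (z : ℝ × ℝ) : ℝ := Real.exp (-(κ * rxPower Q x z))

lemma attn_nonneg (Q : Params Nc) (κ : ℝ) (x : Plane) (z : ℝ × ℝ) : 0 ≤ attn Q κ x z :=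
  (Real.exp_pos _).le

lemma attn_le_one (Q : Params Nc) {κ : ℝ} (hκ : 0 ≤ κ) (x : Plane) (z : ℝ × ℝ) :
    attn Q κ x z ≤ 1 :=
  Real.exp_le_one_iff.2 (neg_nonpos.2 (mul_nonneg hκ (rxPower_nonneg Q x z)))

lemma attn_of_lt (Q : Params Nc) (κ : ℝ) {x : Plane} (hx : Q.RL < ‖x‖) (z : ℝ × ℝ) :
    attn Q κ x z = 1 := by
  simp [attn, rxPower_of_lt Q hx]

lemma measurable_attn (Q : Params Nc) (κ : ℝ) : Measurable (Function.uncurry (attn Q κ)) :=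
  Real.measurable_exp.comp ((measurable_rxPower Q).const_mul κ).neg

lemma measurable_attn_comp (Q : Params Nc) (κ : ℝ) {α : Type*} [MeasurableSpace α]
    {g : α → Plane} {h : α → ℝ × ℝ} (hg : Measurable g) (hh : Measurable h) :
    Measurable fun y => attn Q κ (g y) (h y) := by
  have h1 := measurable_pathLoss Q
  have h2 := (continuous_arrayGain Q.Nant_pos).measurable
  unfold attn rxPower
  fun_prop

/-- Laplace factor of a single interferer at `x`, averaged over the channel. -/
def meanAttn (Q : Params Nc) (κ : ℝ) (x : Plane) : ℝ := ∫ z, attn Q κ x z ∂(channelLaw Q)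

lemma measurable_meanAttn (Q : Params Nc) (κ : ℝ) : Measurable (meanAttn Q κ) := by
  have := isProbabilityMeasure_channelLaw Q
  exact (measurable_attn Q κ).stronglyMeasurable.integral_prod_right.measurable

lemma meanAttn_nonneg (Q : Params Nc) (κ : ℝ) (x : Plane) : 0 ≤ meanAttn Q κ x :=
  integral_nonneg (attn_nonneg Q κ x)

lemma meanAttn_le_one (Q : Params Nc) {κ : ℝ} (hκ : 0 ≤ κ) (x : Plane) : meanAttn Q κ x ≤ 1 := by
  have := isProbabilityMeasure_channelLaw Q
  have h := integral_mono_of_nonneg (μ := channelLaw Q) (Eventually.of_forall (attn_nonneg Q κ x))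
    (integrable_const (1 : ℝ)) (Eventually.of_forall (attn_le_one Q hκ x))
  simpa [meanAttn] using h

lemma meanAttn_of_lt (Q : Params Nc) (κ : ℝ) {x : Plane} (hx : Q.RL < ‖x‖) :
    meanAttn Q κ x = 1 := by
  have := isProbabilityMeasure_channelLaw Q
  simp [meanAttn, attn_of_lt Q κ hx]

open Classical in
/-- Factor of a BS in the functional `1{no BS storing f within a} exp(-κ U)`, where `U` is the
power received from all BSs but those storing `f` within distance `b`. -/
def thinFactor (Q : Params Nc) (κ a b : ℝ) (x : Plane) (m : Prop × ℝ × ℝ) : ℝ :=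
  if m.1 then (if ‖x‖ ≤ a then 0 else if ‖x‖ ≤ b then 1 else attn Q κ x m.2)
  else attn Q κ x m.2

lemma measurable_thinFactor (Q : Params Nc) (κ a b : ℝ) :
    Measurable (Function.uncurry (thinFactor Q κ a b)) := by
  have h1 : Measurable fun y : Plane × Prop × ℝ × ℝ => attn Q κ y.1 y.2.2 :=
    measurable_attn_comp Q κ measurable_fst (measurable_snd.comp measurable_snd)
  have hn : ∀ c : ℝ, MeasurableSet {y : Plane × Prop × ℝ × ℝ | ‖y.1‖ ≤ c} := fun c =>
    measurableSet_le (by fun_prop) measurable_const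
  have hp : MeasurableSet {y : Plane × Prop × ℝ × ℝ | y.2.1} :=
    measurableSet_setOfPred.2 (measurable_fst.comp measurable_snd)
  unfold thinFactor
  exact Measurable.ite hp (Measurable.ite (hn a) measurable_const
    (Measurable.ite (hn b) measurable_const h1)) h1

lemma measurable_thinFactor_comp (Q : Params Nc) (κ a b : ℝ) {α : Type*} [MeasurableSpace α]
    {g : α → Plane} {h : α → Prop × ℝ × ℝ} (hg : Measurable g) (hh : Measurable h) :
    Measurable fun y => thinFactor Q κ a b (g y) (h y) :=
  (measurable_thinFactor Q κ a b).comp (hg.prodMk hh)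

lemma thinFactor_nonneg (Q : Params Nc) (κ a b : ℝ) (x : Plane) (m : Prop × ℝ × ℝ) :
    0 ≤ thinFactor Q κ a b x m := by
  have := attn_nonneg Q κ x m.2
  unfold thinFactor
  split_ifs <;> simp [this]

lemma thinFactor_le_one (Q : Params Nc) {κ : ℝ} (hκ : 0 ≤ κ) (a b : ℝ) (x : Plane)
    (m : Prop × ℝ × ℝ) : thinFactor Q κ a b x m ≤ 1 := by
  have := attn_le_one Q hκ x m.2
  unfold thinFactor
  split_ifs <;> simp [this]

lemma thinFactor_of_lt (Q : Params Nc) (κ : ℝ) {a b : ℝ} {x : Plane} (hR : Q.RL < ‖x‖)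
    (ha : a < ‖x‖) (m : Prop × ℝ × ℝ) : thinFactor Q κ a b x m = 1 := by
  have := attn_of_lt Q κ hR m.2
  unfold thinFactor
  split_ifs <;> first | rfl | exact this | linarith

/-- Exponent of the Laplace transform of the power received from all BSs but those storing `f`
within distance `b`, per unit density. -/
def interfExponent (Q : Params Nc) (f : Fin Nc) (κ b : ℝ) : ℝ :=
  ∫ x : Plane, ((1 - Q.p f) + Q.p f * {x : Plane | b < ‖x‖}.indicator 1 x) * (1 - meanAttn Q κ x)

lemma measurable_interfExponent_integrand (Q : Params Nc) (f : Fin Nc) (κ b : ℝ) :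
    Measurable fun x : Plane =>
      ((1 - Q.p f) + Q.p f * {x : Plane | b < ‖x‖}.indicator 1 x) * (1 - meanAttn Q κ x) := by
  have hs : MeasurableSet {x : Plane | b < ‖x‖} :=
    measurableSet_lt measurable_const measurable_norm
  have h1 : Measurable ({x : Plane | b < ‖x‖}.indicator (1 : Plane → ℝ)) :=
    measurable_one.indicator hs
  exact (measurable_const.add (h1.const_mul _)).mul
    (measurable_const.sub (measurable_meanAttn Q κ))

lemma thinning_weight_mem (Q : Params Nc) (f : Fin Nc) (b : ℝ) (x : Plane) :
    0 ≤ (1 - Q.p f) + Q.p f * {x : Plane | b < ‖x‖}.indicator 1 x ∧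
      (1 - Q.p f) + Q.p f * {x : Plane | b < ‖x‖}.indicator 1 x ≤ 1 := by
  have hp0 := Q.p_nonneg f
  have hp1 := Q.p_le_one f
  have hi : {x : Plane | b < ‖x‖}.indicator (1 : Plane → ℝ) x = 0 ∨
      {x : Plane | b < ‖x‖}.indicator (1 : Plane → ℝ) x = 1 :=
    Set.indicator_eq_zero_or_self _ _ _
  rcases hi with h | h <;> rw [h] <;> constructor <;> linarith

lemma interfExponent_integrand_nonneg (Q : Params Nc) (f : Fin Nc) {κ : ℝ} (hκ : 0 ≤ κ) (b : ℝ)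
    (x : Plane) :
    0 ≤ ((1 - Q.p f) + Q.p f * {x : Plane | b < ‖x‖}.indicator 1 x) * (1 - meanAttn Q κ x) :=
  mul_nonneg (thinning_weight_mem Q f b x).1 (by linarith [meanAttn_le_one Q hκ x])

lemma norm_interfExponent_integrand_le (Q : Params Nc) (f : Fin Nc) {κ : ℝ} (hκ : 0 ≤ κ) (b : ℝ)
    (x : Plane) :
    ‖((1 - Q.p f) + Q.p f * {x : Plane | b < ‖x‖}.indicator 1 x) * (1 - meanAttn Q κ x)‖ ≤
      (Metric.closedBall (0 : Plane) Q.RL).indicator (fun _ => (1 : ℝ)) x := by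
  have hm0 := meanAttn_nonneg Q κ x
  have hm1 := meanAttn_le_one Q hκ x
  rw [Real.norm_of_nonneg (interfExponent_integrand_nonneg Q f hκ b x)]
  by_cases hx : x ∈ Metric.closedBall (0 : Plane) Q.RL
  · rw [Set.indicator_of_mem hx]
    exact mul_le_one₀ (thinning_weight_mem Q f b x).2 (by linarith) (by linarith)
  · rw [Set.indicator_of_notMem hx, meanAttn_of_lt Q κ (by simpa using hx)]
    simp

lemma integrable_indicator_closedBall (r : ℝ) :
    Integrable ((Metric.closedBall (0 : Plane) r).indicator fun _ => (1 : ℝ)) :=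
  (integrable_indicator_iff Metric.isClosed_closedBall.measurableSet).2
    (integrableOn_const (hs := (Metric.isBounded_closedBall.measure_lt_top).ne))

lemma integrable_interfExponent (Q : Params Nc) (f : Fin Nc) {κ : ℝ} (hκ : 0 ≤ κ) (b : ℝ) :
    Integrable fun x : Plane =>
      ((1 - Q.p f) + Q.p f * {x : Plane | b < ‖x‖}.indicator 1 x) * (1 - meanAttn Q κ x) :=
  (integrable_indicator_closedBall Q.RL).mono'
    (measurable_interfExponent_integrand Q f κ b).aestronglyMeasurable
    (Eventually.of_forall (norm_interfExponent_integrand_le Q f hκ b))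

lemma volume_closedBall_toReal {r : ℝ} (hr : 0 ≤ r) :
    (volume (Metric.closedBall (0 : Plane) r)).toReal = Real.pi * r ^ 2 := by
  rw [EuclideanSpace.volume_closedBall_fin_two, ENNReal.toReal_mul, ENNReal.toReal_pow,
    ENNReal.toReal_ofReal hr]
  rw [ENNReal.toReal_ofReal Real.pi_pos.le, mul_comm]

variable {Ω : Type*} [MeasurableSpace Ω] {μ : Measure Ω} [IsProbabilityMeasure μ] {Q : Params Nc}
  {T : PicoTier Ω Nc}

/-- Average the marks, then apply the generating functional. One minus the mean factor is a sum of p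
1{‖x‖ ≤ a} and the integrand of `interfExponent`, so the exponential factorises into the void
probability of the BSs storing f and the Laplace transform of the background. -/
lemma IsPicoTier.integral_finprod_thinFactor (hT : IsPicoTier μ Q T) (f : Fin Nc) {κ a b : ℝ}
    (hκ : 0 ≤ κ) (ha : 0 ≤ a) (hab : a ≤ b) :
    ∫ ω, ∏ᶠ n, thinFactor Q κ a b (T.loc n ω) (T.mark f n ω) ∂μ =
      Real.exp (-(Q.lam * (Q.p f * (Real.pi * a ^ 2)))) *
        Real.exp (-(Q.lam * interfExponent Q f κ b)) := by
  set K : ℝ := max Q.RL a with hK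
  have hKR : Q.RL ≤ K := le_max_left _ _
  have hKa : a ≤ K := le_max_right _ _
  have hpC := isProbabilityMeasure_channelLaw Q
  set ν : Measure (Prop × ℝ × ℝ) := μ.map (T.mark f 0) with hν
  have hpν : IsProbabilityMeasure ν :=
    Measure.isProbabilityMeasure_map (hT.measurable_mark f 0).aemeasurable
  -- The marks are identically distributed: `integral_mark` at indicators gives values free of the
  -- index.
  have hsame : ∀ n, μ.map (T.mark f n) = ν := by
    intro n
    have hval : ∀ k, ∀ s : Set (Prop × ℝ × ℝ), MeasurableSet s → (μ.map (T.mark f k)).real s =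
        Q.p f * ∫ z, {z | (True, z) ∈ s}.indicator 1 z ∂(channelLaw Q) +
        (1 - Q.p f) * ∫ z, {z | (False, z) ∈ s}.indicator 1 z ∂(channelLaw Q) := by
      intro k s hs
      have hs1 : ∀ P : Prop, MeasurableSet {z : ℝ × ℝ | (P, z) ∈ s} :=
        fun P => measurable_prodMk_left hs
      have h01 : ∀ (t : Set (ℝ × ℝ)) z, 0 ≤ t.indicator (1 : ℝ × ℝ → ℝ) z ∧
          t.indicator (1 : ℝ × ℝ → ℝ) z ≤ 1 := by
        intro t z
        rcases Set.indicator_eq_zero_or_self t (1 : ℝ × ℝ → ℝ) z with h | h <;> rw [h] <;> simp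
      rw [← hT.integral_mark f k (measurable_one.indicator (hs1 True))
        (measurable_one.indicator (hs1 False)) (fun z => (h01 _ z).1) (fun z => (h01 _ z).2)
        (fun z => (h01 _ z).1) (fun z => (h01 _ z).2) (measurable_one.indicator hs)
        (fun z => rfl) (fun z => rfl), integral_indicator_one hs]
    have hpn : IsProbabilityMeasure (μ.map (T.mark f n)) :=
      Measure.isProbabilityMeasure_map (hT.measurable_mark f n).aemeasurable
    ext s hs
    have := (hval n s hs).trans (hval 0 s hs).symm
    exact (measureReal_eq_measureReal_iff).1 this
  have hball : MeasurableSet (Metric.closedBall (0 : Plane) K) :=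
    Metric.isClosed_closedBall.measurableSet
  have hmarked := integral_finprod_marked (μ := μ) (X := T.loc) (Z := T.mark f) hT.hppp.measurable
    (hT.measurable_mark f) (hT.indepFun_mark f) hsame (measurable_thinFactor Q κ a b)
    (thinFactor_nonneg Q κ a b) (thinFactor_le_one Q hκ a b)
    (B := Metric.closedBall (0 : Plane) K)
    (fun x hx m => by
      have hx' : K < ‖x‖ := by simpa using hx
      exact thinFactor_of_lt Q κ (hKR.trans_lt hx') (hKa.trans_lt hx') m)
    (hT.hppp.ae_finite hball Metric.isBounded_closedBall)
  rw [hmarked]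
  have hmean : ∀ x, ∫ z, thinFactor Q κ a b x z ∂ν =
      Q.p f * (if ‖x‖ ≤ a then 0 else if ‖x‖ ≤ b then 1 else meanAttn Q κ x) +
      (1 - Q.p f) * meanAttn Q κ x := by
    intro x
    have hat : Measurable (attn Q κ x) := measurable_attn_comp Q κ measurable_const measurable_id
    have hF : Measurable (thinFactor Q κ a b x) :=
      measurable_thinFactor_comp Q κ a b measurable_const measurable_id
    rw [hT.integral_mark f 0 (A := fun z => thinFactor Q κ a b x (True, z))
      (B := fun z => attn Q κ x z) (hF.comp measurable_prodMk_left) hat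
      (fun z => thinFactor_nonneg Q κ a b x _) (fun z => thinFactor_le_one Q hκ a b x _)
      (attn_nonneg Q κ x) (attn_le_one Q hκ x) hF (fun z => rfl)
      (fun z => by simp [thinFactor])]
    congr 2
    simp only [thinFactor, if_true]
    split_ifs
    · simp
    · simp
    · rfl
  have hmeas : Measurable fun x => ∫ z, thinFactor Q κ a b x z ∂ν :=
    (measurable_thinFactor Q κ a b).stronglyMeasurable.integral_prod_right.measurable
  rw [hT.hppp.integral_finprod Q.lam_pos.le hmeas
    (fun x => integral_nonneg (thinFactor_nonneg Q κ a b x))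
    (fun x => by
      have h := integral_mono_of_nonneg (μ := ν)
        (Eventually.of_forall (thinFactor_nonneg Q κ a b x))
        (integrable_const (1 : ℝ)) (Eventually.of_forall (thinFactor_le_one Q hκ a b x))
      simpa using h) (K := K)
    (fun x hx => by simp [thinFactor_of_lt Q κ (hKR.trans_lt hx) (hKa.trans_lt hx)]),
    ← Real.exp_add]
  congr 1
  -- Checked on ‖x‖ ≤ a, on a < ‖x‖ ≤ b and beyond b; a ≤ b rules out the other combinations.
  have hsplit : ∀ x : Plane, 1 - ∫ z, thinFactor Q κ a b x z ∂ν =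
      Q.p f * (Metric.closedBall (0 : Plane) a).indicator 1 x +
      ((1 - Q.p f) + Q.p f * {x : Plane | b < ‖x‖}.indicator 1 x) * (1 - meanAttn Q κ x) := by
    intro x
    classical
    rw [hmean x]
    simp only [Set.indicator_apply, mem_closedBall_zero_iff, Set.mem_ofPred_eq, Pi.one_apply]
    split_ifs <;> first | ring1 | (exfalso; linarith)
  have hballa : MeasurableSet (Metric.closedBall (0 : Plane) a) :=
    Metric.isClosed_closedBall.measurableSet
  simp only [hsplit]
  rw [integral_add _ (integrable_interfExponent Q f hκ b), integral_const_mul,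
    integral_indicator_one hballa, measureReal_def, volume_closedBall_toReal ha, interfExponent]
  · ring
  · exact (integrable_indicator_closedBall a).const_mul _

end Attenuation

/-! ### Serving distance, interference and background for a fixed configuration, and their
measurability. -/

section Pathwise

lemma thinFactor_of_stored {Nc : ℕ} {Q : Params Nc} {κ a b : ℝ} {x : Plane} {m : Prop × ℝ × ℝ}
    (h : m.1) : thinFactor Q κ a b x m =
      if ‖x‖ ≤ a then 0 else if ‖x‖ ≤ b then 1 else attn Q κ x m.2 :=
  if_pos h

lemma thinFactor_of_not_stored {Nc : ℕ} {Q : Params Nc} {κ a b : ℝ} {x : Plane}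
    {m : Prop × ℝ × ℝ} (h : ¬ m.1) : thinFactor Q κ a b x m = attn Q κ x m.2 :=
  if_neg h

section Pathwise

variable {Ω : Type*} {Nc : ℕ} {Q : Params Nc} {T : PicoTier Ω Nc} {f : Fin Nc} {ω : Ω}

/-- A configuration with finitely many BSs in each disc and nonnegative fading powers. -/
def PicoTier.IsRegular (T : PicoTier Ω Nc) (ω : Ω) : Prop :=
  (∀ k : ℕ, {n | ‖T.loc n ω‖ ≤ k}.Finite) ∧ ∀ n, 0 ≤ T.fading n ω

/-- No BS within distance `t` stores `f`. -/
def PicoTier.NoneWithin (T : PicoTier Ω Nc) (f : Fin Nc) (t : ℝ) (ω : Ω) : Prop :=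
  ∀ n, f ∈ T.cache n ω → t < ‖T.loc n ω‖

/-- Power received from the `n`-th BS. -/
def PicoTier.rx (T : PicoTier Ω Nc) (Q : Params Nc) (n : ℕ) (ω : Ω) : ℝ :=
  rxPower Q (T.loc n ω) (T.fading n ω, T.angle n ω)

open Classical in
/-- Power received from all BSs but those storing `f` within distance `b`. -/
def PicoTier.background (T : PicoTier Ω Nc) (Q : Params Nc) (f : Fin Nc) (b : ℝ) (ω : Ω) : ℝ :=
  ∑' n, if f ∈ T.cache n ω ∧ ‖T.loc n ω‖ ≤ b then 0 else T.rx Q n ω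

lemma PicoTier.rx_nonneg (n : ℕ) : 0 ≤ T.rx Q n ω := rxPower_nonneg _ _ _

lemma PicoTier.rx_of_lt {n : ℕ} (h : Q.RL < ‖T.loc n ω‖) : T.rx Q n ω = 0 := rxPower_of_lt Q h _

open Classical in
lemma PicoTier.IsRegular.interference_eq (h : T.IsRegular ω) :
    T.interference Q f ω = ∑' n, if T.IsServing f n ω then 0 else T.rx Q n ω := by
  refine tsum_congr fun n => ?_
  split_ifs
  · rfl
  · rw [PicoTier.rx, rxPower, abs_of_nonneg (h.2 n)]

lemma PicoTier.IsRegular.exists_finset (h : T.IsRegular ω) (t : ℝ) :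
    ∃ S : Finset ℕ, ∀ n ∉ S, t < ‖T.loc n ω‖ := by
  obtain ⟨k, hk⟩ := exists_nat_ge t
  refine ⟨(h.1 k).toFinset, fun n hn => ?_⟩
  simp only [Set.Finite.mem_toFinset, Set.mem_ofPred_eq, not_le] at hn
  linarith

/-- One BS storing f within a contributes a zero factor; if there is none, the exponentials
multiply. Only finitely many BSs have a factor other than 1. -/
lemma PicoTier.IsRegular.finprod_thinFactor (h : T.IsRegular ω) {κ a b : ℝ}
    [Decidable (T.NoneWithin f a ω)] :
    ∏ᶠ n, thinFactor Q κ a b (T.loc n ω) (T.mark f n ω) =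
      if T.NoneWithin f a ω then Real.exp (-(κ * T.background Q f b ω)) else 0 := by
  classical
  obtain ⟨S, hS⟩ := h.exists_finset (max Q.RL a)
  have hprod : ∏ᶠ n, thinFactor Q κ a b (T.loc n ω) (T.mark f n ω) =
      ∏ n ∈ S, thinFactor Q κ a b (T.loc n ω) (T.mark f n ω) := by
    refine finprod_eq_prod_of_mulSupport_subset _ fun n hn => ?_
    by_contra hcon
    exact hn (thinFactor_of_lt Q κ ((le_max_left _ _).trans_lt (hS n hcon))
      ((le_max_right _ _).trans_lt (hS n hcon)) _)
  rw [hprod]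
  split_ifs with hnone
  · have hsum : T.background Q f b ω =
        ∑ n ∈ S, if f ∈ T.cache n ω ∧ ‖T.loc n ω‖ ≤ b then 0 else T.rx Q n ω := by
      refine tsum_eq_sum fun n hn => ?_
      rw [PicoTier.rx_of_lt ((le_max_left _ _).trans_lt (hS n hn)), ite_self]
    rw [hsum, Finset.mul_sum, ← Finset.sum_neg_distrib, Real.exp_sum]
    refine Finset.prod_congr rfl fun n _ => ?_
    by_cases hc : f ∈ T.cache n ω
    · rw [thinFactor_of_stored (show (T.mark f n ω).1 from hc),
        if_neg (not_le.2 (hnone n hc))]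
      by_cases hb : ‖T.loc n ω‖ ≤ b
      · rw [if_pos hb, if_pos ⟨hc, hb⟩]
        simp
      · rw [if_neg hb, if_neg fun h => hb h.2]
        rfl
    · rw [thinFactor_of_not_stored (show ¬ (T.mark f n ω).1 from hc), if_neg fun h => hc h.1]
      rfl
  · simp only [PicoTier.NoneWithin, not_forall, not_lt] at hnone
    obtain ⟨n, hc, hn⟩ := hnone
    refine Finset.prod_eq_zero (i := n) ?_ ?_
    · by_contra hcon
      have := hS n hcon
      exact absurd hn (not_le.2 ((le_max_right _ _).trans_lt this))
    · rw [thinFactor_of_stored (show (T.mark f n ω).1 from hc), if_pos hn]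

lemma bddBelow_servingDist :
    BddBelow {v | ∃ n, f ∈ T.cache n ω ∧ v = ‖T.loc n ω‖} :=
  ⟨0, by rintro v ⟨n, _, rfl⟩; exact norm_nonneg _⟩

lemma servingDist_le {n : ℕ} (hn : f ∈ T.cache n ω) : T.servingDist f ω ≤ ‖T.loc n ω‖ :=
  csInf_le bddBelow_servingDist ⟨n, hn, rfl⟩

/-- The infimum is attained because each disc contains finitely many BSs. -/
lemma PicoTier.IsRegular.exists_norm_eq_servingDist (h : T.IsRegular ω) {n : ℕ}
    (hn : f ∈ T.cache n ω) : ∃ m, f ∈ T.cache m ω ∧ ‖T.loc m ω‖ = T.servingDist f ω := by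
  obtain ⟨k, hk⟩ := exists_nat_ge ‖T.loc n ω‖
  have hfin : {m | ‖T.loc m ω‖ ≤ k ∧ f ∈ T.cache m ω}.Finite := (h.1 k).subset fun m hm => hm.1
  obtain ⟨m, hm, hmin⟩ := Set.exists_min_image _ (fun m => ‖T.loc m ω‖) hfin ⟨n, hk, hn⟩
  refine ⟨m, hm.2, le_antisymm ?_ (servingDist_le hm.2)⟩
  refine le_csInf ⟨_, n, hn, rfl⟩ ?_
  rintro v ⟨j, hj, rfl⟩
  rcases le_or_gt ‖T.loc j ω‖ k with hjk | hjk
  · exact hmin j ⟨hjk, hj⟩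
  · exact hm.1.trans hjk.le

lemma PicoTier.IsRegular.servingDist_mem_Ioc_iff (h : T.IsRegular ω) {a b : ℝ} (ha : 0 ≤ a) :
    T.servingDist f ω ∈ Set.Ioc a b ↔ T.NoneWithin f a ω ∧ ¬ T.NoneWithin f b ω := by
  constructor
  · rintro ⟨h1, h2⟩
    refine ⟨fun n hn => h1.trans_le (servingDist_le hn), fun hnone => ?_⟩
    by_cases hex : ∃ n, f ∈ T.cache n ω
    · obtain ⟨n, hn⟩ := hex
      obtain ⟨m, hm, hmD⟩ := h.exists_norm_eq_servingDist hn
      have := hnone m hm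
      linarith
    -- If no BS stores f, the infimum of the empty set is 0, which lies outside (a, b] because a ≥
    -- 0.
    · have : T.servingDist f ω = 0 := by
        rw [PicoTier.servingDist]
        convert Real.sInf_empty
        ext v
        simp only [Set.mem_ofPred_eq, Set.mem_empty_iff_false, iff_false]
        rintro ⟨n, hn, _⟩
        exact hex ⟨n, hn⟩
      linarith
  · rintro ⟨h1, h2⟩
    simp only [PicoTier.NoneWithin, not_forall, not_lt] at h2
    obtain ⟨n, hn, hnb⟩ := h2
    obtain ⟨m, hm, hmD⟩ := h.exists_norm_eq_servingDist hn
    exact ⟨hmD ▸ h1 m hm, (servingDist_le hn).trans hnb⟩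

lemma PicoTier.IsServing.norm_le {n : ℕ} (hn : T.IsServing f n ω) {b : ℝ}
    (hb : ¬ T.NoneWithin f b ω) : ‖T.loc n ω‖ ≤ b := by
  simp only [PicoTier.NoneWithin, not_forall, not_lt] at hb
  obtain ⟨m, hm, hmb⟩ := hb
  exact (hn.2 m hm).trans hmb

lemma PicoTier.IsRegular.summable_of_le_rx (h : T.IsRegular ω) {g : ℕ → ℝ}
    (hg : ∀ n, T.rx Q n ω = 0 → g n = 0) : Summable g := by
  obtain ⟨S, hS⟩ := h.exists_finset Q.RL
  exact summable_of_ne_finset_zero fun n hn => hg n (PicoTier.rx_of_lt (hS n hn))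

lemma background_nonneg (b : ℝ) : 0 ≤ T.background Q f b ω :=
  tsum_nonneg fun n => by
    split_ifs
    · exact le_rfl
    · exact PicoTier.rx_nonneg n

/-- The set of points at distance in `(a, b]` from the user. -/
def annulus (a b : ℝ) : Set Plane := {x | a < ‖x‖ ∧ ‖x‖ ≤ b}

/-- The BSs storing f within b all lie in the annulus. If it holds at most one BS, that one is the
serving BS, and both sums omit exactly this term. -/
lemma PicoTier.IsRegular.interference_eq_background (h : T.IsRegular ω) {a b : ℝ}
    (ha : T.NoneWithin f a ω) (hb : ¬ T.NoneWithin f b ω)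
    (hcard : ¬ 2 ≤ {n | T.loc n ω ∈ annulus a b}.encard) :
    T.interference Q f ω = T.background Q f b ω := by
  classical
  have hone : ∀ m n, T.loc m ω ∈ annulus a b → T.loc n ω ∈ annulus a b → m = n := by
    intro m n hm hn
    by_contra hne
    refine hcard ?_
    rw [← Set.encard_pair hne]
    refine Set.encard_le_encard ?_
    rintro j (rfl | rfl)
    · exact hm
    · exact hn
  rw [h.interference_eq, PicoTier.background]
  refine tsum_congr fun n => ?_
  by_cases hs : T.IsServing f n ω
  · rw [if_pos hs, if_pos ⟨hs.1, hs.norm_le hb⟩]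
  · rw [if_neg hs, if_neg]
    rintro ⟨hn, hnb⟩
    obtain ⟨m, hm, hmD⟩ := h.exists_norm_eq_servingDist hn
    have hms : T.IsServing f m ω := ⟨hm, fun j hj => hmD ▸ servingDist_le hj⟩
    have : m = n := hone m n ⟨ha m hm, hms.norm_le hb⟩ ⟨ha n hn, hnb⟩
    exact hs (this ▸ hms)

lemma PicoTier.IsRegular.interference_nonneg (h : T.IsRegular ω) : 0 ≤ T.interference Q f ω := by
  classical
  rw [h.interference_eq]
  refine tsum_nonneg fun n => ?_
  split_ifs
  · exact le_rfl
  · exact PicoTier.rx_nonneg n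

end Pathwise

section Measurability

variable {Ω : Type*} [MeasurableSpace Ω] {μ : Measure Ω} {Nc : ℕ} {Q : Params Nc}
  {T : PicoTier Ω Nc}

lemma IsPicoTier.measurableSet_cache (hT : IsPicoTier μ Q T) (f : Fin Nc) (n : ℕ) :
    MeasurableSet {ω | f ∈ T.cache n ω} :=
  measurableSet_setOfPred.2 ((measurable_set_mem f).comp (hT.cache_measurable n))

lemma IsPicoTier.measurable_norm_loc (hT : IsPicoTier μ Q T) (n : ℕ) :
    Measurable fun ω => ‖T.loc n ω‖ := (hT.hppp.measurable n).norm

lemma IsPicoTier.measurable_servingDist (hT : IsPicoTier μ Q T) (f : Fin Nc) :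
    Measurable (T.servingDist f) := by
  refine measurable_of_Iio fun t => ?_
  -- The second set collects the outcomes where no BS stores f and the distance takes the default
  -- value 0.
  have hset : T.servingDist f ⁻¹' Set.Iio t =
      (⋃ n, {ω | f ∈ T.cache n ω} ∩ {ω | ‖T.loc n ω‖ < t}) ∪
        ({_ω | 0 < t} ∩ ⋂ n, {ω | f ∈ T.cache n ω}ᶜ) := by
    ext ω
    simp only [Set.mem_preimage, Set.mem_Iio, Set.mem_union, Set.mem_iUnion, Set.mem_inter_iff,
      Set.mem_ofPred_eq, Set.mem_iInter, Set.mem_compl_iff]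
    by_cases hex : ∃ n, f ∈ T.cache n ω
    · obtain ⟨n, hn⟩ := hex
      have hne : {v | ∃ n, f ∈ T.cache n ω ∧ v = ‖T.loc n ω‖}.Nonempty := ⟨_, n, hn, rfl⟩
      rw [PicoTier.servingDist, csInf_lt_iff bddBelow_servingDist hne]
      constructor
      · rintro ⟨v, ⟨m, hm, rfl⟩, hv⟩
        exact Or.inl ⟨m, hm, hv⟩
      · rintro (⟨m, hm, hv⟩ | ⟨_, hno⟩)
        · exact ⟨_, ⟨m, hm, rfl⟩, hv⟩
        · exact absurd hn (hno n)
    · have hD : T.servingDist f ω = 0 := by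
        rw [PicoTier.servingDist]
        convert Real.sInf_empty
        ext v
        simp only [Set.mem_ofPred_eq, Set.mem_empty_iff_false, iff_false]
        rintro ⟨n, hn, _⟩
        exact hex ⟨n, hn⟩
      rw [hD]
      push Not at hex
      constructor
      · exact fun h => Or.inr ⟨h, hex⟩
      · rintro (⟨m, hm, _⟩ | ⟨h, _⟩)
        · exact absurd hm (hex m)
        · exact h
  rw [hset]
  refine (MeasurableSet.iUnion fun n => (hT.measurableSet_cache f n).inter
    (measurableSet_lt (hT.measurable_norm_loc n) measurable_const)).union
    (MeasurableSet.inter (MeasurableSet.const _)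
      (MeasurableSet.iInter fun n => (hT.measurableSet_cache f n).compl))

lemma IsPicoTier.measurableSet_noneWithin (hT : IsPicoTier μ Q T) (f : Fin Nc) (t : ℝ) :
    MeasurableSet {ω | T.NoneWithin f t ω} := by
  have : {ω | T.NoneWithin f t ω} =
      ⋂ n, ({ω | f ∈ T.cache n ω}ᶜ ∪ {ω | t < ‖T.loc n ω‖}) := by
    ext ω
    simp only [Set.mem_ofPred_eq, PicoTier.NoneWithin, Set.mem_iInter, Set.mem_union,
      Set.mem_compl_iff, imp_iff_not_or]
  rw [this]
  exact MeasurableSet.iInter fun n => (hT.measurableSet_cache f n).compl.union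
    (measurableSet_lt measurable_const (hT.measurable_norm_loc n))

lemma IsPicoTier.measurableSet_isServing (hT : IsPicoTier μ Q T) (f : Fin Nc) (n : ℕ) :
    MeasurableSet {ω | T.IsServing f n ω} := by
  have : {ω | T.IsServing f n ω} = {ω | f ∈ T.cache n ω} ∩
      ⋂ m, ({ω | f ∈ T.cache m ω}ᶜ ∪ {ω | ‖T.loc n ω‖ ≤ ‖T.loc m ω‖}) := by
    ext ω
    simp only [Set.mem_ofPred_eq, PicoTier.IsServing, Set.mem_iInter, Set.mem_union,
      Set.mem_compl_iff, imp_iff_not_or, Set.mem_inter_iff]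
  rw [this]
  exact (hT.measurableSet_cache f n).inter (MeasurableSet.iInter fun m =>
    (hT.measurableSet_cache f m).compl.union
      (measurableSet_le (hT.measurable_norm_loc n) (hT.measurable_norm_loc m)))

lemma IsPicoTier.measurable_rx (hT : IsPicoTier μ Q T) (n : ℕ) : Measurable (T.rx Q n) := by
  have h1 := measurable_pathLoss Q
  have h2 := (continuous_arrayGain Q.Nant_pos).measurable
  have h3 := hT.hppp.measurable n
  have h4 := hT.fading_measurable n
  have h5 := hT.angle_measurable n
  unfold PicoTier.rx rxPower
  fun_prop

variable [IsProbabilityMeasure μ]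

lemma IsPicoTier.ae_isRegular (hT : IsPicoTier μ Q T) : ∀ᵐ ω ∂μ, T.IsRegular ω := by
  have h1 : ∀ᵐ ω ∂μ, ∀ k : ℕ, {n | ‖T.loc n ω‖ ≤ k}.Finite := by
    refine ae_all_iff.2 fun k => ?_
    have := hT.hppp.ae_finite (A := Metric.closedBall 0 k)
      Metric.isClosed_closedBall.measurableSet Metric.isBounded_closedBall
    simpa using this
  have h2 : ∀ᵐ ω ∂μ, ∀ n, 0 ≤ T.fading n ω := by
    refine ae_all_iff.2 fun n => ?_
    refine ae_of_ae_map (p := fun y => 0 ≤ y) (hT.fading_measurable n).aemeasurable ?_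
    rw [hT.fading_law n, gammaMeasure, ae_withDensity_iff (by
      exact (measurable_gammaPDFReal _ _).ennreal_ofReal)]
    refine Eventually.of_forall fun y hy => ?_
    by_contra hneg
    exact hy (gammaPDF_of_neg (not_le.1 hneg))
  filter_upwards [h1, h2] with ω h1 h2 using ⟨h1, h2⟩

lemma IsPicoTier.aemeasurable_tsum_ite (hT : IsPicoTier μ Q T) {p : ℕ → Ω → Prop}
    [∀ n ω, Decidable (p n ω)] (hp : ∀ n, MeasurableSet {ω | p n ω}) :
    AEMeasurable (fun ω => ∑' n, if p n ω then 0 else T.rx Q n ω) μ := by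
  refine aemeasurable_of_tendsto_metrizable_ae atTop
    (f := fun M ω => ∑ n ∈ Finset.range M, if p n ω then 0 else T.rx Q n ω) (fun M => ?_) ?_
  · exact (Finset.measurable_sum _ fun n _ =>
      Measurable.ite (hp n) measurable_const (hT.measurable_rx n)).aemeasurable
  · filter_upwards [hT.ae_isRegular] with ω hω
    exact (hω.summable_of_le_rx (Q := Q) fun n hn => by simp [hn]).hasSum.tendsto_sum_nat

lemma IsPicoTier.aemeasurable_interference (hT : IsPicoTier μ Q T) (f : Fin Nc) :
    AEMeasurable (T.interference Q f) μ := by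
  classical
  refine (hT.aemeasurable_tsum_ite (hT.measurableSet_isServing f)).congr ?_
  filter_upwards [hT.ae_isRegular] with ω hω using hω.interference_eq.symm

lemma IsPicoTier.aemeasurable_background (hT : IsPicoTier μ Q T) (f : Fin Nc) (b : ℝ) :
    AEMeasurable (T.background Q f b) μ := by
  classical
  exact hT.aemeasurable_tsum_ite fun n => (hT.measurableSet_cache f n).inter
    (measurableSet_le (hT.measurable_norm_loc n) measurable_const)

end Measurability

end Pathwise

/-! ### The conditional Laplace transform given the serving distance. -/

section ConditionalLaw

section ConditionalLaplace

/-- A function whose increments are quadratically small is constant. -/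
lemma eq_of_abs_sub_le_sq {g : ℝ → ℝ} {C : ℝ} (h : ∀ s t, |g s - g t| ≤ C * (s - t) ^ 2)
    (s t : ℝ) : g s = g t := by
  have hd : ∀ x, HasDerivAt g 0 x := by
    intro x
    rw [hasDerivAt_iff_tendsto_slope]
    have hlim : Tendsto (fun y => C * |y - x|) (𝓝[≠] x) (𝓝 0) := by
      have : Tendsto (fun y => C * |y - x|) (𝓝 x) (𝓝 (C * |x - x|)) :=
        Continuous.tendsto (by fun_prop) x
      simpa using this.mono_left nhdsWithin_le_nhds
    refine squeeze_zero_norm' ?_ hlim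
    filter_upwards [self_mem_nhdsWithin] with y hy
    have hne : 0 < |y - x| := abs_pos.2 (sub_ne_zero.2 hy)
    rw [slope_def_field, norm_div, Real.norm_eq_abs, Real.norm_eq_abs, div_le_iff₀ hne, mul_assoc,
      ← sq, sq_abs]
    exact h y x
  exact is_const_of_deriv_eq_zero (fun x => (hd x).differentiableAt) (fun x => (hd x).deriv) s t

variable {Ω : Type*} [MeasurableSpace Ω] {μ : Measure Ω} [IsProbabilityMeasure μ]

lemma setIntegral_integral_condDistrib {D I : Ω → ℝ} (hD : Measurable D) (hI : AEMeasurable I μ)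
    {φ : ℝ → ℝ} (hφ : Measurable φ) (hint : Integrable (fun ω => φ (I ω)) μ) {s : Set ℝ}
    (hs : MeasurableSet s) :
    ∫ r in s, ∫ y, φ y ∂(condDistrib I D μ r) ∂(μ.map D) = ∫ ω in D ⁻¹' s, φ (I ω) ∂μ := by
  have hprob : IsProbabilityMeasure (μ.map D) := Measure.isProbabilityMeasure_map hD.aemeasurable
  have hm : AEMeasurable (fun ω => (D ω, I ω)) μ := hD.aemeasurable.prodMk hI
  have hφ' : Measurable fun z : ℝ × ℝ => φ z.2 := hφ.comp measurable_snd
  have hint' : Integrable (fun z : ℝ × ℝ => φ z.2) ((μ.map D) ⊗ₘ condDistrib I D μ) := by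
    rw [compProd_map_condDistrib hI, integrable_map_measure hφ'.aestronglyMeasurable hm]
    exact hint
  have h := Measure.setIntegral_compProd hs MeasurableSet.univ hint'.integrableOn
  simp only [Measure.restrict_univ] at h
  rw [← h, compProd_map_condDistrib hI, setIntegral_map (hs.prod MeasurableSet.univ)
    hφ'.aestronglyMeasurable hm]
  congr 2
  ext ω
  simp

/-- Identification of a conditional expectation given a real random variable, from its integrals
over the intervals `(0, b]`. -/
lemma ae_integral_condDistrib_eq {D I : Ω → ℝ} (hD : Measurable D) (hI : AEMeasurable I μ)
    {φ : ℝ → ℝ} (hφ : Measurable φ) (hφ0 : ∀ y, 0 ≤ φ y)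
    (hint : Integrable (fun ω => φ (I ω)) μ) {g : ℝ → ℝ} (hg : Measurable g)
    (hg0 : ∀ r, 0 ≤ g r) (hg1 : ∀ r, g r ≤ 1) {R : ℝ}
    (h : ∀ b ≤ R, ∫ ω in D ⁻¹' Set.Ioc 0 b, φ (I ω) ∂μ = ∫ ω in D ⁻¹' Set.Ioc 0 b, g (D ω) ∂μ) :
    ∀ᵐ r ∂(μ.map D), r ∈ Set.Ioc 0 R → ∫ y, φ y ∂(condDistrib I D μ r) = g r := by
  have hprob : IsProbabilityMeasure (μ.map D) := Measure.isProbabilityMeasure_map hD.aemeasurable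
  set ρ : Measure ℝ := (μ.map D).restrict (Set.Ioc 0 R) with hρ
  set L : ℝ → ℝ := fun r => ∫ y, φ y ∂(condDistrib I D μ r) with hL
  have hLm : Measurable L := by
    have : StronglyMeasurable fun z : ℝ × ℝ => φ z.2 :=
      (hφ.comp measurable_snd).stronglyMeasurable
    exact this.integral_condDistrib.measurable
  have hL0 : ∀ r, 0 ≤ L r := fun r => integral_nonneg hφ0
  have hLint : Integrable L (μ.map D) := by
    have hm : AEMeasurable (fun ω => (D ω, I ω)) μ := hD.aemeasurable.prodMk hI
    have hφ' : Measurable fun z : ℝ × ℝ => φ z.2 := hφ.comp measurable_snd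
    exact ((integrable_map_measure hφ'.aestronglyMeasurable hm).2 hint).integral_condDistrib_map hI
  have hgint : Integrable g (μ.map D) := integrable_of_mem_unit hg.aestronglyMeasurable hg0 hg1
  have hset : ∀ t, Set.Iic t ∩ Set.Ioc 0 R = Set.Ioc 0 (min t R) := by
    intro t
    ext r
    simp only [Set.mem_inter_iff, Set.mem_Iic, Set.mem_Ioc, le_min_iff]
    tauto
  -- Two finite measures on the line agreeing on all half-lines are equal; inside (0, R] a half-line
  -- is an interval (0, b] with b ≤ R.
  have heq : ρ.withDensity (fun r => ENNReal.ofReal (L r)) =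
      ρ.withDensity fun r => ENNReal.ofReal (g r) := by
    have hfin : IsFiniteMeasure (ρ.withDensity fun r => ENNReal.ofReal (L r)) :=
      isFiniteMeasure_withDensity_ofReal hLint.restrict.2
    refine Measure.ext_of_Iic _ _ fun t => ?_
    rw [withDensity_apply _ measurableSet_Iic, withDensity_apply _ measurableSet_Iic, hρ,
      Measure.restrict_restrict measurableSet_Iic, hset,
      ← ofReal_integral_eq_lintegral_ofReal hLint.restrict (Eventually.of_forall hL0),
      ← ofReal_integral_eq_lintegral_ofReal hgint.restrict (Eventually.of_forall hg0),
      setIntegral_integral_condDistrib hD hI hφ hint measurableSet_Ioc, h _ (min_le_right _ _),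
      setIntegral_map measurableSet_Ioc hg.aestronglyMeasurable hD.aemeasurable]
  rw [withDensity_eq_iff_of_sigmaFinite hLm.ennreal_ofReal.aemeasurable
    hg.ennreal_ofReal.aemeasurable] at heq
  rw [hρ] at heq
  have h2 := (ae_restrict_iff' measurableSet_Ioc).1 heq
  filter_upwards [h2] with r hr hrR
  exact (ENNReal.ofReal_eq_ofReal_iff (hL0 r) (hg0 r)).1 (hr hrR)

end ConditionalLaplace

section Exponent

variable {Nc : ℕ} (Q : Params Nc) (f : Fin Nc)

lemma volume_annulus_toReal {a b : ℝ} (ha : 0 ≤ a) (hab : a ≤ b) :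
    (volume (annulus a b)).toReal = Real.pi * (b ^ 2 - a ^ 2) := by
  have hset : annulus a b = Metric.closedBall 0 b \ Metric.closedBall 0 a := by
    ext x
    simp [annulus, and_comm]
  have h := measureReal_sdiff (μ := (volume : Measure Plane))
    (Metric.closedBall_subset_closedBall (x := (0 : Plane)) hab)
    Metric.isClosed_closedBall.measurableSet Metric.isBounded_closedBall.measure_lt_top.ne
  rw [hset, ← measureReal_def, h, measureReal_def, measureReal_def,
    volume_closedBall_toReal (ha.trans hab), volume_closedBall_toReal ha]
  ring

lemma measurableSet_annulus (a b : ℝ) : MeasurableSet (annulus a b) :=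
  (measurableSet_lt measurable_const measurable_norm).inter
    (measurableSet_le measurable_norm measurable_const)

lemma isBounded_annulus (a b : ℝ) : Bornology.IsBounded (annulus a b) :=
  (Metric.isBounded_closedBall (x := (0 : Plane)) (r := b)).subset fun x hx => by simpa using hx.2

lemma interfExponent_nonneg {κ : ℝ} (hκ : 0 ≤ κ) (b : ℝ) : 0 ≤ interfExponent Q f κ b :=
  integral_nonneg (interfExponent_integrand_nonneg Q f hκ b)

lemma antitone_interfExponent {κ : ℝ} (hκ : 0 ≤ κ) : Antitone (interfExponent Q f κ) := by
  intro a b hab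
  refine integral_mono (integrable_interfExponent Q f hκ b) (integrable_interfExponent Q f hκ a)
    fun x => ?_
  have hi : {x : Plane | b < ‖x‖}.indicator (1 : Plane → ℝ) x ≤
      {x : Plane | a < ‖x‖}.indicator 1 x :=
    Set.indicator_le_indicator_of_subset (fun y hy => hab.trans_lt hy)
      (fun _ => zero_le_one) x
  have h1 := meanAttn_le_one Q hκ x
  have h2 := Q.p_nonneg f
  exact mul_le_mul_of_nonneg_right (by nlinarith) (by linarith)

/-- The integrands differ only on the annulus, by p (1 - q) ≤ 1. -/
lemma interfExponent_sub_le {κ : ℝ} (hκ : 0 ≤ κ) {a b : ℝ} (ha : 0 ≤ a) (hab : a ≤ b) :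
    interfExponent Q f κ a - interfExponent Q f κ b ≤ Real.pi * (b ^ 2 - a ^ 2) := by
  rw [← volume_annulus_toReal ha hab, interfExponent, interfExponent,
    ← integral_sub (integrable_interfExponent Q f hκ a) (integrable_interfExponent Q f hκ b),
    ← measureReal_def, ← integral_indicator_one (measurableSet_annulus a b)]
  refine integral_mono ((integrable_interfExponent Q f hκ a).sub
    (integrable_interfExponent Q f hκ b)) ?_ fun x => ?_
  · exact (integrable_indicator_iff (measurableSet_annulus a b)).2
      (integrableOn_const (hs := ((isBounded_annulus a b).measure_lt_top).ne))
  · have h0 := meanAttn_nonneg Q κ x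
    have h1 := meanAttn_le_one Q hκ x
    have h2 := Q.p_nonneg f
    have h3 := Q.p_le_one f
    classical
    simp only [Set.indicator_apply, annulus, Set.mem_ofPred_eq, Pi.one_apply]
    by_cases ha' : a < ‖x‖
    · by_cases hb' : b < ‖x‖
      · simp [ha', hb', not_le.2 hb']
      · simp only [ha', hb', not_lt.1 hb', if_true, if_false, and_self]
        nlinarith
    · have hb' : ¬ b < ‖x‖ := fun h => ha' (hab.trans_lt h)
      simp [ha', hb']

lemma interfExponent_zero (b : ℝ) : interfExponent Q f 0 b = 0 := by
  have := isProbabilityMeasure_channelLaw Q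
  simp [interfExponent, meanAttn, attn]

/-- The absolute value extends the function to the whole line, where the bounds for κ ≥ 0 still
apply and the rationals are dense. -/
lemma continuous_interfExponent_abs (b : ℝ) : Continuous fun κ => interfExponent Q f |κ| b := by
  have hprob := isProbabilityMeasure_channelLaw Q
  have hmean : ∀ x, Continuous fun κ : ℝ => meanAttn Q |κ| x := by
    intro x
    refine continuous_of_dominated (bound := fun _ => 1)
      (fun κ => (measurable_attn_comp Q |κ| measurable_const measurable_id).aestronglyMeasurable)
      (fun κ => Eventually.of_forall fun z => ?_) (integrable_const _)
      (Eventually.of_forall fun z => ?_)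
    · rw [Real.norm_of_nonneg (attn_nonneg Q _ x _)]
      exact attn_le_one Q (abs_nonneg κ) x _
    · unfold attn
      fun_prop
  refine continuous_of_dominated
    (bound := (Metric.closedBall (0 : Plane) Q.RL).indicator fun _ => (1 : ℝ))
    (fun κ => (measurable_interfExponent_integrand Q f |κ| b).aestronglyMeasurable)
    (fun κ => Eventually.of_forall
      (norm_interfExponent_integrand_le Q f (abs_nonneg κ) b))
    (integrable_indicator_closedBall _) (Eventually.of_forall fun x => ?_)
  exact continuous_const.mul (continuous_const.sub (hmean x))

lemma exp_neg_sub_exp_neg_le {x y : ℝ} (hx : 0 ≤ x) (hxy : x ≤ y) :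
    Real.exp (-x) - Real.exp (-y) ≤ y - x := by
  have h1 : Real.exp (-y) = Real.exp (-x) * Real.exp (-(y - x)) := by
    rw [← Real.exp_add]
    ring_nf
  have h2 : 1 - (y - x) ≤ Real.exp (-(y - x)) := by
    have := Real.add_one_le_exp (-(y - x))
    linarith
  have h3 : Real.exp (-x) ≤ 1 := Real.exp_le_one_iff.2 (by linarith)
  have h4 := Real.exp_pos (-x)
  rw [h1]
  nlinarith

end Exponent

section Serving

variable {Ω : Type*} [MeasurableSpace Ω] {μ : Measure Ω} [IsProbabilityMeasure μ] {Nc : ℕ}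
  {Q : Params Nc} {T : PicoTier Ω Nc}

/-- Laplace transform of the background power on the event that the serving distance lies in
`(a, b]`. -/
lemma IsPicoTier.setIntegral_exp_background (hT : IsPicoTier μ Q T) (f : Fin Nc) {κ a b : ℝ}
    (hκ : 0 ≤ κ) (ha : 0 ≤ a) (hab : a ≤ b) :
    ∫ ω in T.servingDist f ⁻¹' Set.Ioc a b, Real.exp (-(κ * T.background Q f b ω)) ∂μ =
      (Real.exp (-(Q.lam * (Q.p f * (Real.pi * a ^ 2)))) -
        Real.exp (-(Q.lam * (Q.p f * (Real.pi * b ^ 2))))) *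
        Real.exp (-(Q.lam * interfExponent Q f κ b)) := by
  classical
  have hmY : AEStronglyMeasurable (fun ω => Real.exp (-(κ * T.background Q f b ω))) μ :=
    (Real.measurable_exp.comp_aemeasurable
      ((hT.aemeasurable_background f b).const_mul κ).neg).aestronglyMeasurable
  have hYint : Integrable (fun ω => Real.exp (-(κ * T.background Q f b ω))) μ :=
    integrable_of_mem_unit hmY (fun ω => (Real.exp_pos _).le) fun ω =>
      Real.exp_le_one_iff.2 (neg_nonpos.2 (mul_nonneg hκ (background_nonneg b)))
  have hnone : ∀ t, t ≤ b → ∫ ω in {ω | T.NoneWithin f t ω},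
      Real.exp (-(κ * T.background Q f b ω)) ∂μ =
      ∫ ω, ∏ᶠ n, thinFactor Q κ t b (T.loc n ω) (T.mark f n ω) ∂μ := by
    intro t ht
    rw [← integral_indicator (hT.measurableSet_noneWithin f t)]
    refine integral_congr_ae ?_
    filter_upwards [hT.ae_isRegular] with ω hω
    rw [hω.finprod_thinFactor, Set.indicator_apply]
    rfl
  have hsub : {ω | T.NoneWithin f b ω} ⊆ {ω | T.NoneWithin f a ω} :=
    fun ω hω n hn => hab.trans_lt (hω n hn)
  have hset : T.servingDist f ⁻¹' Set.Ioc a b =ᵐ[μ]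
      ({ω | T.NoneWithin f a ω} \ {ω | T.NoneWithin f b ω} : Set Ω) := by
    filter_upwards [hT.ae_isRegular] with ω hω
    exact propext (hω.servingDist_mem_Ioc_iff ha)
  -- The same background level b is used with both void radii a and b, so the factor exp(-λ₂ E(κ,
  -- b)) is common to the two terms.
  rw [setIntegral_congr_set hset, setIntegral_sdiff (hT.measurableSet_noneWithin f b)
    hYint.integrableOn hsub, hnone a hab, hnone b le_rfl,
    hT.integral_finprod_thinFactor f hκ ha hab,
    hT.integral_finprod_thinFactor f hκ (ha.trans hab) le_rfl]
  ring

lemma IsPicoTier.measureReal_servingDist (hT : IsPicoTier μ Q T) (f : Fin Nc) {a b : ℝ}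
    (ha : 0 ≤ a) (hab : a ≤ b) :
    μ.real (T.servingDist f ⁻¹' Set.Ioc a b) =
      Real.exp (-(Q.lam * (Q.p f * (Real.pi * a ^ 2)))) -
        Real.exp (-(Q.lam * (Q.p f * (Real.pi * b ^ 2)))) := by
  have h := hT.setIntegral_exp_background f le_rfl ha hab
  simpa [interfExponent_zero] using h

/-- The probability that the distance lies outside (0, k] is exp(-λ₂ p π k²), which tends to 0
because p > 0. This also discards the default value 0 when no BS stores f. -/
lemma IsPicoTier.ae_servingDist_pos (hT : IsPicoTier μ Q T) (f : Fin Nc) (hf : 0 < Q.p f) :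
    ∀ᵐ r ∂(μ.map (T.servingDist f)), 0 < r := by
  have hD := hT.measurable_servingDist f
  rw [ae_map_iff hD.aemeasurable measurableSet_Ioi]
  have hbound : ∀ k : ℕ, μ.real {ω | ¬ 0 < T.servingDist f ω} ≤
      Real.exp (-(Q.lam * (Q.p f * (Real.pi * (k : ℝ) ^ 2)))) := by
    intro k
    have h1 := hT.measureReal_servingDist f le_rfl (Nat.cast_nonneg (α := ℝ) k)
    have h2 : μ.real {ω | ¬ 0 < T.servingDist f ω} ≤
        μ.real (T.servingDist f ⁻¹' Set.Ioc 0 (k : ℝ))ᶜ :=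
      measureReal_mono fun ω hω hmem => hω hmem.1
    rw [probReal_compl_eq_one_sub (hD measurableSet_Ioc), h1] at h2
    simpa using h2
  have hlim : Tendsto (fun k : ℕ => Real.exp (-(Q.lam * (Q.p f * (Real.pi * (k : ℝ) ^ 2))))) atTop
      (𝓝 0) := by
    refine Real.tendsto_exp_neg_atTop_nhds_zero.comp ?_
    refine Tendsto.const_mul_atTop Q.lam_pos (Tendsto.const_mul_atTop hf
      (Tendsto.const_mul_atTop Real.pi_pos ?_))
    exact (tendsto_pow_atTop two_ne_zero).comp tendsto_natCast_atTop_atTop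
  have h0 : μ.real {ω | ¬ 0 < T.servingDist f ω} = 0 :=
    le_antisymm (ge_of_tendsto' hlim hbound) measureReal_nonneg
  exact (measureReal_eq_zero_iff).1 h0

lemma IsPicoTier.integrable_exp_interference (hT : IsPicoTier μ Q T) (f : Fin Nc) {κ : ℝ}
    (hκ : 0 ≤ κ) : Integrable (fun ω => Real.exp (-(κ * T.interference Q f ω))) μ := by
  refine (integrable_const (1 : ℝ)).mono' ?_ ?_
  · exact (Real.measurable_exp.comp_aemeasurable
      ((hT.aemeasurable_interference f).const_mul κ).neg).aestronglyMeasurable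
  · filter_upwards [hT.ae_isRegular] with ω hω
    rw [Real.norm_of_nonneg (Real.exp_pos _).le]
    exact Real.exp_le_one_iff.2 (neg_nonpos.2 (mul_nonneg hκ hω.interference_nonneg))

/-- Both exponentials lie in [0, 1] and coincide unless the annulus contains two BSs. -/
lemma IsPicoTier.abs_setIntegral_exp_interference_sub_le (hT : IsPicoTier μ Q T) (f : Fin Nc)
    {κ a b : ℝ} (hκ : 0 ≤ κ) (ha : 0 ≤ a) (hab : a ≤ b) :
    |∫ ω in T.servingDist f ⁻¹' Set.Ioc a b, Real.exp (-(κ * T.interference Q f ω)) ∂μ -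
      ∫ ω in T.servingDist f ⁻¹' Set.Ioc a b, Real.exp (-(κ * T.background Q f b ω)) ∂μ| ≤
      (Q.lam * (Real.pi * (b ^ 2 - a ^ 2))) ^ 2 := by
  have hmY : AEStronglyMeasurable (fun ω => Real.exp (-(κ * T.background Q f b ω))) μ :=
    (Real.measurable_exp.comp_aemeasurable
      ((hT.aemeasurable_background f b).const_mul κ).neg).aestronglyMeasurable
  have hYint : Integrable (fun ω => Real.exp (-(κ * T.background Q f b ω))) μ :=
    integrable_of_mem_unit hmY (fun ω => (Real.exp_pos _).le) fun ω =>
      Real.exp_le_one_iff.2 (neg_nonpos.2 (mul_nonneg hκ (background_nonneg b)))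
  have hXint := hT.integrable_exp_interference f hκ
  have hE : MeasurableSet (T.servingDist f ⁻¹' Set.Ioc a b) :=
    hT.measurable_servingDist f measurableSet_Ioc
  set B : Set Ω := {ω | 2 ≤ {n | T.loc n ω ∈ annulus a b}.encard} with hB
  have hBm : MeasurableSet B :=
    hT.hppp.measurable_count (measurableSet_annulus a b) (MeasurableSet.of_discrete (s := Set.Ici 2))
  have hBle : μ.real B ≤ (Q.lam * (Real.pi * (b ^ 2 - a ^ 2))) ^ 2 := by
    rw [← volume_annulus_toReal ha hab]
    exact hT.hppp.measureReal_two_le_count Q.lam_pos.le (measurableSet_annulus a b)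
      (isBounded_annulus a b)
  rw [← integral_sub hXint.integrableOn hYint.integrableOn, ← integral_indicator hE]
  rw [← Real.norm_eq_abs]
  refine (norm_integral_le_integral_norm _).trans (le_trans ?_ hBle)
  rw [← integral_indicator_one hBm]
  refine integral_mono_ae ?_ ?_ ?_
  · exact ((hXint.sub hYint).indicator hE).norm
  · exact (integrable_indicator_iff hBm).2 (integrableOn_const (hs := measure_ne_top _ _))
  · filter_upwards [hT.ae_isRegular] with ω hω
    by_cases hmem : ω ∈ T.servingDist f ⁻¹' Set.Ioc a b
    · rw [Set.indicator_of_mem hmem]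
      obtain ⟨hna, hnb⟩ := (hω.servingDist_mem_Ioc_iff ha).1 hmem
      by_cases hωB : ω ∈ B
      · rw [Set.indicator_of_mem hωB]
        have h1 : Real.exp (-(κ * T.interference Q f ω)) ≤ 1 :=
          Real.exp_le_one_iff.2 (neg_nonpos.2 (mul_nonneg hκ hω.interference_nonneg))
        have h2 : Real.exp (-(κ * T.background Q f b ω)) ≤ 1 :=
          Real.exp_le_one_iff.2 (neg_nonpos.2 (mul_nonneg hκ (background_nonneg b)))
        have h3 := Real.exp_pos (-(κ * T.interference Q f ω))
        have h4 := Real.exp_pos (-(κ * T.background Q f b ω))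
        rw [Real.norm_eq_abs, abs_le, Pi.one_apply]
        constructor <;> linarith
      · rw [Set.indicator_of_notMem hωB, hω.interference_eq_background hna hnb hωB]
        simp
    · rw [Set.indicator_of_notMem hmem, norm_zero]
      exact Set.indicator_nonneg (fun _ _ => zero_le_one) _

/-- The law of the interference given the serving distance `r`, in terms of its Laplace transform
on the events that the serving distance is at most `b`. -/
lemma IsPicoTier.setIntegral_exp_interference (hT : IsPicoTier μ Q T) (f : Fin Nc) {κ b : ℝ}
    (hκ : 0 ≤ κ) (hb : b ≤ Q.RL) :
    ∫ ω in T.servingDist f ⁻¹' Set.Ioc 0 b, Real.exp (-(κ * T.interference Q f ω)) ∂μ =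
      ∫ ω in T.servingDist f ⁻¹' Set.Ioc 0 b,
        Real.exp (-(Q.lam * interfExponent Q f κ (T.servingDist f ω))) ∂μ := by
  set R := Q.RL with hR
  have hRpos : 0 < R := Q.RL_pos
  have hlam := Q.lam_pos
  set g : ℝ → ℝ := fun r => Real.exp (-(Q.lam * interfExponent Q f κ r)) with hg
  have hgmono : Monotone g := fun r r' hrr => by
    have := antitone_interfExponent Q f hκ hrr
    simp only [hg]
    gcongr
  have hgm : Measurable g := hgmono.measurable
  have hD := hT.measurable_servingDist f
  have hXint := hT.integrable_exp_interference f hκ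
  have hgint : Integrable (fun ω => g (T.servingDist f ω)) μ :=
    integrable_of_mem_unit (hgm.comp hD).aestronglyMeasurable (fun ω => (Real.exp_pos _).le)
      fun ω => Real.exp_le_one_iff.2 (neg_nonpos.2 (mul_nonneg hlam.le
        (interfExponent_nonneg Q f hκ _)))
  set H : Ω → ℝ := fun ω => Real.exp (-(κ * T.interference Q f ω)) - g (T.servingDist f ω) with hH
  have hHint : Integrable H μ := hXint.sub hgint
  -- With A = λ₂ π (b² - a²), exchanging interference for background costs A². Replacing g(D) by
  -- g(b) costs at most P(a < D ≤ b) (g(b) - g(a)) ≤ A². Since A ≤ 2 λ₂ π R (b - a), the total 2A²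
  -- gives the factor 8.
  have hkey : ∀ a b, 0 ≤ a → a ≤ b → b ≤ R →
      |∫ ω in T.servingDist f ⁻¹' Set.Ioc a b, H ω ∂μ| ≤
        8 * (Q.lam * Real.pi * R) ^ 2 * (b - a) ^ 2 := by
    intro a b ha hab hbR
    have hE : MeasurableSet (T.servingDist f ⁻¹' Set.Ioc a b) := hD measurableSet_Ioc
    have h1 := hT.abs_setIntegral_exp_interference_sub_le f hκ ha hab
    have hm := hT.measureReal_servingDist f ha hab
    have hback := hT.setIntegral_exp_background f hκ ha hab
    rw [← hm] at hback
    have hgdiff : g b - g a ≤ Q.lam * (Real.pi * (b ^ 2 - a ^ 2)) := by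
      have h2 := exp_neg_sub_exp_neg_le
        (mul_nonneg hlam.le (interfExponent_nonneg Q f hκ b))
        (mul_le_mul_of_nonneg_left (antitone_interfExponent Q f hκ hab) hlam.le)
      have h3 := mul_le_mul_of_nonneg_left (interfExponent_sub_le Q f hκ ha hab) hlam.le
      simp only [hg]
      linarith
    have hPle : μ.real (T.servingDist f ⁻¹' Set.Ioc a b) ≤
        Q.lam * (Real.pi * (b ^ 2 - a ^ 2)) := by
      have hsq : a ^ 2 ≤ b ^ 2 := by gcongr
      have hp0 := Q.p_nonneg f
      have hp1 := Q.p_le_one f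
      have hpi := Real.pi_pos
      have h2 := exp_neg_sub_exp_neg_le (x := Q.lam * (Q.p f * (Real.pi * a ^ 2)))
        (y := Q.lam * (Q.p f * (Real.pi * b ^ 2))) (by positivity) (by gcongr)
      rw [hm]
      refine h2.trans ?_
      have h5 : Q.p f * (Real.pi * (b ^ 2 - a ^ 2)) ≤ Real.pi * (b ^ 2 - a ^ 2) :=
        mul_le_of_le_one_left (mul_nonneg hpi.le (by linarith)) hp1
      have h6 := mul_le_mul_of_nonneg_left h5 hlam.le
      linarith
    have hglow : μ.real (T.servingDist f ⁻¹' Set.Ioc a b) * g a ≤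
        ∫ ω in T.servingDist f ⁻¹' Set.Ioc a b, g (T.servingDist f ω) ∂μ := by
      have := setIntegral_mono_on (μ := μ) (f := fun _ => g a)
        (integrableOn_const (hs := measure_ne_top _ _)) hgint.integrableOn hE
        fun ω hω => hgmono hω.1.le
      simpa [setIntegral_const] using this
    have hghigh : ∫ ω in T.servingDist f ⁻¹' Set.Ioc a b, g (T.servingDist f ω) ∂μ ≤
        μ.real (T.servingDist f ⁻¹' Set.Ioc a b) * g b := by
      have := setIntegral_mono_on (μ := μ) (g := fun _ => g b) hgint.integrableOn
        (integrableOn_const (hs := measure_ne_top _ _)) hE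
        fun ω hω => hgmono hω.2
      simpa [setIntegral_const] using this
    rw [hH, integral_sub hXint.integrableOn hgint.integrableOn]
    set P := μ.real (T.servingDist f ⁻¹' Set.Ioc a b)
    have hP0 : 0 ≤ P := measureReal_nonneg
    set A := Q.lam * (Real.pi * (b ^ 2 - a ^ 2)) with hA
    have hA0 : 0 ≤ A := hP0.trans hPle
    rw [hback] at h1
    have hPg : P * (g b - g a) ≤ A * A :=
      mul_le_mul hPle hgdiff (sub_nonneg.2 (hgmono hab)) hA0
    have hAle : A ≤ 2 * (Q.lam * Real.pi * R) * (b - a) := by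
      have : b ^ 2 - a ^ 2 ≤ 2 * R * (b - a) := by nlinarith
      calc A = Q.lam * Real.pi * (b ^ 2 - a ^ 2) := by rw [hA]; ring
        _ ≤ Q.lam * Real.pi * (2 * R * (b - a)) := by
          have := Real.pi_pos
          gcongr
        _ = _ := by ring
    have hAsq : A ^ 2 ≤ (2 * (Q.lam * Real.pi * R) * (b - a)) ^ 2 := by gcongr
    have hfin : |∫ ω in T.servingDist f ⁻¹' Set.Ioc a b,
        Real.exp (-(κ * T.interference Q f ω)) ∂μ -
        ∫ ω in T.servingDist f ⁻¹' Set.Ioc a b, g (T.servingDist f ω) ∂μ| ≤ 2 * A ^ 2 := by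
      rw [abs_le] at h1 ⊢
      simp only [hg] at h1 hPg hglow hghigh ⊢
      constructor <;> nlinarith
    refine hfin.trans ?_
    nlinarith
  -- The increment bound holds only inside [0, R], whereas `eq_of_abs_sub_le_sq` wants it on the
  -- whole line; clamping is 1-Lipschitz and preserves it.
  set c : ℝ → ℝ := fun t => max 0 (min t R) with hc
  have hc0 : ∀ t, 0 ≤ c t := fun t => le_max_left _ _
  have hcR : ∀ t, c t ≤ R := fun t => max_le hRpos.le (min_le_right _ _)
  have hcmono : Monotone c := fun s t hst => max_le_max le_rfl (min_le_min hst le_rfl)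
  have hclip : ∀ s t, s ≤ t → c t - c s ≤ t - s := by
    intro s t hst
    simp only [hc]
    rcases max_cases 0 (min t R) with h1 | h1 <;> rcases max_cases 0 (min s R) with h2 | h2 <;>
      rcases min_cases t R with h3 | h3 <;> rcases min_cases s R with h4 | h4 <;> linarith
  set Θ : ℝ → ℝ := fun t => ∫ ω in T.servingDist f ⁻¹' Set.Ioc 0 (c t), H ω ∂μ with hΘ
  have hincr : ∀ s t, s ≤ t → |Θ t - Θ s| ≤ 8 * (Q.lam * Real.pi * R) ^ 2 * (t - s) ^ 2 := by
    intro s t hst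
    have hsplit : Θ t = Θ s + ∫ ω in T.servingDist f ⁻¹' Set.Ioc (c s) (c t), H ω ∂μ := by
      simp only [hΘ]
      rw [← setIntegral_union ?_ (hD measurableSet_Ioc) hHint.integrableOn hHint.integrableOn,
        ← Set.preimage_union, Set.Ioc_union_Ioc_eq_Ioc (hc0 s) (hcmono hst)]
      exact Disjoint.preimage _ (Set.Ioc_disjoint_Ioc_of_le le_rfl)
    rw [hsplit, add_sub_cancel_left]
    refine (hkey _ _ (hc0 s) (hcmono hst) (hcR t)).trans ?_
    have := hclip s t hst
    have h0 : 0 ≤ c t - c s := sub_nonneg.2 (hcmono hst)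
    gcongr
  have hconst := eq_of_abs_sub_le_sq (g := Θ) (C := 8 * (Q.lam * Real.pi * R) ^ 2)
    (fun s t => by
      rcases le_total s t with hst | hst
      · rw [abs_sub_comm, show (s - t) ^ 2 = (t - s) ^ 2 by ring]
        exact hincr s t hst
      · exact hincr t s hst) b 0
  have hzero : Θ 0 = 0 := by
    have : c 0 = 0 := by simp [hc, hRpos.le]
    simp [hΘ, this]
  rw [hzero] at hconst
  have hcb : Set.Ioc 0 (c b) = Set.Ioc 0 b := by
    ext r
    simp only [hc, min_eq_left hb, Set.mem_Ioc, le_max_iff]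
    constructor
    · rintro ⟨h1, h2 | h2⟩
      · linarith
      · exact ⟨h1, h2⟩
    · exact fun h => ⟨h.1, Or.inr h.2⟩
  simp only [hΘ, hcb, hH] at hconst
  rw [integral_sub hXint.integrableOn hgint.integrableOn] at hconst
  linarith

/-- Laplace transform of the interference given the serving distance. -/
lemma IsPicoTier.ae_laplace_eq (hT : IsPicoTier μ Q T) (f : Fin Nc) (hf : 0 < Q.p f) :
    ∀ᵐ r ∂(μ.map (T.servingDist f)), r ≤ Q.RL → ∀ κ : ℝ, 0 ≤ κ →
      ∫ y, Real.exp (-(κ * y)) ∂(condDistrib (T.interference Q f) (T.servingDist f) μ r) =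
        Real.exp (-(Q.lam * interfExponent Q f κ r)) := by
  have hD := hT.measurable_servingDist f
  have hI := hT.aemeasurable_interference f
  have hprob : IsProbabilityMeasure (μ.map (T.servingDist f)) :=
    Measure.isProbabilityMeasure_map hD.aemeasurable
  -- The exceptional null set depends on κ; countably many values share one, and continuity in κ
  -- does the rest.
  have hrat : ∀ᵐ r ∂(μ.map (T.servingDist f)), ∀ q : ℚ, r ∈ Set.Ioc 0 Q.RL →
      ∫ y, Real.exp (-(|(q : ℝ)| * y)) ∂(condDistrib (T.interference Q f) (T.servingDist f) μ r) =
        Real.exp (-(Q.lam * interfExponent Q f |(q : ℝ)| r)) := by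
    refine ae_all_iff.2 fun q => ?_
    have hκ : 0 ≤ |(q : ℝ)| := abs_nonneg _
    refine ae_integral_condDistrib_eq hD hI (by fun_prop) (fun y => (Real.exp_pos _).le)
      (hT.integrable_exp_interference f hκ) ?_ (fun r => (Real.exp_pos _).le) (fun r => ?_)
      fun b hb => hT.setIntegral_exp_interference f hκ hb
    · have hm : Measurable (interfExponent Q f |(q : ℝ)|) :=
        (antitone_interfExponent Q f hκ).measurable
      fun_prop
    · exact Real.exp_le_one_iff.2 (neg_nonpos.2 (mul_nonneg Q.lam_pos.le
        (interfExponent_nonneg Q f hκ _)))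
  -- Almost every conditional law is carried by [0, ∞), which gives the bound 1 needed for
  -- continuity in κ.
  have hnn : ∀ᵐ r ∂(μ.map (T.servingDist f)),
      ∀ᵐ y ∂(condDistrib (T.interference Q f) (T.servingDist f) μ r), 0 ≤ y := by
    have h1 : ∀ᵐ z ∂((μ.map (T.servingDist f)) ⊗ₘ
        condDistrib (T.interference Q f) (T.servingDist f) μ), 0 ≤ z.2 := by
      rw [compProd_map_condDistrib hI, ae_map_iff (hD.aemeasurable.prodMk hI)
        (measurableSet_le measurable_const measurable_snd)]
      filter_upwards [hT.ae_isRegular] with ω hω using hω.interference_nonneg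
    exact Measure.ae_ae_of_ae_compProd h1
  filter_upwards [hrat, hnn, hT.ae_servingDist_pos f hf] with r hr hy hr0 hrR κ hκ
  have hcL : Continuous fun κ : ℝ => ∫ y, Real.exp (-(|κ| * y))
      ∂(condDistrib (T.interference Q f) (T.servingDist f) μ r) := by
    refine continuous_of_dominated (bound := fun _ => 1)
      (fun κ => Measurable.aestronglyMeasurable (by fun_prop)) (fun κ => ?_) (integrable_const _)
      (Eventually.of_forall fun y => by fun_prop)
    filter_upwards [hy] with y hy
    rw [Real.norm_of_nonneg (Real.exp_pos _).le]
    exact Real.exp_le_one_iff.2 (neg_nonpos.2 (mul_nonneg (abs_nonneg _) hy))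
  have hcR : Continuous fun κ : ℝ => Real.exp (-(Q.lam * interfExponent Q f |κ| r)) := by
    have := continuous_interfExponent_abs Q f r
    fun_prop
  have hext := Continuous.ext_on (Rat.denseRange_cast (𝕜 := ℝ)) hcL hcR (by
    rintro _ ⟨q, rfl⟩
    exact hr q ⟨hr0, hrR⟩)
  have := congrFun hext κ
  simpa only [abs_of_nonneg hκ] using this

end Serving

end ConditionalLaw

/-! ### Evaluation of the exponent: Gamma fading, uniform angle, polar coordinates. -/

section ClosedForm

/-- Laplace transform of the Gamma law with mean one. -/
lemma integral_exp_neg_mul_abs_gammaMeasure {N : ℕ} (hN : 0 < N) {t : ℝ} (ht : 0 ≤ t) :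
    ∫ h, Real.exp (-(t * |h|)) ∂(gammaMeasure (N : ℝ) (N : ℝ)) = ((1 + t / N) ^ N)⁻¹ := by
  have hN' : (0 : ℝ) < N := by exact_mod_cast hN
  have hG := Real.Gamma_pos_of_pos hN'
  have hmeas : Measurable (gammaPDF (N : ℝ) N) := (measurable_gammaPDFReal _ _).ennreal_ofReal
  rw [gammaMeasure, integral_withDensity_eq_integral_toReal_smul hmeas
    (Eventually.of_forall fun _ => ENNReal.ofReal_lt_top)]
  have h1 : ∀ h : ℝ, (gammaPDF (N : ℝ) N h).toReal • Real.exp (-(t * |h|)) =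
      (Set.Ici (0 : ℝ)).indicator (fun h => (N : ℝ) ^ (N : ℝ) / Real.Gamma N *
        (h ^ ((N : ℝ) - 1) * Real.exp (-((N + t) * h)))) h := by
    intro h
    rw [gammaPDF, ENNReal.toReal_ofReal (gammaPDFReal_nonneg hN' hN' h), gammaPDFReal, smul_eq_mul]
    by_cases hh : 0 ≤ h
    · rw [if_pos hh, Set.indicator_of_mem (Set.mem_Ici.2 hh), abs_of_nonneg hh, add_mul, neg_add,
        Real.exp_add]
      ring
    · rw [if_neg hh, Set.indicator_of_notMem (by simpa using hh), zero_mul]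
  simp_rw [h1]
  rw [integral_indicator measurableSet_Ici, integral_Ici_eq_integral_Ioi, integral_const_mul,
    Real.integral_rpow_mul_exp_neg_mul_Ioi hN' (by positivity), Real.rpow_natCast,
    Real.rpow_natCast, show (1 : ℝ) + t / N = (N + t) / N by field_simp, div_pow, div_pow, one_pow]
  field_simp

variable {Nc : ℕ} (Q : Params Nc)

lemma integral_cond_uniform (φ : ℝ → ℝ) :
    ∫ w, φ w ∂(cond volume (Set.Icc (-(Q.d / Q.wl)) (Q.d / Q.wl))) =
      1 / 2 * ∫ y in (-1 : ℝ)..1, φ (y * Q.d / Q.wl) := by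
  have hd : 0 < Q.d / Q.wl := div_pos Q.d_pos Q.wl_pos
  have h2 : ∫ y in (-1 : ℝ)..1, φ (y * Q.d / Q.wl) =
      (Q.d / Q.wl)⁻¹ * ∫ w in (-(Q.d / Q.wl))..(Q.d / Q.wl), φ w := by
    have := intervalIntegral.integral_comp_mul_right (a := -1) (b := 1) φ hd.ne'
    simpa only [neg_mul, one_mul, smul_eq_mul, mul_div_assoc] using this
  rw [ProbabilityTheory.cond, integral_smul_measure, Real.volume_Icc, integral_Icc_eq_integral_Ioc,
    h2, intervalIntegral.integral_of_le (by linarith), ENNReal.toReal_inv,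
    ENNReal.toReal_ofReal (by linarith), smul_eq_mul]
  field_simp
  ring

/-- The normalisation of κ cancels transmit power, intercept and array size. The Gamma law then
contributes the division by its shape that appears in `argX`. -/
lemma meanAttn_eq {s τ : ℝ} (hs : 0 ≤ s) (hτ : 0 ≤ τ) {x : Plane} (hxR : ‖x‖ ≤ Q.RL) :
    meanAttn Q (s * τ / (Q.P * Q.C * Q.Nant)) x =
      1 / 2 * ∫ y in (-1 : ℝ)..1,
        ((1 + argX Q (y * Q.d / Q.wl) s τ * ‖x‖ ^ (-Q.α)) ^ Q.Nnak)⁻¹ := by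
  have hN : (0 : ℝ) < Q.Nnak := by exact_mod_cast Q.Nnak_pos
  have hA : (0 : ℝ) < Q.Nant := by exact_mod_cast Q.Nant_pos
  have hP := Q.P_pos
  have hC := Q.C_pos
  have hκ : 0 ≤ s * τ / (Q.P * Q.C * Q.Nant) := by positivity
  have hprob := isProbabilityMeasure_channelLaw Q
  have hg := isProbabilityMeasure_gammaMeasure hN hN
  have hint : Integrable (attn Q (s * τ / (Q.P * Q.C * Q.Nant)) x) (channelLaw Q) :=
    integrable_of_mem_unit
      (measurable_attn_comp Q _ measurable_const measurable_id).aestronglyMeasurable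
      (attn_nonneg Q _ x) (attn_le_one Q hκ x)
  rw [meanAttn, channelLaw, integral_prod_symm _ hint, ← integral_cond_uniform Q fun w =>
    ((1 + argX Q w s τ * ‖x‖ ^ (-Q.α)) ^ Q.Nnak)⁻¹]
  refine integral_congr_ae (Eventually.of_forall fun w => ?_)
  have hG := arrayGain_nonneg Q.Nant w
  have ht : 0 ≤ s * τ * arrayGain Q.Nant w * ‖x‖ ^ (-Q.α) := by positivity
  have h := integral_exp_neg_mul_abs_gammaMeasure Q.Nnak_pos ht
  have hattn : ∀ h : ℝ, attn Q (s * τ / (Q.P * Q.C * Q.Nant)) x (h, w) =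
      Real.exp (-(s * τ * arrayGain Q.Nant w * ‖x‖ ^ (-Q.α) * |h|)) := by
    intro h
    rw [attn, rxPower, pathLoss, if_pos (by linarith)]
    congr 2
    field_simp
  simp only [hattn, h, argX]
  congr 3
  ring

/-- `∫₀ᵗ 2 v (1 - q(v)) dv`, with `q(v)` the mean Laplace factor of an interferer at distance
`v`. -/
lemma integral_one_sub_angleAvg {s τ : ℝ} (hs : 0 ≤ s) (hτ : 0 ≤ τ) {t : ℝ} (ht : 0 ≤ t) :
    IntervalIntegrable (fun v => 2 * v * (1 - 1 / 2 * ∫ y in (-1 : ℝ)..1,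
        ((1 + argX Q (y * Q.d / Q.wl) s τ * v ^ (-Q.α)) ^ Q.Nnak)⁻¹)) volume 0 t ∧
    ∫ v in (0 : ℝ)..t, 2 * v * (1 - 1 / 2 * ∫ y in (-1 : ℝ)..1,
        ((1 + argX Q (y * Q.d / Q.wl) s τ * v ^ (-Q.α)) ^ Q.Nnak)⁻¹) =
      t ^ 2 - 1 / 2 * ∫ y in (-1 : ℝ)..1, radialInt Q.α Q.Nnak (argX Q (y * Q.d / Q.wl) s τ) t := by
  have hX : Continuous fun y : ℝ => argX Q (y * Q.d / Q.wl) s τ := by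
    have := continuous_arrayGain Q.Nant_pos
    unfold argX
    fun_prop
  set F : ℝ → ℝ → ℝ := fun v y =>
    2 * v * ((1 + argX Q (y * Q.d / Q.wl) s τ * v ^ (-Q.α)) ^ Q.Nnak)⁻¹ with hF
  have hmeas : Measurable (Function.uncurry F) := by
    have hXm : Measurable fun z : ℝ × ℝ => argX Q (z.2 * Q.d / Q.wl) s τ :=
      hX.measurable.comp measurable_snd
    simp only [hF, Function.uncurry_def]
    fun_prop
  have hint : Integrable (Function.uncurry F)
      ((volume.restrict (Set.Ioc 0 t)).prod (volume.restrict (Set.Ioc (-1 : ℝ) 1))) := by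
    refine (integrable_const (2 * t)).mono' hmeas.aestronglyMeasurable ?_
    rw [Measure.prod_restrict]
    refine (ae_restrict_iff' (measurableSet_Ioc.prod measurableSet_Ioc)).2
      (Eventually.of_forall fun z hz => ?_)
    have hz1 := hz.1
    have h := radial_factor_mem (α := Q.α) Q.Nnak (argX_nonneg Q (z.2 * Q.d / Q.wl) hs hτ) hz1.1.le
    simp only [hF, Function.uncurry]
    rw [Real.norm_of_nonneg (mul_nonneg (by linarith [hz1.1]) h.1)]
    exact (mul_le_of_le_one_right (by linarith [hz1.1]) h.2).trans (by linarith [hz1.2])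
  have hrw : ∀ v, 2 * v * (1 - 1 / 2 * ∫ y in (-1 : ℝ)..1,
      ((1 + argX Q (y * Q.d / Q.wl) s τ * v ^ (-Q.α)) ^ Q.Nnak)⁻¹) =
      2 * v - 1 / 2 * ∫ y in (-1 : ℝ)..1, F v y := by
    intro v
    simp only [hF, intervalIntegral.integral_const_mul]
    ring
  have hI1 : IntervalIntegrable (fun v : ℝ => 2 * v) volume 0 t :=
    Continuous.intervalIntegrable (by fun_prop) _ _
  have hI2 : IntervalIntegrable (fun v => 1 / 2 * ∫ y in (-1 : ℝ)..1, F v y) volume 0 t := by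
    rw [intervalIntegrable_iff_integrableOn_Ioc_of_le ht]
    simp only [intervalIntegral.integral_of_le (show (-1 : ℝ) ≤ 1 by norm_num)]
    exact hint.integral_prod_left.const_mul _
  simp only [hrw]
  refine ⟨hI1.sub hI2, ?_⟩
  rw [intervalIntegral.integral_sub hI1 hI2, intervalIntegral.integral_const_mul,
    intervalIntegral.integral_const_mul, integral_id]
  have hswap : ∫ v in (0 : ℝ)..t, ∫ y in (-1 : ℝ)..1, F v y =
      ∫ y in (-1 : ℝ)..1, radialInt Q.α Q.Nnak (argX Q (y * Q.d / Q.wl) s τ) t := by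
    simp only [radialInt, intervalIntegral.integral_of_le ht,
      intervalIntegral.integral_of_le (show (-1 : ℝ) ≤ 1 by norm_num)]
    exact integral_integral_swap hint
  rw [hswap]
  ring

/-- The exponent of the conditional Laplace transform, in polar coordinates. -/
lemma interfExponent_eq (f : Fin Nc) {s τ : ℝ} (hs : 0 ≤ s) (hτ : 0 ≤ τ) {b : ℝ} (hb : 0 < b)
    (hbR : b ≤ Q.RL) :
    interfExponent Q f (s * τ / (Q.P * Q.C * Q.Nant)) b =
      Real.pi * (Q.RL ^ 2 - Q.p f * b ^ 2) + Real.pi / 2 * ∫ y in (-1 : ℝ)..1,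
        (Q.p f * radialInt Q.α Q.Nnak (argX Q (y * Q.d / Q.wl) s τ) b -
          radialInt Q.α Q.Nnak (argX Q (y * Q.d / Q.wl) s τ) Q.RL) := by
  classical
  have hX : Continuous fun y : ℝ => argX Q (y * Q.d / Q.wl) s τ := by
    have := continuous_arrayGain Q.Nant_pos
    unfold argX
    fun_prop
  have hJ : ∀ {t : ℝ}, 0 ≤ t → IntervalIntegrable
      (fun y => radialInt Q.α Q.Nnak (argX Q (y * Q.d / Q.wl) s τ) t) volume (-1) 1 := fun ht =>
    (continuous_radialInt_comp Q.Nnak hX (fun y => argX_nonneg Q _ hs hτ) ht).intervalIntegrable _ _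
  set q : ℝ → ℝ := fun v => 1 / 2 * ∫ y in (-1 : ℝ)..1,
    ((1 + argX Q (y * Q.d / Q.wl) s τ * v ^ (-Q.α)) ^ Q.Nnak)⁻¹ with hq
  obtain ⟨hKRi, hKR⟩ := integral_one_sub_angleAvg Q hs hτ Q.RL_pos.le
  obtain ⟨hKbi, hKb⟩ := integral_one_sub_angleAvg Q hs hτ hb.le
  set G : ℝ → ℝ := fun v => ((1 - Q.p f) + Q.p f * if b < v then 1 else 0) *
    if v ≤ Q.RL then 1 - q v else 0 with hG
  have h1 : interfExponent Q f (s * τ / (Q.P * Q.C * Q.Nant)) b = ∫ x : Plane, G ‖x‖ := by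
    rw [interfExponent]
    congr 1
    ext x
    simp only [hG, Set.indicator_apply, Set.mem_ofPred_eq, Pi.one_apply]
    congr 1
    by_cases hx : ‖x‖ ≤ Q.RL
    · rw [if_pos hx, meanAttn_eq Q hs hτ hx]
    · rw [if_neg hx, meanAttn_of_lt Q _ (not_le.1 hx), sub_self]
  have hball : (volume : Measure Plane).real (Metric.ball 0 1) = Real.pi := by
    rw [measureReal_def, EuclideanSpace.volume_ball_fin_two]
    simp [Real.pi_pos.le]
  -- The weight is 1 minus p on v ≤ b; since b ≤ R_L, the path loss cutoff does not truncate the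
  -- subtracted part.
  have h2 : ∫ v in Set.Ioi (0 : ℝ), 2 * v * G v =
      (∫ v in (0 : ℝ)..Q.RL, 2 * v * (1 - q v)) - Q.p f * ∫ v in (0 : ℝ)..b, 2 * v * (1 - q v) := by
    have hsplit : ∀ v ∈ Set.Ioi (0 : ℝ), 2 * v * G v =
        (Set.Ioc 0 Q.RL).indicator (fun v => 2 * v * (1 - q v)) v -
          Q.p f * (Set.Ioc 0 b).indicator (fun v => 2 * v * (1 - q v)) v := by
      intro v hv
      have hv0 : 0 < v := hv
      simp only [hG, Set.indicator_apply, Set.mem_Ioc, hv0, true_and]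
      by_cases hvb : v ≤ b
      · have hvR := hvb.trans hbR
        simp only [hvb, hvR, not_lt.2 hvb, if_true, if_false]
        ring
      · simp only [hvb, not_le.1 hvb, if_true, if_false]
        split_ifs <;> ring
    rw [setIntegral_congr_fun measurableSet_Ioi hsplit]
    have hR' := (intervalIntegrable_iff_integrableOn_Ioc_of_le Q.RL_pos.le).1 hKRi
    have hb' := (intervalIntegrable_iff_integrableOn_Ioc_of_le hb.le).1 hKbi
    have hsub : ∀ t : ℝ, Set.Ioi (0 : ℝ) ∩ Set.Ioc 0 t = Set.Ioc 0 t := fun t =>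
      Set.inter_eq_right.2 Set.Ioc_subset_Ioi_self
    rw [integral_sub ((integrable_indicator_iff measurableSet_Ioc).2 hR').integrableOn
      (((integrable_indicator_iff measurableSet_Ioc).2 hb').integrableOn.const_mul _),
      integral_const_mul, setIntegral_indicator measurableSet_Ioc,
      setIntegral_indicator measurableSet_Ioc, hsub, hsub,
      intervalIntegral.integral_of_le Q.RL_pos.le, intervalIntegral.integral_of_le hb.le]
  have h3 : ∫ x : Plane, G ‖x‖ = Real.pi * ∫ v in Set.Ioi (0 : ℝ), 2 * v * G v := by
    rw [integral_fun_norm_addHaar volume G, hball, finrank_euclideanSpace_fin]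
    simp only [mul_assoc, integral_const_mul, smul_eq_mul, nsmul_eq_mul]
    norm_num
    ring
  rw [h1, h3, h2, hKR, hKb, intervalIntegral.integral_sub ((hJ hb.le).const_mul _)
    (hJ Q.RL_pos.le), intervalIntegral.integral_const_mul]
  ring

/-- Both cases of the theorem at once: the path loss exponent matters only for expressing the radial
integrals in closed form, which is the hypothesis on W. -/
lemma IsPicoTier.tendsto_closedForm_laplace {Ω : Type*} [MeasurableSpace Ω] {μ : Measure Ω}
    [IsProbabilityMeasure μ] {Q : Params Nc} {T : PicoTier Ω Nc} (hT : IsPicoTier μ Q T)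
    (f : Fin Nc) (hf : 0 < Q.p f) {W : ℝ → ℝ → ℝ → ℝ → ℝ}
    (hW : ∀ r, 0 < r → ∀ s τ, 0 ≤ s → 0 ≤ τ → ∀ w, W r w s τ =
      Q.p f * radialInt Q.α Q.Nnak (argX Q w s τ) r -
        radialInt Q.α Q.Nnak (argX Q w s τ) Q.RL) :
    ∀ᵐ r ∂(μ.map (T.servingDist f)), r ≤ Q.RL → ∀ s τ : ℝ, 0 ≤ s → 0 ≤ τ →
      Tendsto (fun u : ℕ => closedForm Q f r (fun w => W r w s τ) u) atTop
        (𝓝 (laplaceInterference μ Q T f r s τ)) := by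
  filter_upwards [hT.ae_laplace_eq f hf, hT.ae_servingDist_pos f hf] with r hr hr0 hrR s τ hs hτ
  have hκ : 0 ≤ s * τ / (Q.P * Q.C * Q.Nant) :=
    div_nonneg (mul_nonneg hs hτ)
      (mul_nonneg (mul_nonneg Q.P_pos.le Q.C_pos.le) (Nat.cast_nonneg _))
  have hlim := tendsto_closedForm Q f hr0 hs hτ (hW r hr0 s τ hs hτ)
  convert hlim using 2
  simp only [laplaceInterference, neg_mul]
  rw [hr hrR _ hκ, interfExponent_eq Q f hs hτ hr0 hrR]
  simp only [hW r hr0 s τ hs hτ]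
  congr 1
  ring

end ClosedForm

end HetNet

end

theorem lemma1 {Ω : Type*} [MeasurableSpace Ω] (μ : Measure Ω) [IsProbabilityMeasure μ]
    {Nc : ℕ} (Q : HetNet.Params Nc) (T : HetNet.PicoTier Ω Nc) (hT : HetNet.IsPicoTier μ Q T)
    (f : Fin Nc) (hf : 0 < Q.p f) :
    (2 < Q.α → ∀ᵐ r ∂(μ.map (T.servingDist f)), r ≤ Q.RL →
      ∀ s τ : ℝ, 0 ≤ s → 0 ≤ τ →
        Tendsto (fun u : ℕ => HetNet.closedForm Q f r (fun w => HetNet.Wgt Q f r w s τ) u) atTop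
          (𝓝 (HetNet.laplaceInterference μ Q T f r s τ))) ∧
    (Q.α = 2 → ∀ᵐ r ∂(μ.map (T.servingDist f)), r ≤ Q.RL →
      ∀ s τ : ℝ, 0 ≤ s → 0 ≤ τ →
        Tendsto (fun u : ℕ => HetNet.closedForm Q f r (fun w => HetNet.Weq Q f r w s τ) u) atTop
          (𝓝 (HetNet.laplaceInterference μ Q T f r s τ))) := by
  exact ⟨fun hα => hT.tendsto_closedForm_laplace f hf fun _ hr _ _ hs hτ w =>
      HetNet.Wgt_eq_radialInt Q hα f hr w hs hτ,
    fun hα => hT.tendsto_closedForm_laplace f hf fun _ hr _ _ hs hτ w =>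
      HetNet.Weq_eq_radialInt Q hα f hr w hs hτ⟩
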